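/- A signed digraph on $[n]=\{1,\dots,n\}$ is a set of arcs $E\subseteq [n]\times[n]\times\{-1,1\}$; an element $(j,i,s)$ of $E$ is an arc from $j$ to $i$ of sign $s$ (loops are allowed, as are two arcs of opposite signs from $j$ to $i$). A cycle of $G$ has no repeated vertices (a loop is a cycle of length one), and its sign is the product of the signs of its arcs. We say that $G$ is a cycle if some cycle of $G$ contains all the vertices and all the arcs of $G$. $G$ is strongly connected if there is a directed path, possibly of length zero, from every vertex to every vertex. A Boolean network is a function $f:\{0,1\}^n\to\{0,1\}^n$. Its signed interaction digraph has vertex set $[n]$ and a positive (respectively negative) arc from $j$ to $i$ if there are $x,y\in\{0,1\}^n$ that differ only in component $j$, with $x_j<y_j$, such that $f_i(x)<f_i(y)$ (respectively $f_i(x)>f_i(y)$). A Boolean network on $G$ is one whose signed interaction digraph is $G$. It is an and-or-net on $G$ if, moreover, for every $i\in[n]$ there is $a\in\{0,1\}$ such that, for every $x\in\{0,1\}^n$, $f_i(x)=a$ if and only if $x_j=a$ for every positive arc of $G$ from $j$ to $i$ and $x_j\neq a$ for every negative arc of $G$ from $j$ to $i$. For $i\in[n]$ let $f^i(x)$ be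 obtained from $x$ by replacing $x_i$ with $f_i(x)$, and for a word $w=i_1i_2\dots i_\ell$ over $[n]$, of length $\ell\ge 0$, let $f^w=f^{i_\ell}\circ\dots\circ f^{i_1}$ ($f^w$ is the identity if $\ell=0$). The word $w$ is a synchronizing word for $f$ if $f^w$ is a constant function, and $f$ is synchronizing if it has a synchronizing word. **Theorem.** Let $G$ be a strongly connected signed digraph on $[n]$ without positive cycles. Then exactly one of the following two statements holds: 1. $G$ is a cycle and no Boolean network on $G$ is synchronizing; 2. every and-or-net on $G$ has a synchronizing word of length at most $10(\sqrt5+1)^n$. -/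

import Mathlib

/-- A signed digraph with vertex set `V`: `G.Arc j i s` says that there is an arc from `j` to `i`
of sign `s`, where the group `ℤˣ = {1, -1}` is the set of signs. Loops are allowed, and there may
be both a positive and a negative arc from one vertex to another. -/
@[ext]
structure SignedDigraph (V : Type*) where
  /-- `Arc j i s`: there is an arc from `j` to `i` of sign `s`. -/
  Arc : V → V → ℤˣ → Prop

namespace SignedDigraph

variable {V : Type*}

/-- The underlying unsigned digraph. -/
def underlying (G : SignedDigraph V) : Digraph V where
  Adj j i := ∃ s, G.Arc j i s

/-- Strong connectivity: there is a directed path (possibly of length zero) from every vertex to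
every vertex. -/
def StronglyConnected (G : SignedDigraph V) : Prop :=
  ∀ i j : V, Relation.ReflTransGen G.underlying.Adj i j

/-- A cycle of `G`, as a simple subgraph: `m + 1 ≥ 1` distinct vertices in cyclic order (the
addition of `Fin (m + 1)` wraps around), with one arc of `G` from each vertex to the next one.
A cycle with one vertex is a loop. -/
structure Cycle (G : SignedDigraph V) where
  /-- The number of vertices is `m + 1`. -/
  m : ℕ
  /-- The vertices, in cyclic order. -/
  vertex : Fin (m + 1) → V
  /-- The sign of the arc from `vertex t` to `vertex (t + 1)`. -/
  arcSign : Fin (m + 1) → ℤˣ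
  vertex_injective : Function.Injective vertex
  arc : ∀ t, G.Arc (vertex t) (vertex (t + 1)) (arcSign t)

/-- The sign of a cycle is the product of the signs of its arcs. -/
def Cycle.sign {G : SignedDigraph V} (C : G.Cycle) : ℤˣ := ∏ t, C.arcSign t

/-- `G` has no positive cycles. -/
def NoPositiveCycles (G : SignedDigraph V) : Prop := ∀ C : G.Cycle, C.sign ≠ 1

/-- `G` is a cycle: it has a cycle that contains all its vertices and all its arcs. -/
def IsCycle (G : SignedDigraph V) : Prop :=
  ∃ C : G.Cycle, Function.Surjective C.vertex ∧
    ∀ j i s, G.Arc j i s → ∃ t, C.vertex t = j ∧ C.vertex (t + 1) = i ∧ C.arcSign t = s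

end SignedDigraph

/-- A Boolean network with component set `V`. -/
abbrev BooleanNetwork (V : Type*) := (V → Bool) → (V → Bool)

namespace BooleanNetwork

variable {V : Type*} [DecidableEq V]

/-- The signed interaction digraph of `f`: there is a positive (negative) arc from `j` to `i` if,
for some configuration `x` with `x j = 0`, switching `x j` to `1` increases (decreases) `f x i`. -/
def interactionDigraph (f : BooleanNetwork V) : SignedDigraph V where
  Arc j i s := ∃ x : V → Bool, x j = false ∧
    ((s = 1 ∧ f x i < f (Function.update x j true) i) ∨
      (s = -1 ∧ f (Function.update x j true) i < f x i))

/-- `f` is a Boolean network on `G`. -/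
def IsOn (f : BooleanNetwork V) (G : SignedDigraph V) : Prop := f.interactionDigraph = G

/-- `f` is an and-or-net: each component is a conjunction (`a = true`) or a disjunction
(`a = false`) of the positive or negative literals given by the in-neighbors. -/
def IsAndOrNet (f : BooleanNetwork V) : Prop :=
  ∀ i, ∃ a : Bool, ∀ x : V → Bool, f x i = a ↔
    (∀ j, f.interactionDigraph.Arc j i 1 → x j = a) ∧
      (∀ j, f.interactionDigraph.Arc j i (-1) → x j ≠ a)

/-- The asynchronous update of the component `i` only. -/
def updateAt (f : BooleanNetwork V) (i : V) (x : V → Bool) : V → Bool :=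
  Function.update x i (f x i)

/-- The action of a word on a configuration; the first letter acts first. -/
def run (f : BooleanNetwork V) (w : List V) (x : V → Bool) : V → Bool :=
  w.foldl (fun y i => f.updateAt i y) x

/-- `w` is a synchronizing word for `f`: its action is a constant function. -/
def IsSynchronizingWord (f : BooleanNetwork V) (w : List V) : Prop :=
  ∃ c : V → Bool, ∀ x : V → Bool, f.run w x = c

/-- `f` is synchronizing: it has a synchronizing word. -/
def IsSynchronizing (f : BooleanNetwork V) : Prop := ∃ w : List V, f.IsSynchronizingWord w

end BooleanNetwork

/-! If `G` is a cycle, each component depends on exactly one component, so a network on `G` commutes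
with complementation; a constant `f^w` would then equal its own complement. Since a cycle also
carries an and-or-net, the second statement fails there.

If `G` is not a cycle, switching turns an and-or-net into a conjunctive one (`toAndNet`). Call an
arc consistent in a state if its literal has the value of its target. A cycle of consistent arcs is
positive, so every nonempty set has a vertex without consistent arc from the set (`NPC`). The main
use is `NPC.not_cons`: if all vertices of a set but one have a consistent arc from the set, all arcs
from the set to the last one are inconsistent. If that vertex is false and its literals from outside
are true, its update makes it true. Growing sets of consistently fed vertices therefore makes it
possible to flip chosen vertices (`exists_word_grow`), at a Fibonacci cost.

Two states are merged as follows (`exists_word_merge`). The set where they differ is shrunk until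
each of its vertices has one in-neighbor in it and all literals entering it are true
(`exists_word_functional`). The obstruction is then a family of disjoint chordless cycles with
antipodal values (`Core`), the other differing vertices having consistent differing parents
(`Parents`). Grow the differing set by consistently fed vertices. It cannot reach all vertices, by
`NPC`, so at some point the update of a vertex `k` entering a cycle changes its value in one of the
states (`exists_word_event`). With `k` blocking in at least one state, all cycles fed by `k` can be
given equal values, and the invariant is restored for the other cycles (`exists_word_of_event`).
When no cycle is left, `Parents` and `NPC` force equality.

A merge costs at most `2 * Nat.fib (n + 5)`. Merging the `2 ^ n` states one after the other gives
the bound, because `√5 + 1` is twice the golden ratio. -/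

/-- A conjunctive Boolean network: `E u v` says that there is an arc from `u` to `v`, and `p u v`
is the value of `u` for which the literal of `u` at `v` is true. -/
structure AndNet (V : Type*) where
  /-- The arcs. -/
  E : V → V → Prop
  /-- The value of the source that makes the literal true. -/
  p : V → V → Bool

namespace AndNet

open BooleanNetwork

/-! ### Consistent arcs and the absence of positive cycles -/

section Basic

variable {V : Type*}

open Classical in
/-- The Boolean network: each component is the conjunction of its literals. -/
noncomputable def net (N : AndNet V) : BooleanNetwork V :=
  fun x v => decide (∀ u, N.E u v → x u = N.p u v)

/-- The arc from `u` to `v` is consistent in `x` if the value of its literal is the value of `v`. -/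
def Cons (N : AndNet V) (x : V → Bool) (u v : V) : Prop := x u = N.p u v ↔ x v = true

/-- `v` has a consistent incoming arc from `X`. -/
def HasPar (N : AndNet V) (x : V → Bool) (X : Finset V) (v : V) : Prop :=
  ∃ u ∈ X, N.E u v ∧ N.Cons x u v

/-- Every nonempty set contains a vertex without consistent incoming arc from the set. -/
def NPC (N : AndNet V) : Prop :=
  ∀ (x : V → Bool) (S : Finset V), S.Nonempty → ∃ v ∈ S, ¬ N.HasPar x S v

/-- `C` induces a strongly connected subgraph. -/
def StrongOn (N : AndNet V) (C : Finset V) : Prop :=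
  ∀ Y ⊆ C, Y.Nonempty → Y ≠ C → ∃ u ∈ Y, ∃ v ∈ C, v ∉ Y ∧ N.E u v

/-- `C` contains all the in-neighbors in `U` of its members. -/
def PredClosed (N : AndNet V) (U C : Finset V) : Prop :=
  ∀ v ∈ C, ∀ u ∈ U, N.E u v → u ∈ C

variable {N : AndNet V} {x y : V → Bool} {u v i : V} {C X Y : Finset V}

theorem net_eq_true : N.net x v = true ↔ ∀ u, N.E u v → x u = N.p u v := by
  simp [net]

theorem net_eq_false : N.net x v = false ↔ ∃ u, N.E u v ∧ x u ≠ N.p u v := by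
  simp [net]

theorem net_congr (h : ∀ u, N.E u v → x u = y u) : N.net x v = N.net y v := by
  rw [Bool.eq_iff_iff, net_eq_true, net_eq_true]
  exact forall₂_congr fun u hu => by rw [h u hu]

theorem cons_of_true (h : x v = true) : N.Cons x u v ↔ x u = N.p u v := by
  simp [Cons, h]

theorem cons_of_false (h : x v = false) : N.Cons x u v ↔ x u ≠ N.p u v := by
  simp [Cons, h]

theorem cons_congr (hu : x u = y u) (hv : x v = y v) : N.Cons x u v ↔ N.Cons y u v := by
  simp [Cons, hu, hv]

theorem HasPar.congr (h : N.HasPar x X v) (hX : ∀ u ∈ X, x u = y u) (hv : x v = y v) :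
    N.HasPar y X v := by
  obtain ⟨u, hu, he, hc⟩ := h
  exact ⟨u, hu, he, (cons_congr (hX u hu) hv).1 hc⟩

theorem HasPar.mono (h : N.HasPar x X v) (hX : X ⊆ Y) : N.HasPar x Y v := by
  obtain ⟨u, hu, he⟩ := h
  exact ⟨u, hX hu, he⟩

theorem NPC.not_cons (hN : N.NPC) (hi : i ∈ C)
    (h : ∀ v ∈ C, v ≠ i → N.HasPar x C v) (hu : u ∈ C) (he : N.E u i) : ¬ N.Cons x u i := by
  obtain ⟨v, hv, hv'⟩ := hN x C ⟨i, hi⟩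
  have : v = i := by
    by_contra hne
    exact hv' (h v hv hne)
  subst this
  exact fun hc => hv' ⟨u, hu, he, hc⟩

theorem NPC.loop (hN : N.NPC) (he : N.E v v) : N.p v v = false := by
  obtain ⟨w, hw, hw'⟩ := hN (fun _ => true) {v} (by simp)
  rw [Finset.mem_singleton] at hw
  subst hw
  by_contra hp
  exact hw' ⟨w, by simp, he, by simp_all [Cons]⟩

/-- An initial strongly connected component of the subgraph induced by `U`, obtained as a minimal
nonempty subset closed under in-neighbors. -/
theorem exists_predClosed_strongOn (N : AndNet V) [DecidableEq V] {U : Finset V}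
    (hU : U.Nonempty) :
    ∃ C ⊆ U, C.Nonempty ∧ N.PredClosed U C ∧ N.StrongOn C := by
  obtain ⟨C, hCU, hC⟩ := exists_minimal_le_of_wellFoundedLT
    (fun C : Finset V => C ⊆ U ∧ C.Nonempty ∧ N.PredClosed U C) U
    ⟨subset_rfl, hU, fun v _ u hu _ => hu⟩
  obtain ⟨⟨_, hne, hp⟩, hmin⟩ := hC
  refine ⟨C, hCU, hne, hp, fun Y hY hYne hYC => ?_⟩
  by_contra! hcon
  have hlt : C \ Y ⊆ C := Finset.sdiff_subset
  have := hmin (y := C \ Y) ⟨hlt.trans hCU, ?_, ?_⟩ hlt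
  · obtain ⟨u, hu⟩ := hYne
    exact (Finset.mem_sdiff.1 (this (hY hu))).2 hu
  · rw [Finset.nonempty_iff_ne_empty, Ne, Finset.sdiff_eq_empty_iff_subset]
    exact fun h => hYC (hY.antisymm h)
  · intro v hv u hu he
    rw [Finset.mem_sdiff] at hv ⊢
    exact ⟨hp v hv.1 u hu he, fun huY => hcon u huY v hv.1 hv.2 he⟩

end Basic

/-! ### Action of words -/

section Run

variable {V : Type*} [DecidableEq V] {f : BooleanNetwork V} {x : V → Bool}

theorem run_nil : f.run [] x = x := rfl

theorem run_cons (i : V) (w : List V) : f.run (i :: w) x = f.run w (f.updateAt i x) := rfl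

theorem run_append (w w' : List V) : f.run (w ++ w') x = f.run w' (f.run w x) := by
  simp [run]

theorem run_concat (w : List V) (i : V) : f.run (w ++ [i]) x = f.updateAt i (f.run w x) := by
  simp [run]

theorem updateAt_self (i : V) : f.updateAt i x i = f x i := by simp [updateAt]

theorem updateAt_of_ne {i v : V} (h : v ≠ i) : f.updateAt i x v = x v := by
  simp [updateAt, h]

theorem run_of_notMem {w : List V} {v : V} (h : v ∉ w) : f.run w x v = x v := by
  induction w generalizing x with
  | nil => rfl
  | cons i w ih =>
    rw [List.mem_cons, not_or] at h
    rw [run_cons, ih h.2, updateAt_of_ne h.1]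

end Run

/-! ### Growing a consistently fed set inside a strongly connected set -/

section Growth

/-- The cost of growing a set by `u` vertices: `growCost u + 2` is a Fibonacci number. -/
def growCost (u : ℕ) : ℕ := Nat.fib (u + 3) - 2

theorem growCost_add_two_eq (u : ℕ) : growCost u + 2 = Nat.fib (u + 3) :=
  Nat.sub_add_cancel (Nat.fib_mono (show 3 ≤ u + 3 by omega))

theorem growCost_mono : Monotone growCost := fun a b h =>
  Nat.sub_le_sub_right (Nat.fib_mono (by omega)) 2

theorem growCost_add_two (u : ℕ) : growCost (u + 2) = growCost (u + 1) + growCost u + 2 := by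
  have h0 := growCost_add_two_eq u
  have h1 := growCost_add_two_eq (u + 1)
  have h2 := growCost_add_two_eq (u + 2)
  have : Nat.fib (u + 2 + 3) = Nat.fib (u + 3) + Nat.fib (u + 1 + 3) := Nat.fib_add_two
  omega

theorem growCost_zero : growCost 0 = 0 := rfl

theorem growCost_one : growCost 1 = 1 := rfl

theorem growCost_succ (u : ℕ) : growCost u + 1 ≤ growCost (u + 1) := by
  cases u with
  | zero => simp [growCost_zero, growCost_one]
  | succ u => rw [growCost_add_two]; omega

/-- The budget for the two ways of treating an initial component with `c` vertices in
`exists_word_grow`. Here its growth starts from two vertices and one vertex is gained; in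
`growCost_case_one` it starts from one vertex and two are gained. -/
theorem growCost_case_two {c u : ℕ} (hc : 2 ≤ c) (hcu : c ≤ u) :
    growCost (c - 2) + 2 + growCost (u - 1) ≤ growCost u := by
  obtain ⟨u, rfl⟩ : ∃ k, u = k + 2 := ⟨u - 2, by omega⟩
  have h1 : growCost (c - 2) ≤ growCost u := growCost_mono (by omega)
  rw [growCost_add_two]
  simp only [show u + 2 - 1 = u + 1 from rfl]
  omega

theorem growCost_case_one {c u : ℕ} (hc : 2 ≤ c) (hcu : c ≤ u) :
    growCost (c - 1) + 2 + growCost (u - 2) ≤ growCost u := by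
  obtain ⟨u, rfl⟩ : ∃ k, u = k + 2 := ⟨u - 2, by omega⟩
  have h1 : growCost (c - 1) ≤ growCost (u + 1) := growCost_mono (by omega)
  rw [growCost_add_two]
  simp only [show u + 2 - 2 = u from rfl]
  omega

variable {V : Type*} [DecidableEq V] {N : AndNet V}

/-- Once `C` is grown from a false vertex `i`, `NPC.not_cons` makes all literals at `i` from `C`
true, so `i` can be flipped. A vertex of `C \ X` is added to `X` as soon as it has a consistent arc
from `X`; when this requires making a false vertex true, the lemma is applied recursively to an
initial component of `C \ X`. -/
theorem exists_word_grow (hN : N.NPC) (n : ℕ) : ∀ (C X : Finset V) (i : V) (x : V → Bool),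
    N.StrongOn C → i ∈ X → X ⊆ C → (C \ X).card = n →
    (∀ v ∈ C, ∀ u ∉ C, N.E u v → x u = N.p u v) →
    (∀ v ∈ X, v ≠ i → N.HasPar x X v) →
    ∃ w : List V, (∀ l ∈ w, l ∈ C ∧ l ∉ X) ∧ w.length ≤ growCost n ∧
      ∀ v ∈ C, v ≠ i → N.HasPar (N.net.run w x) C v := by
  induction n using Nat.strong_induction_on with
  | _ n ih =>
  intro C X i x hC hi hXC hcard hout hpar
  by_cases hU : (C \ X).Nonempty
  swap
  · have : X = C := hXC.antisymm (by
      rwa [Finset.not_nonempty_iff_eq_empty, Finset.sdiff_eq_empty_iff_subset] at hU)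
    subst this
    exact ⟨[], by simp, by simp, hpar⟩
  -- enlarging `X` after a word that does not touch it
  have key : ∀ (w : List V) (A : Finset V), (∀ l ∈ w, l ∈ C ∧ l ∉ X) → A ⊆ C \ X → A.Nonempty →
      (∀ v ∈ A, N.HasPar (N.net.run w x) (X ∪ A) v) →
      w.length + growCost (n - A.card) ≤ growCost n →
      ∃ w : List V, (∀ l ∈ w, l ∈ C ∧ l ∉ X) ∧ w.length ≤ growCost n ∧
      ∀ v ∈ C, v ≠ i → N.HasPar (N.net.run w x) C v := by
    intro w A hw hA hAne hAp hlen
    have hcA : (C \ (X ∪ A)).card = n - A.card := by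
      rw [← Finset.sup_eq_union, ← sdiff_sdiff_left, Finset.card_sdiff_of_subset hA, hcard]
    have hAcard : A.card ≤ n := hcard ▸ Finset.card_le_card hA
    have hApos := hAne.card_pos
    have hXfix : ∀ v ∈ X, N.net.run w x v = x v := fun v hv =>
      run_of_notMem fun h => (hw v h).2 hv
    obtain ⟨w', hw', hl', hp'⟩ := ih (n - A.card) (by omega) C (X ∪ A) i (N.net.run w x) hC
      (Finset.mem_union_left _ hi)
      (Finset.union_subset hXC (hA.trans Finset.sdiff_subset)) hcA
      (fun v hv u hu he => by
        rw [run_of_notMem fun h => hu (hw u h).1]; exact hout v hv u hu he)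
      (fun v hv hne => by
        rcases Finset.mem_union.1 hv with h | h
        · exact ((hpar v h hne).congr (fun u hu => (hXfix u hu).symm) (hXfix v h).symm).mono
            Finset.subset_union_left
        · exact hAp v h)
    refine ⟨w ++ w', ?_, by rw [List.length_append]; omega, ?_⟩
    · intro l hl
      rcases List.mem_append.1 hl with h | h
      · exact hw l h
      · exact ⟨(hw' l h).1, fun hX => (hw' l h).2 (Finset.mem_union_left _ hX)⟩
    · rw [run_append]; exact hp'
  have hn : 1 ≤ n := hcard ▸ hU.card_pos
  have hn1 : growCost (n - 1) + 1 ≤ growCost n := by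
    have := growCost_succ (n - 1)
    rwa [Nat.sub_add_cancel hn] at this
  have single : ∀ v ∈ C \ X, ∀ u ∈ X, N.E u v → N.Cons (N.net.updateAt v x) u v →
      ∃ w : List V, (∀ l ∈ w, l ∈ C ∧ l ∉ X) ∧ w.length ≤ growCost n ∧
      ∀ v ∈ C, v ≠ i → N.HasPar (N.net.run w x) C v := by
    intro v hv u hu he hc
    refine key [v] {v} (by simpa using hv) (by simpa using hv) (by simp) ?_
      (by simp; omega)
    intro v' hv'
    rw [Finset.mem_singleton] at hv'
    subst hv'
    exact ⟨u, Finset.mem_union_left _ hu, he, hc⟩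
  -- A false literal makes its target false when updated, and the arc becomes consistent.
  by_cases h1 : ∃ v ∈ C \ X, ∃ u ∈ X, N.E u v ∧ x u ≠ N.p u v
  · obtain ⟨v, hv, u, hu, he, hl⟩ := h1
    refine single v hv u hu he ?_
    have huv : u ≠ v := fun h => (Finset.mem_sdiff.1 hv).2 (h ▸ hu)
    rw [cons_of_false, updateAt_of_ne huv]
    · exact hl
    · rw [updateAt_self, net_eq_false]
      exact ⟨u, he, hl⟩
  push Not at h1
  by_cases h2 : ∃ v ∈ C \ X, x v = true ∧ ∃ u ∈ X, N.E u v
  · obtain ⟨v, hv, hxv, u, hu, he⟩ := h2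
    refine key [] {v} (by simp) (by simpa using hv) (by simp) ?_
      (by simp; omega)
    intro v' hv'
    rw [Finset.mem_singleton] at hv'
    subst hv'
    exact ⟨u, Finset.mem_union_left _ hu, he, (cons_of_true hxv).2 (h1 _ hv u hu he)⟩
  push Not at h2
  -- From here on, every arc from `X` to `C \ X` has a true literal and a false target: progress
  -- requires flipping such a target. An initial component `C'` receives only true literals, so the
  -- induction hypothesis applies inside it.
  obtain ⟨C', hC'U, hC'ne, hC'p, hC's⟩ := N.exists_predClosed_strongOn hU
  have hC'C : C' ⊆ C := hC'U.trans Finset.sdiff_subset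
  -- the entry vertex
  obtain ⟨u, huX, v, hvC', he⟩ : ∃ u ∈ X, ∃ v ∈ C', N.E u v := by
    obtain ⟨u, hu, v, hv, hvY, he⟩ := hC (C \ C') Finset.sdiff_subset
      ⟨i, Finset.mem_sdiff.2 ⟨hXC hi, fun h => (Finset.mem_sdiff.1 (hC'U h)).2 hi⟩⟩
      (fun h => by
        obtain ⟨v, hv⟩ := hC'ne
        have := h.symm ▸ hC'C hv
        exact (Finset.mem_sdiff.1 this).2 hv)
    have hv' : v ∈ C' := by simpa [hv] using hvY
    rw [Finset.mem_sdiff] at hu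
    refine ⟨u, ?_, v, hv', he⟩
    by_contra huX
    exact hu.2 (hC'p v hv' u (Finset.mem_sdiff.2 ⟨hu.1, huX⟩) he)
  have hvU := hC'U hvC'
  have hvX : v ∉ X := (Finset.mem_sdiff.1 hvU).2
  have huv : u ≠ v := fun h => hvX (h ▸ huX)
  have hxv : x v = false := by
    by_contra h
    exact h2 v hvU (by simpa using h) u huX he
  -- the literals into `C'` from outside are true
  have hout' : ∀ (w : List V), (∀ l ∈ w, l ∈ C') → ∀ a ∈ C', ∀ b ∉ C', N.E b a →
      N.net.run w x b = N.p b a := by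
    intro w hw a ha b hb hba
    rw [run_of_notMem fun h => hb (hw b h)]
    by_cases hbC : b ∈ C
    · by_cases hbX : b ∈ X
      · exact h1 a (hC'U ha) b hbX hba
      · exact absurd (hC'p a ha b (Finset.mem_sdiff.2 ⟨hbC, hbX⟩) hba) hb
    · exact hout a (hC'C ha) b hbC hba
  -- after growing `C'` from `v`, the vertex `v` can be flipped
  have flip : ∀ w : List V, (∀ l ∈ w, l ∈ C') → N.net.run w x v = false →
      (∀ a ∈ C', a ≠ v → N.HasPar (N.net.run w x) C' a) → N.net (N.net.run w x) v = true := by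
    intro w hw hwv hp
    rw [net_eq_true]
    intro b hb
    by_cases hbC : b ∈ C'
    · have := hN.not_cons hvC' hp hbC hb
      rwa [cons_of_false hwv, not_not] at this
    · exact hout' w hw v hvC' b hbC hb
  have hmem : ∀ w : List V, (∀ l ∈ w, l ∈ C') → ∀ l ∈ w, l ∈ C ∧ l ∉ X := fun w hw l hl =>
    Finset.mem_sdiff.1 (hC'U (hw l hl))
  have hflipcons : ∀ w : List V, (∀ l ∈ w, l ∈ C') → N.net (N.net.run w x) v = true →
      N.Cons (N.net.run (w ++ [v]) x) u v := by
    intro w hw h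
    rw [run_concat, cons_of_true (by rw [updateAt_self, h]), updateAt_of_ne huv,
      run_of_notMem fun h => (hmem w hw u h).2 huX]
    exact h1 v hvU u huX he
  have hc' : C'.card ≤ n := hcard ▸ Finset.card_le_card hC'U
  by_cases hc1 : C' = {v}
  · refine key [v] {v} (by simpa using hvU) (by simpa using hvU) (by simp) ?_
      (by simp; omega)
    intro v' hv'
    rw [Finset.mem_singleton] at hv'
    subst hv'
    refine ⟨u, Finset.mem_union_left _ huX, he, ?_⟩
    refine hflipcons [] (by simp) (flip [] (by simp) hxv ?_)
    intro a ha hne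
    rw [hc1, Finset.mem_singleton] at ha
    exact absurd ha hne
  obtain ⟨v', hv', t, htC', htv, hvt⟩ := hC's {v} (by simpa using hvC') (by simp)
    (fun h => hc1 h.symm)
  rw [Finset.mem_singleton] at hv' htv
  subst hv'
  have hc2 : 2 ≤ C'.card := by
    have : ({v', t} : Finset V) ⊆ C' := by
      intro a ha
      simp only [Finset.mem_insert, Finset.mem_singleton] at ha
      rcases ha with rfl | rfl <;> assumption
    have h' := Finset.card_le_card this
    rwa [Finset.card_pair (Ne.symm htv)] at h'
  have hvt' : v' ≠ t := Ne.symm htv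
  -- The out-neighbor `t` of `v'` in `C'` is what keeps the cost Fibonacci. If the literal of `v'`
  -- at `t` is true, flipping `v'` makes it false, and one more update adds `t` to `X` as well. If
  -- it is false, updating `t` first gives a head start of two vertices for the growth of `C'`.
  by_cases hlit : x v' = N.p v' t
  · obtain ⟨w, hw, hwl, hwp⟩ := ih (C'.card - 1) (by omega) C' {v'} v' x hC's (by simp)
      (by simpa using hvC')
      (by rw [Finset.card_sdiff_of_subset (by simpa using hvC')]; simp)
      (hout' [] (by simp)) (by simp)
    have hwC : ∀ l ∈ w, l ∈ C' := fun l hl => (hw l hl).1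
    have hwv : N.net.run w x v' = false := by
      rw [run_of_notMem fun h => (hw v' h).2 (by simp), hxv]
    have hfl := flip w hwC hwv hwp
    have h3 : N.net.run (w ++ [v']) x v' = true := by rw [run_concat, updateAt_self, hfl]
    have h4 : N.net (N.net.run (w ++ [v']) x) t = false := by
      rw [net_eq_false]
      refine ⟨v', hvt, ?_⟩
      rw [h3, ← hlit, hxv]; simp
    refine key ((w ++ [v']) ++ [t]) {v', t} (hmem _ ?_) ?_ (by simp) ?_ ?_
    · intro l hl
      simp only [List.mem_append, List.mem_singleton] at hl
      rcases hl with (h | rfl) | rfl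
      exacts [hwC _ h, hvC', htC']
    · intro a ha
      simp only [Finset.mem_insert, Finset.mem_singleton] at ha
      rcases ha with rfl | rfl
      exacts [hvU, hC'U htC']
    · intro a ha
      have htU := hC'U htC'
      have hut : u ≠ t := fun h => (Finset.mem_sdiff.1 htU).2 (h ▸ huX)
      simp only [Finset.mem_insert, Finset.mem_singleton] at ha
      rw [run_concat]
      rcases ha with rfl | rfl
      · refine ⟨u, by simp [huX], he, ?_⟩
        have := hflipcons w hwC hfl
        exact (cons_congr (updateAt_of_ne hut) (updateAt_of_ne hvt')).2 this
      · refine ⟨v', by simp, hvt, ?_⟩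
        rw [cons_of_false (by rw [updateAt_self, h4]), updateAt_of_ne hvt', h3, ← hlit, hxv]
        simp
    · rw [Finset.card_pair hvt']
      have := growCost_case_one hc2 hc'
      simp only [List.length_append, List.length_singleton]
      omega
  · have h4 : N.net x t = false := net_eq_false.2 ⟨v', hvt, hlit⟩
    have hx1v : N.net.updateAt t x v' = false := by rw [updateAt_of_ne hvt', hxv]
    obtain ⟨w, hw, hwl, hwp⟩ := ih (C'.card - 2) (by omega) C' {v', t} v' (N.net.updateAt t x) hC's
      (by simp) (by
        intro a ha
        simp only [Finset.mem_insert, Finset.mem_singleton] at ha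
        rcases ha with rfl | rfl <;> assumption)
      (by
        rw [Finset.card_sdiff_of_subset, Finset.card_pair hvt']
        intro a ha
        simp only [Finset.mem_insert, Finset.mem_singleton] at ha
        rcases ha with rfl | rfl <;> assumption)
      (hout' [t] (by simpa using htC')) (by
        intro a ha hne
        simp only [Finset.mem_insert, Finset.mem_singleton] at ha
        rcases ha with rfl | rfl
        · exact absurd rfl hne
        · refine ⟨v', by simp, hvt, ?_⟩
          rw [cons_of_false (by rw [updateAt_self, h4]), updateAt_of_ne hvt']
          exact hlit)
    have hwC : ∀ l ∈ t :: w, l ∈ C' := by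
      intro l hl
      rcases List.mem_cons.1 hl with rfl | h
      exacts [htC', (hw l h).1]
    have hwv : N.net.run (t :: w) x v' = false := by
      rw [run_cons, run_of_notMem fun h => (hw v' h).2 (by simp), hx1v]
    have hfl := flip (t :: w) hwC hwv hwp
    refine key ((t :: w) ++ [v']) {v'} (hmem _ ?_) (by simpa using hvU) (by simp) ?_ ?_
    · intro l hl
      rcases List.mem_append.1 hl with h | h
      · exact hwC l h
      · rw [List.mem_singleton] at h; exact h ▸ hvC'
    · intro a ha
      rw [Finset.mem_singleton] at ha
      subst ha
      exact ⟨u, by simp [huX], he, hflipcons _ hwC hfl⟩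
    · have := growCost_case_two hc2 hc'
      simp only [List.length_append, List.length_cons, List.length_nil, Finset.card_singleton]
      omega

end Growth

/-! ### Chordless cycles -/

section Ring

variable {V : Type*} {N : AndNet V} {S : Finset V} {s : ℕ → V}

/-- Every nonempty proper set of vertices has an outgoing arc. -/
def Strong (N : AndNet V) : Prop :=
  ∀ X : Set V, X.Nonempty → X ≠ Set.univ → ∃ u ∈ X, ∃ v ∉ X, N.E u v

/-- `S` induces a chordless cycle. -/
structure IsRing (N : AndNet V) (S : Finset V) : Prop where
  nonempty : S.Nonempty
  existsUnique : ∀ a ∈ S, ∃! u, u ∈ S ∧ N.E u a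
  minimal : ∀ T ⊆ S, T.Nonempty → N.PredClosed S T → T = S

/-- `s` enumerates periodically the vertices of the chordless cycle induced by `S`. -/
structure RingEnum (N : AndNet V) (S : Finset V) (s : ℕ → V) : Prop where
  mem : ∀ t, s t ∈ S
  pred : ∀ t, ∀ u ∈ S, N.E u (s (t + 1)) ↔ u = s t
  period : ∀ t, s (t + S.card) = s t
  surj : ∀ a ∈ S, ∃ t < S.card, s t = a

theorem RingEnum.inj (h : N.RingEnum S s) {t t' : ℕ} (ht : t < S.card) (ht' : t' < S.card)
    (hs : s t = s t') : t = t' := by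
  have := Finset.injOn_of_surjOn_of_card_le (s := Finset.range S.card) (t := S) s
    (fun t _ => h.mem t) (fun a ha => by
      obtain ⟨t, ht, rfl⟩ := h.surj a ha
      exact ⟨t, by simpa using ht, rfl⟩) (by simp)
  exact this (by simpa using ht) (by simpa using ht') hs

theorem RingEnum.shift (h : N.RingEnum S s) {m : ℕ} (hm : m ≤ S.card) :
    N.RingEnum S (fun t => s (m + t)) where
  mem t := h.mem _
  pred t u hu := h.pred _ u hu
  period t := by rw [← add_assoc]; exact h.period _
  surj a ha := by
    obtain ⟨t, ht, rfl⟩ := h.surj a ha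
    by_cases hmt : m ≤ t
    · exact ⟨t - m, by omega, by rw [Nat.add_sub_cancel' hmt]⟩
    · refine ⟨t + S.card - m, by omega, ?_⟩
      rw [Nat.add_sub_cancel' (by omega), h.period]

theorem RingEnum.pred_zero (h : N.RingEnum S s) {u : V} (hu : u ∈ S) :
    N.E u (s 0) ↔ u = s (S.card - 1) := by
  have hpos : 0 < S.card := Finset.card_pos.2 ⟨_, h.mem 0⟩
  rw [← h.pred _ u hu, Nat.sub_add_cancel hpos, ← h.period 0, zero_add]

theorem IsRing.exists_enum [DecidableEq V] (h : N.IsRing S) {b : V} (hb : b ∈ S) :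
    ∃ s : ℕ → V, s 0 = b ∧ N.RingEnum S s := by
  have h1 : ∀ a, ∃ u, a ∈ S → (u ∈ S ∧ N.E u a) ∧ ∀ u' ∈ S, N.E u' a → u' = u := by
    intro a
    by_cases ha : a ∈ S
    · obtain ⟨u, hu, hu'⟩ := h.existsUnique a ha
      exact ⟨u, fun _ => ⟨hu, fun u' h1 h2 => hu' u' ⟨h1, h2⟩⟩⟩
    · exact ⟨a, fun h => absurd h ha⟩
  choose π hπ using h1
  have hmem : ∀ a ∈ S, ∀ t, π^[t] a ∈ S := by
    intro a ha t
    induction t with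
    | zero => exact ha
    | succ t ih => rw [Function.iterate_succ_apply']; exact (hπ _ ih).1.1
  have hall : ∀ a ∈ S, ∀ c ∈ S, ∃ t, π^[t] a = c := by
    classical
    intro a ha c hc
    have := h.minimal (S.filter fun c => ∃ t, π^[t] a = c) (Finset.filter_subset _ _)
      ⟨a, by simp only [Finset.mem_filter]; exact ⟨ha, 0, rfl⟩⟩ (by
        intro v hv u hu he
        rw [Finset.mem_filter] at hv ⊢
        obtain ⟨hv, t, rfl⟩ := hv
        exact ⟨hu, t + 1, by
          rw [Function.iterate_succ_apply']; exact ((hπ _ hv).2 u hu he).symm⟩)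
    rw [← this, Finset.mem_filter] at hc
    exact hc.2
  obtain ⟨t0, ht0⟩ := hall (π b) (hπ b hb).1.1 b hb
  have hper : b ∈ Function.periodicPts π := ⟨t0 + 1, Nat.succ_pos _, by
    rw [Function.IsPeriodicPt, Function.IsFixedPt, Function.iterate_succ_apply, ht0]⟩
  set l := Function.minimalPeriod π b with hl
  have hlpos : 0 < l := Function.minimalPeriod_pos_of_mem_periodicPts hper
  have hlper : π^[l] b = b := Function.iterate_minimalPeriod
  have hcard : S.card = l := by
    have : S = (Finset.range l).image fun t => π^[t] b := by
      ext c
      simp only [Finset.mem_image, Finset.mem_range]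
      constructor
      · intro hc
        obtain ⟨t, rfl⟩ := hall b hb c hc
        exact ⟨t % l, Nat.mod_lt _ hlpos, Function.iterate_mod_minimalPeriod_eq⟩
      · rintro ⟨t, _, rfl⟩
        exact hmem b hb t
    rw [this, Finset.card_image_of_injOn, Finset.card_range]
    intro t ht t' ht' he
    exact Function.iterate_injOn_Iio_minimalPeriod (by simpa using ht) (by simpa using ht') he
  have hmul : ∀ m, π^[l * m] b = b := fun m =>
    ((Function.isPeriodicPt_minimalPeriod π b).mul_const m)
  -- The map `π` goes to the predecessor and has period `l` at `b`, so `l - 1` steps back are one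
  -- step forward.
  set s : ℕ → V := fun t => π^[(l - 1) * t] b with hs
  have hsS : ∀ t, s t ∈ S := fun t => hmem b hb _
  have hπs : ∀ t, π (s (t + 1)) = s t := by
    intro t
    simp only [hs]
    rw [← Function.iterate_succ_apply' π,
      show ((l - 1) * (t + 1)).succ = (l - 1) * t + l by
        rw [Nat.mul_succ, Nat.succ_eq_add_one]; omega,
      Function.iterate_add_apply, hlper]
  refine ⟨s, by simp [hs], hsS, ?_, ?_, ?_⟩
  · intro t u hu
    constructor
    · intro he
      rw [(hπ _ (hsS (t + 1))).2 u hu he, hπs]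
    · rintro rfl
      have := (hπ _ (hsS (t + 1))).1.2
      rwa [hπs] at this
  · intro t
    simp only [hs, hcard]
    rw [Nat.mul_add, mul_comm (l - 1) l, Function.iterate_add_apply, hmul]
  · intro a ha
    obtain ⟨t, ht⟩ := hall b hb a ha
    have hlt := Nat.mod_lt t hlpos
    refine ⟨(l - t % l) % l, by rw [hcard]; exact Nat.mod_lt _ hlpos, ?_⟩
    rw [← ht, ← Function.iterate_mod_minimalPeriod_eq, ← hl]
    simp only [hs]
    rcases Nat.eq_zero_or_pos (t % l) with h0 | h0
    · simp [h0]
    · rw [Nat.mod_eq_of_lt (by omega)]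
      obtain ⟨d, hd⟩ : ∃ d, l = t % l + d + 1 := ⟨l - t % l - 1, by omega⟩
      have : (l - 1) * (l - t % l) = t % l + l * (l - t % l - 1) := by
        generalize t % l = r at *
        have e1 : l - 1 = r + d := by omega
        have e2 : l - r = d + 1 := by omega
        rw [e1, e2, hd, Nat.add_sub_cancel]
        ring
      rw [this, Function.iterate_add_apply, hmul]

/-- The values along an enumeration `s` that make the arcs `(s t, s (t + 1))` consistent, from
the value `b` of `s 0`. -/
def chain (N : AndNet V) (s : ℕ → V) (b : Bool) : ℕ → Bool
  | 0 => b
  | t + 1 => decide (N.chain s b t = N.p (s t) (s (t + 1)))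

theorem chain_true (t : ℕ) : N.chain s true t = !N.chain s false t := by
  induction t with
  | zero => rfl
  | succ t ih =>
    simp only [chain, ih]
    cases N.chain s false t <;> cases N.p (s t) (s (t + 1)) <;> rfl

theorem hasPar_chain (hs : N.RingEnum S s) {b : Bool} {lab : V → Bool} {X : Finset V} {t : ℕ}
    (h0 : lab (s t) = N.chain s b t) (h1 : lab (s (t + 1)) = N.chain s b (t + 1))
    (hX : s t ∈ X) : N.HasPar lab X (s (t + 1)) :=
  ⟨s t, hX, (hs.pred t _ (hs.mem t)).2 rfl, by rw [Cons, h0, h1]; simp [chain]⟩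

theorem RingEnum.exists_base (hs : N.RingEnum S s) (val : ℕ → Bool) :
    ∃ base : V → Bool, ∀ t < S.card, base (s t) = val t := by
  classical
  refine ⟨fun a => if h : ∃ t < S.card, s t = a then val h.choose else false, fun t ht => ?_⟩
  have h : ∃ t' < S.card, s t' = s t := ⟨t, ht, rfl⟩
  simp only [dif_pos h]
  rw [hs.inj h.choose_spec.1 ht h.choose_spec.2]

/-- The vertices that cannot reach `k` while avoiding `S` form a proper set containing `S`. An arc
leaving this set must start in `S`, since otherwise its source would also reach `k`. -/
theorem exists_exit (hN : N.Strong) (hS : S.Nonempty) {k : V} (hk : k ∉ S) :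
    ∃ e ∈ S, ∃ v ∉ S, N.E e v ∧ Relation.ReflTransGen (fun a b => N.E a b ∧ b ∉ S) v k := by
  obtain ⟨u, hu, v, hv, he⟩ :=
    hN {v | ¬ (v ∉ S ∧ Relation.ReflTransGen (fun a b => N.E a b ∧ b ∉ S) v k)}
      (by obtain ⟨a, ha⟩ := hS; exact ⟨a, fun h => h.1 ha⟩)
      (fun h => by
        have := Set.mem_univ k
        rw [← h] at this
        exact this ⟨hk, Relation.ReflTransGen.refl⟩)
  simp only [Set.mem_ofPred_eq, not_not] at hv hu
  refine ⟨u, ?_, v, hv.1, he, hv.2⟩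
  by_contra huS
  exact hu ⟨huS, Relation.ReflTransGen.head ⟨he, hv.1⟩ hv.2⟩

end Ring

/-! ### Equalizing two states on a chordless cycle fed by one vertex -/

section KillRing

variable {V : Type*} [DecidableEq V] {N : AndNet V} {S : Finset V} {s : ℕ → V} {k : V}
  {κ : Bool} {x : V → Bool}

theorem exists_word_pass (hs : N.RingEnum S s) {val : ℕ → Bool}
    (h : ∀ j < S.card, ∀ z : V → Bool, (∀ v ∉ S, z v = x v) → (∀ t < j, z (s t) = val t) →
      (j = 0 → z = x) → N.net z (s j) = val j) :
    ∀ t < S.card, N.net.run ((List.range S.card).map s) x (s t) = val t := by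
  have key : ∀ j ≤ S.card, ∀ t < j, N.net.run ((List.range j).map s) x (s t) = val t := by
    intro j
    induction j with
    | zero => intro _ t ht; omega
    | succ j ih =>
      intro hj t ht
      rw [List.range_succ, List.map_append, List.map_singleton, run_concat]
      by_cases htj : t = j
      · subst htj
        rw [updateAt_self]
        refine h t (by omega) _ ?_ (ih (by omega)) ?_
        · intro v hv
          refine run_of_notMem fun hm => hv ?_
          obtain ⟨t', -, rfl⟩ := List.mem_map.1 hm
          exact hs.mem t'
        · rintro rfl
          rfl
      · rw [updateAt_of_ne fun he => htj (hs.inj (by omega) (by omega) he)]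
        exact ih (by omega) t (by omega)
  exact key _ le_rfl

theorem net_ring (hs : N.RingEnum S s) (hk : k ∉ S)
    (hp : ∀ a ∈ S, N.E k a → N.p k a = κ)
    (hx : ∀ a ∈ S, ∀ u ∉ S, u ≠ k → N.E u a → x u = N.p u a) (t : ℕ) :
    N.net x (s (t + 1)) = true ↔
      x (s t) = N.p (s t) (s (t + 1)) ∧ (N.E k (s (t + 1)) → x k = κ) := by
  rw [net_eq_true]
  constructor
  · refine fun h => ⟨h _ ((hs.pred t _ (hs.mem t)).2 rfl), fun he => ?_⟩
    rw [← hp _ (hs.mem _) he]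
    exact h k he
  · rintro ⟨h1, h2⟩ u he
    by_cases hu : u ∈ S
    · rw [(hs.pred t u hu).1 he, h1]
    · by_cases huk : u = k
      · subst huk
        rw [h2 he, hp _ (hs.mem _) he]
      · exact hx _ (hs.mem _) u hu huk he

/-- Values are propagated along the path from `e` to `k`. A vertex met again keeps its first value,
so the path need not be simple. -/
theorem exists_labelling {e v : V} (he : e ∈ S) (hv : v ∉ S) (hev : N.E e v)
    (hvk : Relation.ReflTransGen (fun a b => N.E a b ∧ b ∉ S) v k) (base : V → Bool) :
    ∃ (lab : V → Bool) (Z : Finset V), k ∈ Z ∧ (∀ z ∈ Z, z ∉ S) ∧ (∀ a ∈ S, lab a = base a) ∧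
      ∀ z ∈ Z, N.HasPar lab (insert e Z) z := by
  induction hvk with
  | refl =>
    have hne : e ≠ v := fun h => hv (h ▸ he)
    refine ⟨Function.update base v (decide (base e = N.p e v)), {v}, by simp, by simpa using hv,
      fun a ha => Function.update_of_ne (ne_of_mem_of_not_mem ha hv) _ _, ?_⟩
    intro z hz
    rw [Finset.mem_singleton] at hz
    subst hz
    exact ⟨e, by simp, hev, by simp [Cons, hne]⟩
  | @tail b c _ hbc ih =>
    obtain ⟨lab, Z, hbZ, hZS, hlab, hpar⟩ := ih
    by_cases hc : c ∈ Z
    · exact ⟨lab, Z, hc, hZS, hlab, hpar⟩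
    have hne : ∀ a ∈ insert e Z, a ≠ c := by
      intro a ha h
      subst h
      rcases Finset.mem_insert.1 ha with rfl | h
      · exact hbc.2 he
      · exact hc h
    refine ⟨Function.update lab c (decide (lab b = N.p b c)), insert c Z, by simp, ?_, ?_, ?_⟩
    · intro z hz
      rcases Finset.mem_insert.1 hz with rfl | h
      exacts [hbc.2, hZS z h]
    · intro a ha
      rw [Function.update_of_ne (ne_of_mem_of_not_mem ha hbc.2), hlab a ha]
    · intro z hz
      rcases Finset.mem_insert.1 hz with rfl | h
      · refine ⟨b, by simp [hbZ], hbc.1, ?_⟩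
        have := hne b (by simp [hbZ])
        simp [Cons, this]
      · refine ((hpar z h).congr (fun u hu => ?_) ?_).mono ?_
        · rw [Function.update_of_ne (hne u hu)]
        · rw [Function.update_of_ne (hne z (by simp [h]))]
        · exact Finset.insert_subset_insert _ (Finset.subset_insert _ _)

/-- There is an enumeration from a vertex fed by `k` that makes the chain of values false at
all the vertices fed by `k`. -/
theorem exists_enum_chain (hN : N.NPC) (hstr : N.Strong) (hR : N.IsRing S) (hk : k ∉ S)
    (hp : ∀ a ∈ S, N.E k a → N.p k a = κ) (hf : ∃ a ∈ S, N.E k a) :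
    ∃ s, N.RingEnum S s ∧ N.E k (s 0) ∧
      ∀ t < S.card, N.E k (s t) → N.chain s false t = false := by
  obtain ⟨e, he, v, hv, hev, hvk⟩ := exists_exit hstr hR.nonempty hk
  obtain ⟨s', hs'0, hs'⟩ := hR.exists_enum he
  have hpos := hR.nonempty.card_pos
  have hs'l : s' S.card = e := by rw [← hs'0, ← hs'.period 0, zero_add]
  classical
  -- The enumeration will start at the first fed vertex strictly after the exit `e`. Then every fed
  -- vertex lies on the arc of the cycle from the start to `e`, with `e` itself counted last.
  have hex : ∃ t, 1 ≤ t ∧ t ≤ S.card ∧ N.E k (s' t) := by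
    obtain ⟨a, ha, hka⟩ := hf
    obtain ⟨t, ht, rfl⟩ := hs'.surj a ha
    rcases Nat.eq_zero_or_pos t with rfl | h
    · exact ⟨S.card, hpos, le_rfl, by rwa [hs'l, ← hs'0]⟩
    · exact ⟨t, h, ht.le, hka⟩
  obtain ⟨h1, h2, h3⟩ := Nat.find_spec hex
  have hmin := fun t (ht : t < Nat.find hex) => Nat.find_min hex ht
  set m := Nat.find hex
  have hs := hs'.shift h2
  set s : ℕ → V := fun t => s' (m + t) with hsdef
  have hfed : ∀ t < S.card, N.E k (s t) → t ≤ S.card - m := by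
    intro t ht hkt
    by_contra hcon
    refine hmin (m + t - S.card) (by omega) ⟨by omega, by omega, ?_⟩
    rw [← hs'.period, Nat.sub_add_cancel (by omega)]
    exact hkt
  have hse : s (S.card - m) = e := by
    simp only [hsdef]
    rw [Nat.add_sub_cancel' h2, hs'l]
  obtain ⟨base, hbase⟩ := hs.exists_base (N.chain s false)
  obtain ⟨lab, Z, hkZ, hZS, hlab, hpar⟩ := exists_labelling he hv hev hvk base
  have hlab' : ∀ t < S.card, lab (s t) = N.chain s false t := fun t ht => by
    rw [hlab _ (hs.mem t), hbase t ht]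
  -- The walk from `s t` along the cycle to `e`, then outside `S` to `k`, is consistent in `lab`, so
  -- the arc that closes it is not. At `s 0`, which is false, this gives `lab k = κ`; the literals
  -- of `k` being true, all other fed vertices on the chain must be false too.
  have key : ∀ t ≤ S.card - m, N.E k (s t) → ¬ N.Cons lab k (s t) := by
    intro t ht hkt
    refine hN.not_cons (C := Z ∪ (Finset.Icc t (S.card - m)).image s) ?_ ?_ ?_ hkt
    · exact Finset.mem_union_right _ (Finset.mem_image_of_mem _ (by simp [ht]))
    · intro a ha hne
      rcases Finset.mem_union.1 ha with ha | ha
      · refine (hpar a ha).mono ?_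
        refine Finset.insert_subset (Finset.mem_union_right _ ?_) Finset.subset_union_left
        rw [← hse]
        exact Finset.mem_image_of_mem _ (by simp [ht])
      · obtain ⟨r, hr, rfl⟩ := Finset.mem_image.1 ha
        rw [Finset.mem_Icc] at hr
        obtain ⟨r, rfl⟩ : ∃ q, r = q + 1 :=
          ⟨r - 1, by
            rcases Nat.eq_zero_or_pos r with h | h
            · exact absurd (by congr 1; omega) hne
            · omega⟩
        refine hasPar_chain hs (hlab' _ (by omega)) (hlab' _ (by omega))
          (Finset.mem_union_right _ (Finset.mem_image_of_mem _ ?_))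
        rw [Finset.mem_Icc]
        have : t ≠ r + 1 := fun h => hne (by rw [h])
        omega
    · exact Finset.mem_union_left _ hkZ
  have hk0 : lab k = κ := by
    have := key 0 (by omega) h3
    rw [cons_of_false (hlab' 0 hpos), not_not, hp _ (hs.mem 0) h3] at this
    exact this
  refine ⟨s, hs, h3, fun t ht hkt => ?_⟩
  have := key t (hfed t ht hkt) hkt
  rw [← hlab' t ht]
  by_contra hcon
  rw [Bool.not_eq_false] at hcon
  rw [cons_of_true hcon, hp _ (hs.mem t) hkt] at this
  exact this hk0

/-- Two states can be made equal on a chordless cycle fed by an external vertex `k`, if the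
corresponding literals are not true in both states. -/
theorem exists_word_killRing (hN : N.NPC) (hstr : N.Strong) (hR : N.IsRing S) (hk : k ∉ S)
    (hp : ∀ a ∈ S, N.E k a → N.p k a = κ) (hf : ∃ a ∈ S, N.E k a) :
    ∃ c : V → Bool,
      (∀ z : V → Bool, z k ≠ κ → (∀ a ∈ S, z a = c a) → ∀ a ∈ S, N.E a k → ¬ N.Cons z a k) ∧
      ∀ x y : V → Bool, (∀ a ∈ S, ∀ u ∉ S, u ≠ k → N.E u a → x u = N.p u a) →
        (∀ a ∈ S, ∀ u ∉ S, u ≠ k → N.E u a → y u = N.p u a) → ¬ (x k = κ ∧ y k = κ) →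
        ∃ w : List V, (∀ l ∈ w, l ∈ S) ∧ w.length ≤ 2 * S.card ∧
          ∀ a ∈ S, N.net.run w x a = c a ∧ N.net.run w y a = c a := by
  obtain ⟨s, hs, hk0, hfed⟩ := exists_enum_chain hN hstr hR hk hp hf
  obtain ⟨c, hc⟩ := hs.exists_base (N.chain s false)
  have hpos := hR.nonempty.card_pos
  have hsl : s (S.card - 1 + 1) = s 0 := by
    rw [Nat.sub_add_cancel hpos, ← hs.period 0, zero_add]
  -- The chain cannot close up consistently, because the cycle is negative. While `k` is free,
  -- passes therefore alternate between this chain and its complement.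
  have hneg : N.chain s false (S.card - 1) = N.p (s (S.card - 1)) (s 0) := by
    have := hN.not_cons (x := c) (C := S) (i := s 0) (hs.mem 0) (fun v hv hne => by
      obtain ⟨t, ht, rfl⟩ := hs.surj v hv
      obtain ⟨t, rfl⟩ : ∃ q, t = q + 1 := ⟨t - 1, by
        rcases Nat.eq_zero_or_pos t with rfl | h
        · exact absurd rfl hne
        · omega⟩
      exact hasPar_chain hs (hc _ (by omega)) (hc _ ht) (hs.mem t))
      (hs.mem (S.card - 1)) ((hs.pred_zero (hs.mem _)).2 rfl)
    rw [cons_of_false (hc 0 hpos), hc _ (by omega), not_not] at this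
    exact this
  refine ⟨c, ?_, ?_⟩
  · intro z hzk hzc a ha hak
    -- With `k` blocking and `s 0` false, the arc from `k` to `s 0` is consistent, and so is the
    -- chain after it.
    refine hN.not_cons (C := insert k S) (i := k) (by simp) ?_ (by simp [ha]) hak
    intro v hv hne
    have hv := Finset.mem_of_mem_insert_of_ne hv hne
    obtain ⟨t, ht, rfl⟩ := hs.surj v hv
    rcases Nat.eq_zero_or_pos t with rfl | h
    · refine ⟨k, by simp, hk0, ?_⟩
      rw [cons_of_false (by rw [hzc _ (hs.mem 0), hc 0 hpos]; rfl), hp _ (hs.mem 0) hk0]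
      exact hzk
    · obtain ⟨t, rfl⟩ : ∃ q, t = q + 1 := ⟨t - 1, by omega⟩
      refine hasPar_chain hs (b := false) ?_ ?_ (Finset.mem_insert_of_mem (hs.mem t))
      · rw [hzc _ (hs.mem _), hc _ (by omega)]
      · rw [hzc _ (hs.mem _), hc _ (by omega)]
  set P := (List.range S.card).map s with hP
  have hPmem : ∀ l ∈ P, l ∈ S := by
    intro l hl
    obtain ⟨t, -, rfl⟩ := List.mem_map.1 hl
    exact hs.mem t
  have hPlen : P.length = S.card := by simp [hP]
  -- a pass from a state where `k` is blocking
  have blocked : ∀ x : V → Bool, (∀ a ∈ S, ∀ u ∉ S, u ≠ k → N.E u a → x u = N.p u a) →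
      x k ≠ κ → ∀ t < S.card, N.net.run P x (s t) = N.chain s false t := by
    intro x hx hxk
    refine exists_word_pass hs fun j hj z hz hz' _ => ?_
    have hzout : ∀ a ∈ S, ∀ u ∉ S, u ≠ k → N.E u a → z u = N.p u a := fun a ha u hu huk hua => by
      rw [hz u hu]; exact hx a ha u hu huk hua
    by_cases hkj : N.E k (s j)
    · rw [hfed j hj hkj, net_eq_false]
      exact ⟨k, hkj, by rw [hz k hk, hp _ (hs.mem j) hkj]; exact hxk⟩
    · rcases Nat.eq_zero_or_pos j with rfl | h
      · exact absurd hk0 hkj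
      · obtain ⟨j, rfl⟩ : ∃ q, j = q + 1 := ⟨j - 1, by omega⟩
        rw [Bool.eq_iff_iff, net_ring hs hk hp hzout, hz' j (by omega)]
        simp [chain, hkj]
  have free : ∀ x : V → Bool, (∀ a ∈ S, ∀ u ∉ S, u ≠ k → N.E u a → x u = N.p u a) →
      x k = κ → ∀ t < S.card, N.net.run P x (s t) =
        N.chain s (decide (x (s (S.card - 1)) = N.p (s (S.card - 1)) (s 0))) t := by
    intro x hx hxk
    refine exists_word_pass hs fun j hj z hz hz' hz0 => ?_
    have hzout : ∀ a ∈ S, ∀ u ∉ S, u ≠ k → N.E u a → z u = N.p u a := fun a ha u hu huk hua => by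
      rw [hz u hu]; exact hx a ha u hu huk hua
    have hzk : z k = κ := by rw [hz k hk, hxk]
    rcases Nat.eq_zero_or_pos j with rfl | h
    · have := net_ring hs hk hp hzout (S.card - 1)
      rw [hsl, hz0 rfl] at this
      rw [hz0 rfl, Bool.eq_iff_iff, this]
      simp [chain, hxk]
    · obtain ⟨j, rfl⟩ : ∃ q, j = q + 1 := ⟨j - 1, by omega⟩
      rw [Bool.eq_iff_iff, net_ring hs hk hp hzout, hz' j (by omega)]
      simp [chain, hzk]
  have hPout : ∀ (x : V → Bool), ∀ v ∉ S, N.net.run P x v = x v := fun x v hv =>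
    run_of_notMem fun h => hv (hPmem v h)
  have hPx : ∀ x : V → Bool, (∀ a ∈ S, ∀ u ∉ S, u ≠ k → N.E u a → x u = N.p u a) →
      ∀ a ∈ S, ∀ u ∉ S, u ≠ k → N.E u a → N.net.run P x u = N.p u a := fun x hx a ha u hu huk he => by
    rw [hPout x u hu]; exact hx a ha u hu huk he
  -- two states with only the second one possibly free
  have main : ∀ x y : V → Bool, (∀ a ∈ S, ∀ u ∉ S, u ≠ k → N.E u a → x u = N.p u a) →
        (∀ a ∈ S, ∀ u ∉ S, u ≠ k → N.E u a → y u = N.p u a) → x k ≠ κ →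
        ∃ w : List V, (∀ l ∈ w, l ∈ S) ∧ w.length ≤ 2 * S.card ∧
          ∀ a ∈ S, N.net.run w x a = c a ∧ N.net.run w y a = c a := by
    intro x y hx hy hxk
    have toC : ∀ (w : List V) (x : V → Bool), (∀ t < S.card, N.net.run w x (s t) =
        N.chain s false t) → ∀ a ∈ S, N.net.run w x a = c a := by
      intro w x h a ha
      obtain ⟨t, ht, rfl⟩ := hs.surj a ha
      rw [h t ht, hc t ht]
    -- A blocked state reaches the chain in one pass and stays there, since the fed vertices are
    -- false on the chain. A free state reaches it after one or two passes, depending on the literal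
    -- that starts the first pass.
    by_cases hyk : y k = κ
    · by_cases hlit : y (s (S.card - 1)) = N.p (s (S.card - 1)) (s 0)
      · refine ⟨P ++ P, by simpa using hPmem, by simp [hPlen]; omega, fun a ha => ⟨?_, ?_⟩⟩
        · refine toC (P ++ P) x ?_ a ha
          rw [run_append]
          exact blocked _ (hPx x hx) (by rwa [hPout x k hk])
        · refine toC (P ++ P) y ?_ a ha
          rw [run_append]
          have h1 := free _ (hPx y hy) (by rwa [hPout y k hk])
          have h2 := free y hy hyk (S.card - 1) (by omega)
          rw [decide_eq_true hlit, chain_true, hneg] at h2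
          rw [h2] at h1
          intro t ht
          rw [h1 t ht]
          congr 1
          simp
      · refine ⟨P, hPmem, by omega, fun a ha => ⟨toC P x (blocked x hx hxk) a ha, ?_⟩⟩
        refine toC P y ?_ a ha
        have h1 := free y hy hyk
        rwa [decide_eq_false hlit] at h1
    · exact ⟨P, hPmem, by omega, fun a ha =>
        ⟨toC P x (blocked x hx hxk) a ha, toC P y (blocked y hy hyk) a ha⟩⟩
  intro x y hx hy hxy
  by_cases hxk : x k = κ
  · obtain ⟨w, hw, hwl, hwc⟩ := main y x hy hx fun h => hxy ⟨hxk, h⟩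
    exact ⟨w, hw, hwl, fun a ha => (hwc a ha).symm⟩
  · exact main x y hx hy hxk

end KillRing

/-! ### Components with different values in two states -/

section NetNe

variable {V : Type*} {N : AndNet V} {x y : V → Bool} {v : V}

theorem exists_of_net_ne (h : N.net x v ≠ N.net y v) :
    ∃ u, x u ≠ y u ∧ N.E u v ∧ (x u = N.p u v ↔ N.net x v = true) := by
  by_cases hx : N.net x v = true
  · have hy : N.net y v = false := by simpa [hx] using h.symm
    obtain ⟨u, hu, hyu⟩ := net_eq_false.1 hy
    have hxu := net_eq_true.1 hx u hu
    exact ⟨u, fun h => hyu (h ▸ hxu), hu, by simp [hx, hxu]⟩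
  · have hx : N.net x v = false := by simpa using hx
    have hy : N.net y v = true := by simpa [hx] using h.symm
    obtain ⟨u, hu, hxu⟩ := net_eq_false.1 hx
    have hyu := net_eq_true.1 hy u hu
    exact ⟨u, fun h => hxu (h ▸ hyu), hu, by simp [hx, hxu]⟩

theorem lit_iff_of_net_ne (h : N.net x v ≠ N.net y v) {u : V} (hu : x u ≠ y u) (he : N.E u v) :
    x u = N.p u v ↔ N.net x v = true := by
  by_cases hx : N.net x v = true
  · simp [hx, net_eq_true.1 hx u he]
  · have hx : N.net x v = false := by simpa using hx
    have hy : N.net y v = true := by simpa [hx] using h.symm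
    have := net_eq_true.1 hy u he
    simp [hx, ← this, hu]

/-- A consistent and an inconsistent arc into `v` carry opposite literals. Both change sign from `x`
to `y`, so each state has a false literal at `v`. -/
theorem net_eq_false_of_mixed {Q : Finset V} (hQ : ∀ v ∈ Q, x v ≠ y v)
    (h1 : N.HasPar x Q v) (h2 : ∃ u ∈ Q, N.E u v ∧ ¬ N.Cons x u v) :
    N.net x v = false ∧ N.net y v = false := by
  obtain ⟨u, hu, hue, huc⟩ := h1
  obtain ⟨t, ht, hte, htc⟩ := h2
  have key : ∀ z : V → Bool, (∀ v ∈ Q, z v ≠ x v) → N.net x v = false ∧ N.net z v = false := by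
    intro z hz
    rw [net_eq_false, net_eq_false]
    have hu' := hz u hu
    have ht' := hz t ht
    by_cases hv : x v = true
    · rw [cons_of_true hv] at huc htc
      exact ⟨⟨t, hte, htc⟩, u, hue, by rwa [← huc]⟩
    · have hv : x v = false := by simpa using hv
      rw [cons_of_false hv] at huc htc
      rw [not_not] at htc
      exact ⟨⟨u, hue, huc⟩, t, hte, by rwa [← htc]⟩
  exact key y fun v hv => (hQ v hv).symm

end NetNe

/-! ### Removing vertices from the set where two states differ -/

section Cleaning

variable {V : Type*} [DecidableEq V] {N : AndNet V} {x y : V → Bool} {v : V}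

/-- Otherwise a choice of consistent out-neighbors maps some minimal nonempty set onto itself, and
every vertex of that set has a consistent in-neighbor in it. -/
theorem NPC.exists_sink (hN : N.NPC) (x : V → Bool) {S : Finset V} (hS : S.Nonempty) :
    ∃ v ∈ S, ∀ w ∈ S, N.E v w → ¬ N.Cons x v w := by
  by_contra! h
  choose! g hgS hgE hgC using h
  obtain ⟨T, hTS, hT⟩ := exists_minimal_le_of_wellFoundedLT
    (fun T : Finset V => T ⊆ S ∧ T.Nonempty ∧ T.image g ⊆ T) S
    ⟨subset_rfl, hS, fun v hv => by
      obtain ⟨u, hu, rfl⟩ := Finset.mem_image.1 hv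
      exact hgS u hu⟩
  obtain ⟨⟨_, hne, hg⟩, hmin⟩ := hT
  have hle : T ≤ T.image g := hmin ⟨hg.trans hTS, hne.image g, Finset.image_subset_image hg⟩ hg
  obtain ⟨v, hv, hv'⟩ := hN x T hne
  obtain ⟨u, hu, rfl⟩ := Finset.mem_image.1 (hle hv)
  exact hv' ⟨u, hu, hgE u (hTS hu), hgC u (hTS hu)⟩

/-- The state with the vertices of `K` set to false. -/
def kill (K : Finset V) (x : V → Bool) : V → Bool := fun v => if v ∈ K then false else x v

theorem kill_of_mem {K : Finset V} (h : v ∈ K) : kill K x v = false := by simp [kill, h]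

theorem kill_of_notMem {K : Finset V} (h : v ∉ K) : kill K x v = x v := by simp [kill, h]

/-- On an antipodal set `Q`, a set `K` of vertices of `L` can be set to false in both states so
that all the arcs from the remaining vertices of `Q` to those of `L` are consistent. -/
theorem exists_word_kill (hN : N.NPC) (x y : V → Bool) (n : ℕ) : ∀ L Q : Finset V, L.card = n →
    L ⊆ Q → (∀ v ∈ Q, x v ≠ y v) →
    (∀ v ∈ L, (∃ u ∈ Q, N.E u v ∧ ¬ N.Cons x u v) → N.HasPar x Q v) →
    ∃ (w : List V) (K : Finset V), K ⊆ L ∧ (∀ l ∈ w, l ∈ L) ∧ w.length ≤ n ∧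
      (∀ x' y' : V → Bool, (∀ v ∈ Q, x' v = x v ∧ y' v = y v) →
        N.net.run w x' = kill K x' ∧ N.net.run w y' = kill K y') ∧
      ∀ v ∈ L, v ∉ K → ∀ u ∈ Q, u ∉ K → N.E u v → N.Cons x u v := by
  classical
  induction n with
  | zero =>
    intro L Q hL _ _ _
    obtain rfl := Finset.card_eq_zero.1 hL
    exact ⟨[], ∅, by simp, by simp, by simp, fun x' y' _ => by
      constructor <;> (funext v; simp [kill, run_nil]), by simp⟩
  | succ n ih =>
    intro L Q hL hLQ hQ hpar
    by_cases hbad : (L.filter fun v => ∃ u ∈ Q, N.E u v ∧ ¬ N.Cons x u v).Nonempty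
    · obtain ⟨v, hv, hsink⟩ := hN.exists_sink x hbad
      rw [Finset.mem_filter] at hv
      obtain ⟨w, K, hK, hw, hwl, hrun, hcons⟩ := ih (L.erase v) (Q.erase v)
        (by rw [Finset.card_erase_of_mem hv.1, hL]; rfl) (Finset.erase_subset_erase _ hLQ)
        (fun a ha => hQ a (Finset.mem_of_mem_erase ha)) (by
          rintro a ha ⟨u, hu, hua, huc⟩
          have haL := Finset.mem_of_mem_erase ha
          have hab : ∃ u ∈ Q, N.E u a ∧ ¬ N.Cons x u a :=
            ⟨u, Finset.mem_of_mem_erase hu, hua, huc⟩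
          obtain ⟨t, ht, hta, htc⟩ := hpar a haL hab
          refine ⟨t, Finset.mem_erase.2 ⟨?_, ht⟩, hta, htc⟩
          rintro rfl
          exact hsink a (Finset.mem_filter.2 ⟨haL, hab⟩) hta htc)
      refine ⟨v :: w, insert v K, ?_, ?_, by simpa using hwl, ?_, ?_⟩
      · exact Finset.insert_subset hv.1 (hK.trans (Finset.erase_subset _ _))
      · intro l hl
        rcases List.mem_cons.1 hl with rfl | h
        exacts [hv.1, Finset.mem_of_mem_erase (hw l h)]
      · intro x' y' hxy
        obtain ⟨h1, h2⟩ := net_eq_false_of_mixed hQ (hpar v hv.1 hv.2) hv.2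
        have h3 : N.net x' v = false ∧ N.net y' v = false := by
          refine net_eq_false_of_mixed (Q := Q) (fun a ha => ?_) ?_ ?_
          · rw [(hxy a ha).1, (hxy a ha).2]; exact hQ a ha
          · exact (hpar v hv.1 hv.2).congr (fun u hu => ((hxy u hu).1).symm)
              ((hxy v (hLQ hv.1)).1).symm
          · obtain ⟨u, hu, hue, huc⟩ := hv.2
            exact ⟨u, hu, hue, by
              rwa [cons_congr ((hxy u hu).1) ((hxy v (hLQ hv.1)).1)]⟩
        obtain ⟨h4, h5⟩ := hrun (N.net.updateAt v x') (N.net.updateAt v y') (by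
          intro a ha
          rw [Finset.mem_erase] at ha
          rw [updateAt_of_ne ha.1, updateAt_of_ne ha.1]
          exact hxy a ha.2)
        rw [run_cons, run_cons, h4, h5]
        constructor
        · funext a
          by_cases hav : a = v
          · subst hav
            simp [kill, updateAt_self, h3]
          · simp [kill, updateAt_of_ne hav, hav]
        · funext a
          by_cases hav : a = v
          · subst hav
            simp [kill, updateAt_self, h3]
          · simp [kill, updateAt_of_ne hav, hav]
      · intro a ha haK u hu huK he
        rw [Finset.mem_insert, not_or] at haK huK
        exact hcons a (Finset.mem_erase.2 ⟨haK.1, ha⟩) haK.2 u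
          (Finset.mem_erase.2 ⟨huK.1, hu⟩) huK.2 he
    · refine ⟨[], ∅, by simp, by simp, by simp, fun x' y' _ => by
        constructor <;> (funext v; simp [kill, run_nil]), ?_⟩
      intro v hv _ u hu _ he
      by_contra hc
      exact hbad ⟨v, Finset.mem_filter.2 ⟨hv, u, hu, he, hc⟩⟩

/-- A set `K` of vertices of `L` can be made equal in both states so that the components of the
remaining vertices of `L` take different values in the two states. -/
theorem exists_word_clean (n : ℕ) : ∀ (L : Finset V) (x y : V → Bool), L.card = n →
    ∃ (w : List V) (K : Finset V), K ⊆ L ∧ (∀ l ∈ w, l ∈ L) ∧ w.length ≤ n ∧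
      (∀ v ∉ K, N.net.run w x v = x v ∧ N.net.run w y v = y v) ∧
      (∀ v ∈ K, N.net.run w x v = N.net.run w y v) ∧
      ∀ v ∈ L, v ∉ K → N.net (N.net.run w x) v ≠ N.net (N.net.run w y) v := by
  induction n with
  | zero =>
    intro L x y hL
    obtain rfl := Finset.card_eq_zero.1 hL
    exact ⟨[], ∅, by simp, by simp, by simp, by simp [run_nil], by simp, by simp⟩
  | succ n ih =>
    intro L x y hL
    by_cases h : ∃ v ∈ L, N.net x v = N.net y v
    · obtain ⟨v, hv, he⟩ := h
      obtain ⟨w, K, hK, hw, hwl, h1, h2, h3⟩ := ih (L.erase v) (N.net.updateAt v x)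
        (N.net.updateAt v y) (by rw [Finset.card_erase_of_mem hv, hL]; rfl)
      have hvK : v ∉ K := fun h => by simpa using hK h
      refine ⟨v :: w, insert v K, ?_, ?_, by simpa using hwl, ?_, ?_, ?_⟩
      · exact Finset.insert_subset hv (hK.trans (Finset.erase_subset _ _))
      · intro l hl
        rcases List.mem_cons.1 hl with rfl | h
        exacts [hv, Finset.mem_of_mem_erase (hw l h)]
      · intro a ha
        rw [Finset.mem_insert, not_or] at ha
        rw [run_cons, run_cons, (h1 a ha.2).1, (h1 a ha.2).2, updateAt_of_ne ha.1,
          updateAt_of_ne ha.1]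
        exact ⟨rfl, rfl⟩
      · intro a ha
        rw [run_cons, run_cons]
        rcases Finset.mem_insert.1 ha with rfl | h
        · rw [(h1 a hvK).1, (h1 a hvK).2, updateAt_self, updateAt_self, he]
        · exact h2 a h
      · intro a ha haK
        rw [Finset.mem_insert, not_or] at haK
        rw [run_cons, run_cons]
        exact h3 a (Finset.mem_erase.2 ⟨haK.1, ha⟩) haK.2
    · push Not at h
      exact ⟨[], ∅, by simp, by simp, by simp, by simp [run_nil], by simp,
        fun v hv _ => h v hv⟩

/-- Two states can be made equal on several chordless cycles fed by an external vertex `k`. -/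
theorem exists_word_killRings (hN : N.NPC) (hstr : N.Strong) {k : V} {κ : Bool}
    (J : Finset (Finset V)) (B : Finset V) (hJB : ∀ S ∈ J, S ⊆ B) (hkB : k ∉ B)
    (hR : ∀ S ∈ J, N.IsRing S) (hf : ∀ S ∈ J, ∃ a ∈ S, N.E k a)
    (hp : ∀ S ∈ J, ∀ a ∈ S, N.E k a → N.p k a = κ)
    (hdis : ∀ S ∈ J, ∀ T ∈ J, S ≠ T → Disjoint S T)
    (hB : ∀ S ∈ J, ∀ a ∈ S, ∀ u ∉ S, N.E u a → u ∉ B) : ∀ x y : V → Bool,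
    (∀ S ∈ J, ∀ a ∈ S, ∀ u ∉ S, u ≠ k → N.E u a → x u = N.p u a) →
    (∀ S ∈ J, ∀ a ∈ S, ∀ u ∉ S, u ≠ k → N.E u a → y u = N.p u a) →
    ¬ (x k = κ ∧ y k = κ) →
    ∃ w : List V, (∀ l ∈ w, ∃ S ∈ J, l ∈ S) ∧ w.length ≤ 2 * ∑ S ∈ J, S.card ∧
      (∀ S ∈ J, ∀ a ∈ S, N.net.run w x a = N.net.run w y a) ∧
      ∀ z : V → Bool, z k ≠ κ → (∀ S ∈ J, ∀ a ∈ S, z a = N.net.run w x a) →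
        ∀ S ∈ J, ∀ a ∈ S, N.E a k → ¬ N.Cons z a k := by
  induction J using Finset.induction_on with
  | empty => exact fun x y _ _ _ => ⟨[], by simp, by simp, by simp, by simp⟩
  | insert S J hSJ ih =>
    intro x y hx hy hxy
    have hins : ∀ T ∈ J, T ∈ insert S J := fun T hT => Finset.mem_insert_of_mem hT
    have hS : S ∈ insert S J := Finset.mem_insert_self _ _
    have hkS : k ∉ S := fun h => hkB (hJB S hS h)
    obtain ⟨c, hc1, hc2⟩ := exists_word_killRing hN hstr (hR S hS) hkS (hp S hS) (hf S hS)
    obtain ⟨w, hw, hwl, hwc⟩ := hc2 x y (hx S hS) (hy S hS) hxy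
    have hout : ∀ (x : V → Bool), ∀ v ∉ B, N.net.run w x v = x v := fun x v hv =>
      run_of_notMem fun h => hv (hJB S hS (hw v h))
    obtain ⟨w', hw', hwl', h1, h2⟩ := ih (fun T hT => hJB T (hins T hT))
      (fun T hT => hR T (hins T hT)) (fun T hT => hf T (hins T hT))
      (fun T hT => hp T (hins T hT))
      (fun T hT U hU => hdis T (hins T hT) U (hins U hU)) (fun T hT => hB T (hins T hT))
      (N.net.run w x) (N.net.run w y)
      (fun T hT a ha u hu huk he => by
        rw [hout x u (hB T (hins T hT) a ha u hu he)]
        exact hx T (hins T hT) a ha u hu huk he)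
      (fun T hT a ha u hu huk he => by
        rw [hout y u (hB T (hins T hT) a ha u hu he)]
        exact hy T (hins T hT) a ha u hu huk he)
      (by rwa [hout x k hkB, hout y k hkB])
    have hS' : ∀ (x : V → Bool), ∀ a ∈ S, N.net.run w' x a = x a := fun x a ha =>
      run_of_notMem fun h => by
        obtain ⟨T, hT, haT⟩ := hw' a h
        exact Finset.disjoint_left.1 (hdis S hS T (hins T hT) fun h => hSJ (h ▸ hT)) ha haT
    refine ⟨w ++ w', ?_, ?_, ?_, ?_⟩
    · intro l hl
      rcases List.mem_append.1 hl with h | h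
      · exact ⟨S, hS, hw l h⟩
      · obtain ⟨T, hT, hlT⟩ := hw' l h
        exact ⟨T, hins T hT, hlT⟩
    · rw [Finset.sum_insert hSJ, List.length_append]
      omega
    · intro T hT a ha
      rw [run_append, run_append]
      rcases Finset.mem_insert.1 hT with rfl | hT
      · rw [hS' _ a ha, hS' _ a ha, (hwc a ha).1, (hwc a ha).2]
      · exact h1 T hT a ha
    · intro z hzk hz T hT
      rcases Finset.mem_insert.1 hT with rfl | hT
      · refine hc1 z hzk fun a ha => ?_
        rw [hz T hS a ha, run_append, hS' _ a ha, (hwc a ha).1]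
      · refine h2 z hzk (fun U hU a ha => ?_) T hT
        rw [hz U (hins U hU) a ha, run_append]

end Cleaning

/-! ### The invariant on pairs of states -/

section State

variable {V : Type*} {N : AndNet V} {x y x' y' : V → Bool} {v : V}
  {J J' : Finset (Finset V)}

/-- `v` is the source of an arc entering a member of `J`. -/
def Feeds (N : AndNet V) (J : Finset (Finset V)) (v : V) : Prop :=
  ∃ S ∈ J, v ∉ S ∧ ∃ a ∈ S, N.E v a

/-- The two states `x` and `y` are antipodal on the members of `J`, which are chordless cycles
whose vertices, with one exception, have a consistent incoming arc; the literals entering the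
members of `J` are true in both states. -/
structure Core (N : AndNet V) (x y : V → Bool) (J : Finset (Finset V)) : Prop where
  ring : ∀ S ∈ J, N.IsRing S
  good : ∀ S ∈ J, ∀ a ∈ S, ∀ u ∉ S, N.E u a → x u = y u ∧ x u = N.p u a
  anti : ∀ S ∈ J, ∀ a ∈ S, x a ≠ y a
  cut : ∀ S ∈ J, ∃ i ∈ S, x i = true ∧ (∃ u ∉ S, N.E u i) ∧ ∀ a ∈ S, a ≠ i → N.HasPar x S a

/-- Every vertex that distinguishes the two states is in a member of `J` or has a consistent
incoming arc from another such vertex. -/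
def Parents (N : AndNet V) (x y : V → Bool) (J : Finset (Finset V)) : Prop :=
  ∀ v, x v ≠ y v → (∃ S ∈ J, v ∈ S) ∨ ∃ u, x u ≠ y u ∧ N.E u v ∧ N.Cons x u v

theorem Core.mono (h : N.Core x y J) (hJ : J' ⊆ J) : N.Core x y J' where
  ring S hS := h.ring S (hJ hS)
  good S hS := h.good S (hJ hS)
  anti S hS := h.anti S (hJ hS)
  cut S hS := h.cut S (hJ hS)

theorem Core.congr (h : N.Core x y J)
    (h' : ∀ v, ((∃ S ∈ J, v ∈ S) ∨ N.Feeds J v) → x' v = x v ∧ y' v = y v) :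
    N.Core x' y' J where
  ring := h.ring
  good S hS a ha u hu he := by
    rw [(h' u (Or.inr ⟨S, hS, hu, a, ha, he⟩)).1, (h' u (Or.inr ⟨S, hS, hu, a, ha, he⟩)).2]
    exact h.good S hS a ha u hu he
  anti S hS a ha := by
    rw [(h' a (Or.inl ⟨S, hS, ha⟩)).1, (h' a (Or.inl ⟨S, hS, ha⟩)).2]
    exact h.anti S hS a ha
  cut S hS := by
    obtain ⟨i, hi, hxi, hu, hpar⟩ := h.cut S hS
    refine ⟨i, hi, by rw [(h' i (Or.inl ⟨S, hS, hi⟩)).1, hxi], hu, fun a ha hne => ?_⟩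
    exact (hpar a ha hne).congr (fun u hu => ((h' u (Or.inl ⟨S, hS, hu⟩)).1).symm)
      ((h' a (Or.inl ⟨S, hS, ha⟩)).1).symm

theorem Core.feeds_agree (h : N.Core x y J) (hv : N.Feeds J v) : x v = y v := by
  obtain ⟨S, hS, hvS, a, ha, he⟩ := hv
  exact (h.good S hS a ha v hvS he).1

/-- A vertex of `S \ T` with an arc into `S ∩ T` would agree in both states as a source entering `T`
and differ as a member of `S`. Hence `S ∩ T` is closed under in-neighbors in both cycles, and
minimality makes it equal to each. -/
theorem Core.disjoint (h : N.Core x y J) {S T : Finset V} (hS : S ∈ J) (hT : T ∈ J)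
    (hST : S ≠ T) : Disjoint S T := by
  classical
  rw [Finset.disjoint_iff_inter_eq_empty]
  by_contra hne
  have hne := Finset.nonempty_iff_ne_empty.2 hne
  have key : ∀ {S T : Finset V}, S ∈ J → T ∈ J → (S ∩ T).Nonempty → S ∩ T = S := by
    intro S T hS hT hne
    refine (h.ring S hS).minimal _ Finset.inter_subset_left hne fun v hv u hu he => ?_
    rw [Finset.mem_inter] at hv ⊢
    refine ⟨hu, ?_⟩
    by_contra huT
    exact h.anti S hS u hu (h.good T hT v hv.2 u huT he).1
  have h1 := key hS hT hne
  have h2 := key hT hS (by rwa [Finset.inter_comm])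
  rw [Finset.inter_comm] at h2
  exact hST (h1.symm.trans h2)

theorem good_congr (good : ∀ S ∈ J, ∀ a ∈ S, ∀ u ∉ S, N.E u a → x u = y u ∧ x u = N.p u a)
    (h : ∀ v, N.Feeds J v → x v = y v → x' v = x v ∧ y' v = y v) :
    ∀ S ∈ J, ∀ a ∈ S, ∀ u ∉ S, N.E u a → x' u = y' u ∧ x' u = N.p u a := by
  intro S hS a ha u hu he
  have h1 := good S hS a ha u hu he
  obtain ⟨h2, h3⟩ := h u ⟨S, hS, hu, a, ha, he⟩ h1.1
  rw [h2, h3]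
  exact h1

/-- The vertices that distinguish two states. -/
def diff [Fintype V] (x y : V → Bool) : Finset V := Finset.univ.filter fun v => x v ≠ y v

theorem mem_diff [Fintype V] : v ∈ diff x y ↔ x v ≠ y v := by simp [diff]

end State

/-! ### Growing until a vertex entering a cycle changes -/

section PairGrowth

variable {V : Type*} [DecidableEq V] {N : AndNet V} {x y : V → Bool} {v : V}
  {J : Finset (Finset V)}

/-- The next update of `k` changes the value of a vertex entering a member of `J`. -/
def Event (N : AndNet V) (J : Finset (Finset V)) (x y : V → Bool) (k : V) : Prop :=
  N.Feeds J k ∧ ¬ (N.net x k = x k ∧ N.net y k = x k)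

/-- A word over vertices that do not distinguish the two states can be run up to an event, or up
to the first vertex that gets two different values. -/
theorem exists_prefix (N : AndNet V) (J : Finset (Finset V)) (w : List V) : ∀ x y : V → Bool,
    (∀ l ∈ w, x l = y l) →
    ((∀ l ∈ w, N.net.run w x l = N.net.run w y l) ∧
      ∀ v, N.Feeds J v → x v = y v → N.net.run w x v = x v ∧ N.net.run w y v = y v) ∨
    ∃ w₁ k w₂, w = w₁ ++ k :: w₂ ∧ (∀ l ∈ w, N.net.run w₁ x l = N.net.run w₁ y l) ∧
      (∀ v, N.Feeds J v → x v = y v → N.net.run w₁ x v = x v ∧ N.net.run w₁ y v = y v) ∧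
      (N.Event J (N.net.run w₁ x) (N.net.run w₁ y) k ∨
        ¬ N.Feeds J k ∧ N.net (N.net.run w₁ x) k ≠ N.net (N.net.run w₁ y) k) := by
  induction w with
  | nil => exact fun x y _ => Or.inl ⟨by simp, by simp [run_nil]⟩
  | cons i w ih =>
    intro x y hxy
    by_cases hev : N.Event J x y i
    · exact Or.inr ⟨[], i, w, rfl, hxy, by simp [run_nil], Or.inl hev⟩
    by_cases hF : N.net x i = N.net y i
    swap
    · by_cases hfi : N.Feeds J i
      · refine absurd ⟨hfi, fun h => hF ?_⟩ hev
        rw [h.1, h.2]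
      · exact Or.inr ⟨[], i, w, rfl, hxy, by simp [run_nil], Or.inr ⟨hfi, hF⟩⟩
    have hfix : ∀ v, N.Feeds J v → x v = y v →
        N.net.updateAt i x v = x v ∧ N.net.updateAt i y v = y v := by
      intro v hv hxyv
      by_cases hvi : v = i
      · subst hvi
        rw [updateAt_self, updateAt_self]
        by_contra hcon
        exact hev ⟨hv, fun h => hcon ⟨h.1, by rw [h.2, hxyv]⟩⟩
      · rw [updateAt_of_ne hvi, updateAt_of_ne hvi]
        exact ⟨rfl, rfl⟩
    have hag : ∀ l ∈ i :: w, N.net.updateAt i x l = N.net.updateAt i y l := by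
      intro l hl
      by_cases hli : l = i
      · subst hli
        rw [updateAt_self, updateAt_self, hF]
      · rw [updateAt_of_ne hli, updateAt_of_ne hli]
        exact hxy l hl
    have hrest := ih (N.net.updateAt i x) (N.net.updateAt i y) fun l hl => hag l (by simp [hl])
    have hi : ∀ w₁ : List V, (∀ l ∈ w, N.net.run w₁ (N.net.updateAt i x) l =
        N.net.run w₁ (N.net.updateAt i y) l) → (∀ l ∈ w₁, l ∈ w) →
        ∀ l ∈ i :: w, N.net.run w₁ (N.net.updateAt i x) l =
        N.net.run w₁ (N.net.updateAt i y) l := by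
      intro w₁ h1 h2 l hl
      by_cases hlw : l ∈ w
      · exact h1 l hlw
      · have hl1 : l ∉ w₁ := fun h => hlw (h2 l h)
        rw [run_of_notMem hl1, run_of_notMem hl1]
        exact hag l hl
    rcases hrest with ⟨h1, h2⟩ | ⟨w₁, k, w₂, rfl, h1, h2, h3⟩
    · left
      refine ⟨hi w h1 fun l hl => hl, fun v hv hxyv => ?_⟩
      obtain ⟨h3, h4⟩ := hfix v hv hxyv
      obtain ⟨h5, h6⟩ := h2 v hv (by rw [h3, h4, hxyv])
      rw [run_cons, run_cons, h5, h6, h3, h4]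
      exact ⟨rfl, rfl⟩
    · right
      refine ⟨i :: w₁, k, w₂, rfl, hi w₁ h1 fun l hl => by simp [hl], fun v hv hxyv => ?_, h3⟩
      obtain ⟨h3, h4⟩ := hfix v hv hxyv
      obtain ⟨h5, h6⟩ := h2 v hv (by rw [h3, h4, hxyv])
      rw [run_cons, run_cons, h5, h6, h3, h4]
      exact ⟨rfl, rfl⟩

/-- The cost of reaching an event from a set with `u` vertices outside. -/
def eventCost (u : ℕ) : ℕ := ∑ j ∈ Finset.range u, (growCost j + 1)

theorem eventCost_succ (u : ℕ) : eventCost (u + 1) = eventCost u + (growCost u + 1) :=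
  Finset.sum_range_succ _ _

theorem eventCost_mono : Monotone eventCost :=
  monotone_nat_of_le_succ fun u => by rw [eventCost_succ]; omega

theorem eventCost_add (u : ℕ) : eventCost u + u + 3 = Nat.fib (u + 4) := by
  induction u with
  | zero => rfl
  | succ u ih =>
    rw [eventCost_succ]
    have h1 := growCost_add_two_eq u
    have : Nat.fib (u + 1 + 4) = Nat.fib (u + 3) + Nat.fib (u + 4) := Nat.fib_add_two
    omega

/-- The invariant of the growth of `X`. -/
structure GrowInv (N : AndNet V) (J : Finset (Finset V)) (X : Finset V) (x y : V → Bool) :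
    Prop where
  agree : ∀ v ∉ X, x v = y v
  good : ∀ S ∈ J, ∀ a ∈ S, ∀ u ∉ S, N.E u a → x u = y u ∧ x u = N.p u a
  par : ∀ v ∈ X, N.HasPar x X v ∨ x v = true ∧ ∃ S ∈ J, v ∈ S ∧ ∃ u ∉ S, N.E u v
  parents : N.Parents x y J

theorem GrowInv.congr {X : Finset V} (h : N.GrowInv J X x y) {x' y' : V → Bool}
    (hX : ∀ v ∈ X, x' v = x v ∧ y' v = y v) (hU : ∀ v ∉ X, x' v = y' v)
    (hf : ∀ v, N.Feeds J v → x v = y v → x' v = x v ∧ y' v = y v) : N.GrowInv J X x' y' where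
  agree := hU
  good := good_congr h.good hf
  par v hv := by
    rcases h.par v hv with h1 | ⟨h1, h2⟩
    · exact Or.inl (h1.congr (fun u hu => (hX u hu).1.symm) (hX v hv).1.symm)
    · exact Or.inr ⟨by rw [(hX v hv).1, h1], h2⟩
  parents v hv := by
    have hvX : v ∈ X := by
      by_contra hvX
      exact hv (hU v hvX)
    rw [(hX v hvX).1, (hX v hvX).2] at hv
    rcases h.parents v hv with h1 | ⟨u, hu, he, hc⟩
    · exact Or.inl h1
    · have huX : u ∈ X := by
        by_contra huX
        exact hu (h.agree u huX)
      refine Or.inr ⟨u, by rwa [(hX u huX).1, (hX u huX).2], he, ?_⟩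
      rwa [cons_congr (hX u huX).1 (hX v hvX).1]

/-- The update of a vertex outside `X` that does not feed `J`, which adds it to `X`. -/
theorem GrowInv.insert {X : Finset V} (h : N.GrowInv J X x y) {c : V} (hc : c ∉ X)
    (hev : ¬ N.Event J x y c) (hp : ∃ u ∈ X, N.E u c ∧ (x u = N.p u c ↔ N.net x c = true)) :
    N.GrowInv J (insert c X) (N.net.updateAt c x) (N.net.updateAt c y) := by
  have hne : ∀ v ∈ X, v ≠ c := fun v hv h => hc (h ▸ hv)
  have hpar : ∀ u ≠ c, (x u = N.p u c ↔ N.net x c = true) → N.Cons (N.net.updateAt c x) u c := by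
    intro u hu h
    rwa [Cons, updateAt_of_ne hu, updateAt_self]
  refine ⟨?_, good_congr h.good ?_, ?_, ?_⟩
  · intro v hv
    rw [Finset.mem_insert, not_or] at hv
    rw [updateAt_of_ne hv.1, updateAt_of_ne hv.1]
    exact h.agree v hv.2
  · intro v hv hxyv
    by_cases hvi : v = c
    · subst hvi
      rw [updateAt_self, updateAt_self]
      by_contra hcon
      exact hev ⟨hv, fun h => hcon ⟨h.1, by rw [h.2, hxyv]⟩⟩
    · rw [updateAt_of_ne hvi, updateAt_of_ne hvi]
      exact ⟨rfl, rfl⟩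
  · intro v hv
    rcases Finset.mem_insert.1 hv with rfl | hv
    · obtain ⟨u, hu, he, hl⟩ := hp
      exact Or.inl ⟨u, by simp [hu], he, hpar u (hne u hu) hl⟩
    · rcases h.par v hv with h1 | ⟨h1, h2⟩
      · refine Or.inl ((h1.congr (fun u hu => ?_) ?_).mono (Finset.subset_insert _ _))
        · rw [updateAt_of_ne (hne u hu)]
        · rw [updateAt_of_ne (hne v hv)]
      · exact Or.inr ⟨by rw [updateAt_of_ne (hne v hv), h1], h2⟩
  · intro v hv
    by_cases hvc : v = c
    · subst hvc
      rw [updateAt_self, updateAt_self] at hv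
      obtain ⟨u, hu, he, hl⟩ := exists_of_net_ne hv
      have huv : u ≠ v := by
        rintro rfl
        exact hu (h.agree u hc)
      exact Or.inr ⟨u, by rwa [updateAt_of_ne huv, updateAt_of_ne huv], he, hpar u huv hl⟩
    · rw [updateAt_of_ne hvc, updateAt_of_ne hvc] at hv
      rcases h.parents v hv with h1 | ⟨u, hu, he, hcons⟩
      · exact Or.inl h1
      · have huc : u ≠ c := by
          rintro rfl
          exact hu (h.agree u hc)
        refine Or.inr ⟨u, by rwa [updateAt_of_ne huc, updateAt_of_ne huc], he, ?_⟩
        rwa [cons_congr (updateAt_of_ne huc) (updateAt_of_ne hvc)]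

variable [Fintype V]

/-- The growth of `exists_word_grow` is simulated in `x` while following `y`. If the states get
different values at a vertex outside `X` before an event, that vertex itself has a suitable
in-neighbor in `X` and is added instead. -/
theorem exists_word_event_aux (hN : N.NPC) (hstr : N.Strong) (n : ℕ) :
    ∀ (X : Finset V) (x y : V → Bool), Xᶜ.card = n → X.Nonempty → N.GrowInv J X x y →
    ∃ (w : List V) (k : V), (∀ l ∈ w, l ∉ X) ∧ w.length ≤ eventCost n ∧
      (∀ S ∈ J, ∀ a ∈ S, ∀ u ∉ S, N.E u a → N.net.run w x u = N.net.run w y u ∧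
        N.net.run w x u = N.p u a) ∧
      N.Parents (N.net.run w x) (N.net.run w y) J ∧
      N.Event J (N.net.run w x) (N.net.run w y) k := by
  induction n with
  | zero =>
    intro X x y hX hXne h
    rw [Finset.card_eq_zero, Finset.compl_eq_empty_iff] at hX
    subst hX
    obtain ⟨v, -, hv'⟩ := hN x Finset.univ hXne
    -- If `X` contains all vertices, even the exceptional vertices of the cycles are consistently
    -- fed: they are true and so is the literal that enters from outside. This contradicts `NPC`, so
    -- an event must come earlier.
    rcases h.par v (Finset.mem_univ v) with h1 | ⟨h1, S, hS, hvS, u, hu, he⟩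
    · exact absurd h1 hv'
    · exact absurd ⟨u, Finset.mem_univ u, he,
        (cons_of_true h1).2 (h.good S hS v hvS u hu he).2⟩ hv'
  | succ n ih =>
    intro X x y hX hXne h
    -- continuing after having added a vertex
    have step : ∀ (w : List V) (c : V), c ∉ X → (∀ l ∈ w, l ∉ X) → w.length ≤ growCost n + 1 →
        N.GrowInv J (insert c X) (N.net.run w x) (N.net.run w y) →
        ∃ (w : List V) (k : V), (∀ l ∈ w, l ∉ X) ∧ w.length ≤ eventCost (n + 1) ∧
          (∀ S ∈ J, ∀ a ∈ S, ∀ u ∉ S, N.E u a → N.net.run w x u = N.net.run w y u ∧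
            N.net.run w x u = N.p u a) ∧
          N.Parents (N.net.run w x) (N.net.run w y) J ∧
          N.Event J (N.net.run w x) (N.net.run w y) k := by
      intro w c hc hw hwl hinv
      obtain ⟨w', k, hw', hwl', h1, h2, h3⟩ := ih (insert c X) _ _ (by
        rw [Finset.compl_insert, Finset.card_erase_of_mem (by simpa using hc), hX]; rfl)
        (Finset.insert_nonempty _ _) hinv
      refine ⟨w ++ w', k, ?_, ?_, ?_⟩
      · intro l hl
        rcases List.mem_append.1 hl with h | h
        · exact hw l h
        · exact fun hlX => hw' l h (Finset.mem_insert_of_mem hlX)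
      · rw [List.length_append, eventCost_succ]
        omega
      · rw [run_append, run_append]
        exact ⟨h1, h2, h3⟩
    -- an event after a word outside `X`
    have halt : ∀ (w : List V) (k : V), (∀ l ∈ w, l ∉ X) → w.length ≤ growCost n + 1 →
        N.GrowInv J X (N.net.run w x) (N.net.run w y) →
        N.Event J (N.net.run w x) (N.net.run w y) k →
        ∃ (w : List V) (k : V), (∀ l ∈ w, l ∉ X) ∧ w.length ≤ eventCost (n + 1) ∧
          (∀ S ∈ J, ∀ a ∈ S, ∀ u ∉ S, N.E u a → N.net.run w x u = N.net.run w y u ∧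
            N.net.run w x u = N.p u a) ∧
          N.Parents (N.net.run w x) (N.net.run w y) J ∧
          N.Event J (N.net.run w x) (N.net.run w y) k := by
      intro w k hw hwl hinv hev
      exact ⟨w, k, hw, by rw [eventCost_succ]; omega, hinv.good, hinv.parents, hev⟩
    -- the update of a vertex outside `X` after a word outside `X`
    have upd : ∀ (w : List V) (c : V), c ∉ X → (∀ l ∈ w, l ∉ X) → w.length ≤ growCost n →
        N.GrowInv J X (N.net.run w x) (N.net.run w y) →
        (∃ u ∈ X, N.E u c ∧ (N.net.run w x u = N.p u c ↔ N.net (N.net.run w x) c = true)) →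
        ∃ (w : List V) (k : V), (∀ l ∈ w, l ∉ X) ∧ w.length ≤ eventCost (n + 1) ∧
          (∀ S ∈ J, ∀ a ∈ S, ∀ u ∉ S, N.E u a → N.net.run w x u = N.net.run w y u ∧
            N.net.run w x u = N.p u a) ∧
          N.Parents (N.net.run w x) (N.net.run w y) J ∧
          N.Event J (N.net.run w x) (N.net.run w y) k := by
      intro w c hc hw hwl hinv hp
      by_cases hev : N.Event J (N.net.run w x) (N.net.run w y) c
      · exact halt w c hw (by omega) hinv hev
      · refine step (w ++ [c]) c hc ?_ (by simpa using hwl) ?_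
        · intro l hl
          rcases List.mem_append.1 hl with h | h
          · exact hw l h
          · rw [List.mem_singleton] at h; exact h ▸ hc
        · rw [run_concat, run_concat]
          exact hinv.insert hc hev hp
    by_cases h1 : ∃ v ∉ X, ∃ u ∈ X, N.E u v ∧ x u ≠ N.p u v
    · obtain ⟨v, hv, u, hu, he, hl⟩ := h1
      refine upd [] v hv (by simp) (by simp) h ⟨u, hu, he, ?_⟩
      rw [run_nil, net_eq_false.2 ⟨u, he, hl⟩]
      simp [hl]
    push Not at h1
    by_cases h2 : ∃ v ∉ X, x v = true ∧ ∃ u ∈ X, N.E u v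
    · obtain ⟨v, hv, hxv, u, hu, he⟩ := h2
      refine step [] v hv (by simp) (by simp) ⟨?_, h.good, ?_, h.parents⟩
      · intro a ha
        rw [Finset.mem_insert, not_or] at ha
        exact h.agree a ha.2
      · intro a ha
        rcases Finset.mem_insert.1 ha with rfl | ha
        · exact Or.inl ⟨u, by simp [hu], he, (cons_of_true hxv).2 (h1 _ hv u hu he)⟩
        · exact (h.par a ha).imp_left fun h => h.mono (Finset.subset_insert _ _)
    push Not at h2
    have hU : Xᶜ.Nonempty := Finset.card_pos.1 (by omega)
    -- As in `exists_word_grow`, only flipping a false vertex can help now. The strong connectivity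
    -- of the whole graph provides the entry into an initial component of the complement of `X`.
    obtain ⟨C, hCU, hCne, hCp, hCs⟩ := N.exists_predClosed_strongOn hU
    have hCX : ∀ v ∈ C, v ∉ X := fun v hv => Finset.mem_compl.1 (hCU hv)
    obtain ⟨u, huX, v, hvC, he⟩ : ∃ u ∈ X, ∃ v ∈ C, N.E u v := by
      obtain ⟨u, hu, v, hv, he⟩ := hstr {a | a ∉ C} (by
          obtain ⟨a, ha⟩ := hXne
          exact ⟨a, fun h => hCX a h ha⟩) (fun h => by
          obtain ⟨a, ha⟩ := hCne
          have := Set.mem_univ a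
          rw [← h] at this
          exact this ha)
      simp only [Set.mem_ofPred_eq, not_not] at hu hv
      refine ⟨u, ?_, v, hv, he⟩
      by_contra huX
      exact hu (hCp v hv u (by simpa using huX) he)
    have hvX := hCX v hvC
    have huv : u ≠ v := fun h => hvX (h ▸ huX)
    have hxv : x v = false := by
      by_contra h
      exact h2 v hvX (by simpa using h) u huX he
    have hout : ∀ a ∈ C, ∀ b ∉ C, N.E b a → x b = N.p b a := by
      intro a ha b hb hba
      by_cases hbX : b ∈ X
      · exact h1 a (hCX a ha) b hbX hba
      · exact absurd (hCp a ha b (by simpa using hbX) hba) hb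
    obtain ⟨w, hw, hwl, hwp⟩ := exists_word_grow hN _ C {v} v x hCs (by simp) (by simpa using hvC)
      rfl hout (by simp)
    have hCcard : (C \ {v}).card ≤ n := by
      rw [Finset.card_sdiff_of_subset (by simpa using hvC), Finset.card_singleton]
      have := Finset.card_le_card hCU
      omega
    have hwX : ∀ l ∈ w, l ∉ X := fun l hl => hCX l (hw l hl).1
    have hwl' : w.length ≤ growCost n := hwl.trans (growCost_mono hCcard)
    have hinv : ∀ w' : List V, (∀ l ∈ w', l ∈ w) →
        (∀ l ∈ w, N.net.run w' x l = N.net.run w' y l) →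
        (∀ v, N.Feeds J v → x v = y v → N.net.run w' x v = x v ∧ N.net.run w' y v = y v) →
        N.GrowInv J X (N.net.run w' x) (N.net.run w' y) := by
      intro w' hw' hag hfe
      refine h.congr (fun a ha => ?_) (fun a ha => ?_) hfe
      · have : a ∉ w' := fun h => hwX a (hw' a h) ha
        exact ⟨run_of_notMem this, run_of_notMem this⟩
      · by_cases haw : a ∈ w
        · exact hag a haw
        · have : a ∉ w' := fun h => haw (hw' a h)
          rw [run_of_notMem this, run_of_notMem this]
          exact h.agree a ha
    rcases exists_prefix N J w x y fun l hl => h.agree l (hwX l hl) with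
      ⟨hag, hfe⟩ | ⟨w₁, k, w₂, rfl, hag, hfe, hk⟩
    · refine upd w v hvX hwX hwl' (hinv w (fun l hl => hl) hag hfe) ⟨u, huX, he, ?_⟩
      have hwv : N.net.run w x v = false := by
        rw [run_of_notMem fun h => (hw v h).2 (by simp), hxv]
      have hF : N.net (N.net.run w x) v = true := by
        rw [net_eq_true]
        intro b hb
        by_cases hbC : b ∈ C
        · have := hN.not_cons hvC hwp hbC hb
          rwa [cons_of_false hwv, not_not] at this
        · rw [run_of_notMem fun h => hbC (hw b h).1]
          exact hout v hvC b hbC hb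
      rw [hF, run_of_notMem fun h => hwX u h huX]
      simp [h1 v hvX u huX he]
    · have hw1 : ∀ l ∈ w₁, l ∈ w₁ ++ k :: w₂ := fun l hl => by simp [hl]
      have hkX : k ∉ X := hwX k (by simp)
      have hinv1 := hinv w₁ hw1 hag hfe
      have hl1 : w₁.length ≤ growCost n := by
        rw [List.length_append] at hwl'
        omega
      rcases hk with hk | ⟨-, hk⟩
      · exact halt w₁ k (fun l hl => hwX l (hw1 l hl)) (by omega) hinv1 hk
      · refine upd w₁ k hkX (fun l hl => hwX l (hw1 l hl)) hl1 hinv1 ?_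
        obtain ⟨t, ht, hte, htl⟩ := exists_of_net_ne hk
        refine ⟨t, ?_, hte, htl⟩
        by_contra htX
        exact ht (hinv1.agree t htX)

theorem exists_word_event (hN : N.NPC) (hstr : N.Strong) (hc : N.Core x y J)
    (hp : N.Parents x y J) (hJ : J.Nonempty) :
    ∃ (w : List V) (k : V), (∀ l ∈ w, x l = y l) ∧ w.length ≤ eventCost (diff x y)ᶜ.card ∧
      N.Core (N.net.run w x) (N.net.run w y) J ∧
      N.Parents (N.net.run w x) (N.net.run w y) J ∧
      N.Event J (N.net.run w x) (N.net.run w y) k := by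
  have hne : (diff x y).Nonempty := by
    obtain ⟨S, hS⟩ := hJ
    obtain ⟨a, ha⟩ := (hc.ring S hS).nonempty
    exact ⟨a, mem_diff.2 (hc.anti S hS a ha)⟩
  have hinv : N.GrowInv J (diff x y) x y := by
    refine ⟨fun v hv => ?_, hc.good, fun v hv => ?_, hp⟩
    · rwa [mem_diff, not_not] at hv
    · rw [mem_diff] at hv
      rcases hp v hv with ⟨S, hS, hvS⟩ | ⟨u, hu, he⟩
      · obtain ⟨i, hi, hxi, hui, hpar⟩ := hc.cut S hS
        by_cases hvi : v = i
        · subst hvi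
          exact Or.inr ⟨hxi, S, hS, hvS, hui⟩
        · exact Or.inl ((hpar v hvS hvi).mono fun a ha => mem_diff.2 (hc.anti S hS a ha))
      · exact Or.inl ⟨u, mem_diff.2 hu, he⟩
  obtain ⟨w, k, hw, hwl, h1, h2, h3⟩ := exists_word_event_aux hN hstr _ _ x y rfl hne hinv
  have hw' : ∀ l ∈ w, x l = y l := fun l hl => by
    have := hw l hl
    rwa [mem_diff, not_not] at this
  refine ⟨w, k, hw', hwl, ?_, h2, h3⟩
  have hfix : ∀ S ∈ J, ∀ a ∈ S, N.net.run w x a = x a ∧ N.net.run w y a = y a := by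
    intro S hS a ha
    have : a ∉ w := fun h => hc.anti S hS a ha (hw' a h)
    exact ⟨run_of_notMem this, run_of_notMem this⟩
  refine ⟨hc.ring, h1, fun S hS a ha => ?_, fun S hS => ?_⟩
  · rw [(hfix S hS a ha).1, (hfix S hS a ha).2]
    exact hc.anti S hS a ha
  · obtain ⟨i, hi, hxi, hu, hpar⟩ := hc.cut S hS
    refine ⟨i, hi, by rw [(hfix S hS i hi).1, hxi], hu, fun a ha hne => ?_⟩
    exact (hpar a ha hne).congr (fun u hu => (hfix S hS u hu).1.symm) (hfix S hS a ha).1.symm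

end PairGrowth

/-! ### Eliminating the cycles -/

section Reduction

variable {V : Type*} [DecidableEq V] {N : AndNet V} {x y : V → Bool} {v k : V}
  {J : Finset (Finset V)}

/-- After `exists_word_clean`, a remaining differing vertex of `L` has different images, hence an
arc from a differing vertex; `hcons` says that this arc is consistent. The word touches only
differing vertices outside the cycles, so neither the cycles nor their sources change. -/
theorem Core.exists_word_parents (hc : N.Core x y J) (L : Finset V)
    (hLJ : ∀ v ∈ L, ∀ S ∈ J, v ∉ S) (hd : ∀ v, x v ≠ y v → (∃ S ∈ J, v ∈ S) ∨ v ∈ L)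
    (hcons : ∀ v ∈ L, x v ≠ y v → ∀ u, x u ≠ y u → N.E u v → N.Cons x u v) :
    ∃ w : List V, w.length ≤ L.card ∧ N.Core (N.net.run w x) (N.net.run w y) J ∧
      N.Parents (N.net.run w x) (N.net.run w y) J := by
  obtain ⟨w, K, hK, hw, hwl, h1, h2, h3⟩ :=
    exists_word_clean (N := N) _ (L.filter fun v => x v ≠ y v) x y rfl
  have hKL : ∀ v ∈ K, v ∈ L ∧ x v ≠ y v := fun v hv => by simpa using hK hv
  have hnK : ∀ v, N.net.run w x v ≠ N.net.run w y v → v ∉ K := fun v hv h => hv (h2 v h)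
  have hxy : ∀ v, N.net.run w x v ≠ N.net.run w y v → x v ≠ y v := fun v hv => by
    obtain ⟨h4, h5⟩ := h1 v (hnK v hv)
    rwa [h4, h5] at hv
  refine ⟨w, hwl.trans (Finset.card_filter_le _ _), hc.congr fun v hv => h1 v fun hvK => ?_, ?_⟩
  · rcases hv with ⟨S, hS, hvS⟩ | hv
    · exact hLJ v (hKL v hvK).1 S hS hvS
    · exact (hKL v hvK).2 (hc.feeds_agree hv)
  · intro v hv
    have hv' := hxy v hv
    rcases hd v hv' with h | h
    · exact Or.inl h
    · right
      obtain ⟨u, hu, he, -⟩ := exists_of_net_ne (h3 v (by simp [h, hv']) (hnK v hv))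
      refine ⟨u, hu, he, ?_⟩
      rw [cons_congr (h1 u (hnK u hu)).1 (h1 v (hnK v hv)).1]
      exact hcons v h hv' u (hxy u hu) he

theorem Core.card_le (hc : N.Core x y J) : J.card ≤ (J.biUnion id).card := by
  rw [Finset.card_biUnion (t := id) fun S hS T hT hST => hc.disjoint hS hT hST,
    Finset.card_eq_sum_ones]
  exact Finset.sum_le_sum fun S hS => (hc.ring S hS).nonempty.card_pos

variable [Fintype V]

/-- The cycles fed by `k` are equalized, which needs `k` blocking in at least one state, and the
others are kept. For `Parents`, arcs between remaining differing vertices must be made consistent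
where they enter `L` or `k`: `exists_word_kill` removes the bad vertices of `L`, and `k` is treated
according to its two new values and to the presence of a loop. -/
theorem exists_word_of_event (hN : N.NPC) (hstr : N.Strong) (hc : N.Core x y J)
    (hp : N.Parents x y J) (hev : N.Event J x y k) :
    ∃ (w : List V) (J' : Finset (Finset V)), J' ⊆ J ∧ J' ≠ J ∧
      w.length + 2 * ∑ S ∈ J', S.card ≤
        2 * (diff x y \ J.biUnion id).card + 3 + 2 * ∑ S ∈ J, S.card ∧
      N.Core (N.net.run w x) (N.net.run w y) J' ∧
      N.Parents (N.net.run w x) (N.net.run w y) J' := by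
  classical
  have hk : x k = y k := hc.feeds_agree hev.1
  have hkJ : ∀ S ∈ J, k ∉ S := fun S hS h => hc.anti S hS k h hk
  set J₁ := J.filter fun S => ∃ a ∈ S, N.E k a with hJ₁
  set J₂ := J.filter fun S => ¬ ∃ a ∈ S, N.E k a with hJ₂
  have hJ₁J : ∀ S ∈ J₁, S ∈ J := fun S hS => (Finset.mem_filter.1 hS).1
  have hJ₂J : ∀ S ∈ J₂, S ∈ J := fun S hS => (Finset.mem_filter.1 hS).1
  have hsum : ∑ S ∈ J₁, S.card + ∑ S ∈ J₂, S.card = ∑ S ∈ J, S.card :=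
    Finset.sum_filter_add_sum_filter_not _ _ _
  have hne : J₂ ≠ J := by
    intro h
    obtain ⟨S, hS, -, hf⟩ := hev.1
    rw [← h] at hS
    exact (Finset.mem_filter.1 hS).2 hf
  have h12 : ∀ S ∈ J₁, ∀ T ∈ J₂, ∀ a ∈ S, a ∉ T := fun S hS T hT a haS haT => by
    refine Finset.disjoint_left.1 (hc.disjoint (hJ₁J S hS) (hJ₂J T hT) ?_) haS haT
    rintro rfl
    exact (Finset.mem_filter.1 hT).2 (Finset.mem_filter.1 hS).2
  set L := diff x y \ J.biUnion id with hL
  have hLmem : ∀ v, v ∈ L ↔ x v ≠ y v ∧ ∀ S ∈ J, v ∉ S := by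
    intro v
    simp [hL, mem_diff]
  have hkL : k ∉ L := fun h => ((hLmem k).1 h).1 hk
  have hparL : ∀ v ∈ L, N.HasPar x (diff x y) v := by
    intro v hv
    rw [hLmem] at hv
    rcases hp v hv.1 with ⟨S, hS, hvS⟩ | ⟨u, hu, he⟩
    · exact absurd hvS (hv.2 S hS)
    · exact ⟨u, mem_diff.2 hu, he⟩
  -- the words that make the states equal on the cycles fed by `k`
  have killJ : ∀ x₁ y₁ : V → Bool, (∀ v ∉ insert k L, x₁ v = x v ∧ y₁ v = y v) →
      ¬ (x₁ k = x k ∧ y₁ k = x k) →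
      ∃ w : List V, (∀ l ∈ w, ∃ S ∈ J₁, l ∈ S) ∧ w.length ≤ 2 * ∑ S ∈ J₁, S.card ∧
      (∀ S ∈ J₁, ∀ a ∈ S, N.net.run w x₁ a = N.net.run w y₁ a) ∧
      ∀ z : V → Bool, z k ≠ x k → (∀ S ∈ J₁, ∀ a ∈ S, z a = N.net.run w x₁ a) →
        ∀ S ∈ J₁, ∀ a ∈ S, N.E a k → ¬ N.Cons z a k := by
    intro x₁ y₁ hxy₁ hk₁
    have hnot : ∀ S ∈ J, ∀ a ∈ S, ∀ u ∉ S, u ≠ k → N.E u a → u ∉ insert k L := by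
      intro S hS a ha u hu huk he h
      rw [Finset.mem_insert, hLmem] at h
      exact (h.resolve_left huk).1 (hc.good S hS a ha u hu he).1
    refine exists_word_killRings hN hstr J₁ (J.biUnion id) ?_ ?_
      (fun S hS => hc.ring S (hJ₁J S hS)) (fun S hS => (Finset.mem_filter.1 hS).2)
      (fun S hS a ha he => ((hc.good S (hJ₁J S hS) a ha k (hkJ S (hJ₁J S hS)) he).2).symm)
      (fun S hS T hT hST => hc.disjoint (hJ₁J S hS) (hJ₁J T hT) hST) ?_ x₁ y₁ ?_ ?_ hk₁
    · intro S hS a ha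
      exact Finset.mem_biUnion.2 ⟨S, hJ₁J S hS, ha⟩
    · simpa using hkJ
    · intro S hS a ha u hu he h
      obtain ⟨T, hT, huT⟩ := Finset.mem_biUnion.1 h
      exact hc.anti T hT u huT (hc.good S (hJ₁J S hS) a ha u hu he).1
    · intro S hS a ha u hu huk he
      rw [(hxy₁ u (hnot S (hJ₁J S hS) a ha u hu huk he)).1]
      exact (hc.good S (hJ₁J S hS) a ha u hu he).2
    · intro S hS a ha u hu huk he
      rw [(hxy₁ u (hnot S (hJ₁J S hS) a ha u hu huk he)).2]
      have := hc.good S (hJ₁J S hS) a ha u hu he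
      rw [← this.1, this.2]
  have ring_notMem : ∀ v, (∃ S ∈ J₁, v ∈ S) → v ∉ insert k L := by
    rintro v ⟨S, hS, hvS⟩ h
    rcases Finset.mem_insert.1 h with rfl | h
    · exact hkJ S (hJ₁J S hS) hvS
    · exact ((hLmem v).1 h).2 S (hJ₁J S hS) hvS
  -- the final step
  have fin : ∀ w : List V, w.length ≤ L.card + 2 + 2 * ∑ S ∈ J₁, S.card →
      (∀ v ∉ insert k L, (∀ S ∈ J₁, v ∉ S) → N.net.run w x v = x v ∧ N.net.run w y v = y v) →
      (∀ S ∈ J₁, ∀ a ∈ S, N.net.run w x a = N.net.run w y a) →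
      (∀ v ∈ insert k L, N.net.run w x v ≠ N.net.run w y v →
        ∀ u, N.net.run w x u ≠ N.net.run w y u → N.E u v → N.Cons (N.net.run w x) u v) →
      ∃ (w : List V) (J' : Finset (Finset V)), J' ⊆ J ∧ J' ≠ J ∧
        w.length + 2 * ∑ S ∈ J', S.card ≤ 2 * L.card + 3 + 2 * ∑ S ∈ J, S.card ∧
        N.Core (N.net.run w x) (N.net.run w y) J' ∧
        N.Parents (N.net.run w x) (N.net.run w y) J' := by
    intro w hwl hout hag hcons
    have hc₂ : N.Core (N.net.run w x) (N.net.run w y) J₂ := by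
      refine (hc.mono (Finset.filter_subset _ _)).congr fun v hv => ?_
      rcases hv with ⟨T, hT, hvT⟩ | hv
      · refine hout v ?_ fun S hS hvS => h12 S hS T hT v hvS hvT
        rw [Finset.mem_insert, not_or]
        refine ⟨?_, fun h => ((hLmem v).1 h).2 T (hJ₂J T hT) hvT⟩
        rintro rfl
        exact hkJ T (hJ₂J T hT) hvT
      · have hvJ : N.Feeds J v := by
          obtain ⟨T, hT, h⟩ := hv
          exact ⟨T, hJ₂J T hT, h⟩
        have hxv := hc.feeds_agree hvJ
        refine hout v ?_ fun S hS hvS => hc.anti S (hJ₁J S hS) v hvS hxv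
        rw [Finset.mem_insert, not_or]
        refine ⟨?_, fun h => ((hLmem v).1 h).1 hxv⟩
        rintro rfl
        obtain ⟨T, hT, -, h⟩ := hv
        exact (Finset.mem_filter.1 hT).2 h
    obtain ⟨w', hwl', h1, h2⟩ := hc₂.exists_word_parents (insert k L) (by
        intro v hv S hS hvS
        rcases Finset.mem_insert.1 hv with rfl | h
        · exact hkJ S (hJ₂J S hS) hvS
        · exact ((hLmem v).1 h).2 S (hJ₂J S hS) hvS) (by
        intro v hv
        by_contra! hcon
        have hv₁ : ∀ S ∈ J₁, v ∉ S := fun S hS hvS => hv (hag S hS v hvS)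
        obtain ⟨h1, h2⟩ := hout v hcon.2 hv₁
        rw [h1, h2] at hv
        refine hcon.2 (Finset.mem_insert_of_mem ((hLmem v).2 ⟨hv, fun S hS hvS => ?_⟩))
        by_cases hf : ∃ a ∈ S, N.E k a
        · exact hv₁ S (Finset.mem_filter.2 ⟨hS, hf⟩) hvS
        · exact hcon.1 S (Finset.mem_filter.2 ⟨hS, hf⟩) hvS) hcons
    -- Cleaning concerns `L` and `k`, so it adds at most `L.card + 1` letters to the `L.card + 2`
    -- not charged to the cycles.
    refine ⟨w ++ w', J₂, Finset.filter_subset _ _, hne, ?_, ?_⟩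
    · rw [Finset.card_insert_of_notMem hkL] at hwl'
      rw [List.length_append]
      omega
    · rw [run_append, run_append]
      exact ⟨h1, h2⟩
  -- This word acts in the same way before and after an update of `k`, since `k` is not in `diff x
  -- y`.
  obtain ⟨w₁, K, hKL, hw₁, hwl₁, hrun, hKcons⟩ := exists_word_kill hN x y _ L (diff x y) rfl
    Finset.sdiff_subset (fun v hv => mem_diff.1 hv) fun v hv _ => hparL v hv
  have hkK : k ∉ K := fun h => hkL (hKL h)
  have hLne : ∀ v ∈ L, v ≠ k := fun v hv h => hkL (h ▸ hv)
  -- the final step when `k` does not distinguish the states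
  have fin₁ : ∀ w : List V, w.length ≤ L.card + 2 + 2 * ∑ S ∈ J₁, S.card →
      (∀ v, v ≠ k → (∀ S ∈ J₁, v ∉ S) →
        N.net.run w x v = kill K x v ∧ N.net.run w y v = kill K y v) →
      N.net.run w x k = N.net.run w y k →
      (∀ S ∈ J₁, ∀ a ∈ S, N.net.run w x a = N.net.run w y a) →
      ∃ (w : List V) (J' : Finset (Finset V)), J' ⊆ J ∧ J' ≠ J ∧
        w.length + 2 * ∑ S ∈ J', S.card ≤ 2 * L.card + 3 + 2 * ∑ S ∈ J, S.card ∧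
        N.Core (N.net.run w x) (N.net.run w y) J' ∧
        N.Parents (N.net.run w x) (N.net.run w y) J' := by
    intro w hwl hout hkw hag
    refine fin w hwl ?_ hag ?_
    · intro v hv hv₁
      rw [Finset.mem_insert, not_or] at hv
      have hvK : v ∉ K := fun h => hv.2 (hKL h)
      obtain ⟨h1, h2⟩ := hout v hv.1 hv₁
      rw [h1, h2, kill_of_notMem hvK, kill_of_notMem hvK]
      exact ⟨rfl, rfl⟩
    · have hD : ∀ u, N.net.run w x u ≠ N.net.run w y u →
          u ∈ diff x y ∧ u ∉ K ∧ N.net.run w x u = x u := by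
        intro u hu
        have huk : u ≠ k := by
          rintro rfl
          exact hu hkw
        obtain ⟨h1, h2⟩ := hout u huk fun S hS huS => hu (hag S hS u huS)
        have huK : u ∉ K := fun h => hu (by rw [h1, h2, kill_of_mem h, kill_of_mem h])
        rw [kill_of_notMem huK] at h1 h2
        exact ⟨mem_diff.2 (by rwa [h1, h2] at hu), huK, h1⟩
      intro v hv hvne u hu he
      have hvL : v ∈ L := (Finset.mem_insert.1 hv).resolve_left (by
        rintro rfl
        exact hvne hkw)
      obtain ⟨huD, huK, hux⟩ := hD u hu
      obtain ⟨hvD, hvK, hvx⟩ := hD v hvne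
      rw [cons_congr hux hvx]
      exact hKcons v hvL hvK u huD huK he
  -- the case where `k` gets the same new value in the two states
  have same : ∀ w : List V, w.length ≤ L.card + 1 →
      (∀ v, v ≠ k → N.net.run w x v = kill K x v ∧ N.net.run w y v = kill K y v) →
      N.net.run w x k ≠ x k → N.net.run w x k = N.net.run w y k →
      ∃ (w : List V) (J' : Finset (Finset V)), J' ⊆ J ∧ J' ≠ J ∧
        w.length + 2 * ∑ S ∈ J', S.card ≤ 2 * L.card + 3 + 2 * ∑ S ∈ J, S.card ∧
        N.Core (N.net.run w x) (N.net.run w y) J' ∧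
        N.Parents (N.net.run w x) (N.net.run w y) J' := by
    intro w hwl hout hkw hkw'
    obtain ⟨w', hw', hwl', hag, -⟩ := killJ (N.net.run w x) (N.net.run w y) (by
      intro v hv
      rw [Finset.mem_insert, not_or] at hv
      have hvK : v ∉ K := fun h => hv.2 (hKL h)
      obtain ⟨h1, h2⟩ := hout v hv.1
      rw [h1, h2, kill_of_notMem hvK, kill_of_notMem hvK]
      exact ⟨rfl, rfl⟩) (fun h => hkw h.1)
    have hkw₂ : k ∉ w' := fun h => by
      obtain ⟨S, hS, hkS⟩ := hw' k h
      exact hkJ S (hJ₁J S hS) hkS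
    refine fin₁ (w ++ w') (by rw [List.length_append]; omega) ?_ ?_ ?_
    · intro v hv hv₁
      have : v ∉ w' := fun h => by
        obtain ⟨S, hS, hvS⟩ := hw' v h
        exact hv₁ S hS hvS
      rw [run_append, run_append, run_of_notMem this, run_of_notMem this]
      exact hout v hv
    · rw [run_append, run_append, run_of_notMem hkw₂, run_of_notMem hkw₂, hkw']
    · rw [run_append, run_append]
      exact hag
  have hupd : ∀ v ∈ diff x y, N.net.updateAt k x v = x v ∧ N.net.updateAt k y v = y v := by
    intro v hv
    have : v ≠ k := by
      rintro rfl
      exact mem_diff.1 hv hk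
    exact ⟨updateAt_of_ne this, updateAt_of_ne this⟩
  by_cases hF : N.net x k = N.net y k
  · have hFk : N.net x k ≠ x k := fun h => hev.2 ⟨h, by rw [← hF, h]⟩
    obtain ⟨h1, h2⟩ := hrun _ _ hupd
    refine same (k :: w₁) (by simpa using hwl₁) ?_ ?_ ?_
    · intro v hv
      rw [run_cons, run_cons, h1, h2]
      simp [kill, updateAt_of_ne hv]
    · rw [run_cons, h1, kill_of_notMem hkK, updateAt_self]
      exact hFk
    · rw [run_cons, run_cons, h1, h2, kill_of_notMem hkK, kill_of_notMem hkK, updateAt_self,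
        updateAt_self, hF]
  -- Without a loop, `k` may stay among the differing vertices, as the arcs from differing vertices
  -- to `k` become consistent with its new value. A loop is negative, hence never consistent, so in
  -- that case `k` must be made equal in the two states.
  by_cases hloop : N.E k k
  swap
  · -- `k` distinguishes the states after its update
    set x₁ := N.net.updateAt k x with hx₁
    set y₁ := N.net.updateAt k y with hy₁
    have hx₁k : x₁ k = N.net x k := updateAt_self k
    have hy₁k : y₁ k = N.net y k := updateAt_self k
    have hx₁v : ∀ v, v ≠ k → x₁ v = x v ∧ y₁ v = y v := fun v hv =>
      ⟨updateAt_of_ne hv, updateAt_of_ne hv⟩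
    obtain ⟨w₂, K₂, hK₂L, hw₂, hwl₂, hrun₂, hcons₂⟩ := exists_word_kill hN x₁ y₁ _ L
      (insert k (diff x y)) rfl (Finset.sdiff_subset.trans (Finset.subset_insert _ _)) (by
        intro v hv
        rcases Finset.mem_insert.1 hv with rfl | h
        · rwa [hx₁k, hy₁k]
        · rw [(hupd v h).1, (hupd v h).2]
          exact mem_diff.1 h) (by
        intro v hv _
        refine ((hparL v hv).congr (fun u hu => (hupd u hu).1.symm) ?_).mono
          (Finset.subset_insert _ _)
        exact (hx₁v v (hLne v hv)).1.symm)
    obtain ⟨h1, h2⟩ := hrun₂ x₁ y₁ fun _ _ => ⟨rfl, rfl⟩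
    have hkK₂ : k ∉ K₂ := fun h => hkL (hK₂L h)
    obtain ⟨w', hw', hwl', hag, -⟩ := killJ (N.net.run w₂ x₁) (N.net.run w₂ y₁) (by
      intro v hv
      rw [Finset.mem_insert, not_or] at hv
      have hvK : v ∉ K₂ := fun h => hv.2 (hK₂L h)
      rw [h1, h2, kill_of_notMem hvK, kill_of_notMem hvK]
      exact hx₁v v hv.1) (by
      rw [h1, h2, kill_of_notMem hkK₂, kill_of_notMem hkK₂, hx₁k, hy₁k]
      exact fun h => hF (h.1.trans h.2.symm))
    have hrw : ∀ v, (∀ S ∈ J₁, v ∉ S) → N.net.run (k :: (w₂ ++ w')) x v = kill K₂ x₁ v ∧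
        N.net.run (k :: (w₂ ++ w')) y v = kill K₂ y₁ v := by
      intro v hv
      have : v ∉ w' := fun h => by
        obtain ⟨S, hS, hvS⟩ := hw' v h
        exact hv S hS hvS
      rw [run_cons, run_cons, run_append, run_append, run_of_notMem this, run_of_notMem this,
        ← hx₁, ← hy₁, h1, h2]
      exact ⟨rfl, rfl⟩
    have hag' : ∀ S ∈ J₁, ∀ a ∈ S, N.net.run (k :: (w₂ ++ w')) x a =
        N.net.run (k :: (w₂ ++ w')) y a := by
      rw [run_cons, run_cons, run_append, run_append]
      exact hag
    refine fin (k :: (w₂ ++ w')) ?_ ?_ hag' ?_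
    · rw [List.length_cons, List.length_append]
      omega
    · intro v hv hv₁
      rw [Finset.mem_insert, not_or] at hv
      have hvK : v ∉ K₂ := fun h => hv.2 (hK₂L h)
      obtain ⟨h3, h4⟩ := hrw v hv₁
      rw [h3, h4, kill_of_notMem hvK, kill_of_notMem hvK]
      exact hx₁v v hv.1
    · have hD : ∀ u, N.net.run (k :: (w₂ ++ w')) x u ≠ N.net.run (k :: (w₂ ++ w')) y u →
          u ∈ insert k (diff x y) ∧ u ∉ K₂ ∧ N.net.run (k :: (w₂ ++ w')) x u = x₁ u := by
        intro u hu
        obtain ⟨h3, h4⟩ := hrw u fun S hS huS => hu (hag' S hS u huS)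
        have huK : u ∉ K₂ := fun h => hu (by rw [h3, h4, kill_of_mem h, kill_of_mem h])
        rw [kill_of_notMem huK] at h3 h4
        refine ⟨?_, huK, h3⟩
        by_cases huk : u = k
        · exact huk ▸ Finset.mem_insert_self _ _
        · refine Finset.mem_insert_of_mem (mem_diff.2 ?_)
          rwa [h3, h4, (hx₁v u huk).1, (hx₁v u huk).2] at hu
      intro v hv hvne u hu he
      obtain ⟨huD, huK, hux⟩ := hD u hu
      obtain ⟨hvD, hvK, hvx⟩ := hD v hvne
      rw [cons_congr hux hvx]
      rcases Finset.mem_insert.1 hv with rfl | hvL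
      · have huv : u ≠ v := by
          rintro rfl
          exact hloop he
        have huD := mem_diff.1 ((Finset.mem_insert.1 huD).resolve_left huv)
        rw [Cons, hx₁k, (hx₁v u huv).1]
        exact lit_iff_of_net_ne hF huD he
      · exact hcons₂ v hvL hvK u huD huK he
  -- the case of a loop at `k`
  have hpk := hN.loop hloop
  have hκ : x k = false := by
    by_cases h : N.net x k = true
    · rw [net_eq_true.1 h k hloop, hpk]
    · have : N.net y k = true := by
        rw [Bool.not_eq_true] at h
        simpa [h] using hF
      rw [hk, net_eq_true.1 this k hloop, hpk]
  have hxd : ∀ v ∈ diff x y, x v = x v ∧ y v = y v := fun _ _ => ⟨rfl, rfl⟩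
  -- If `k` becomes true in both states after the removal of `K`, postponing its update leads to the
  -- case of a common new value. Otherwise `k` is updated first, blocks in one state while the
  -- cycles are equalized, and then returns to false in both.
  by_cases hE : N.net (kill K x) k = true ∧ N.net (kill K y) k = true
  · obtain ⟨h1, h2⟩ := hrun _ _ hxd
    refine same (w₁ ++ [k]) (by simpa using hwl₁) ?_ ?_ ?_
    · intro v hv
      rw [run_concat, run_concat, updateAt_of_ne hv, updateAt_of_ne hv, h1, h2]
      exact ⟨rfl, rfl⟩
    · rw [run_concat, updateAt_self, h1, hE.1, hκ]
      simp
    · rw [run_concat, run_concat, updateAt_self, updateAt_self, h1, h2, hE.1, hE.2]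
  obtain ⟨h1, h2⟩ := hrun _ _ hupd
  have hx₂k : N.net.run (k :: w₁) x k = N.net x k := by
    rw [run_cons, h1, kill_of_notMem hkK, updateAt_self]
  have hy₂k : N.net.run (k :: w₁) y k = N.net y k := by
    rw [run_cons, h2, kill_of_notMem hkK, updateAt_self]
  have hx₂v : ∀ v, v ≠ k →
      N.net.run (k :: w₁) x v = kill K x v ∧ N.net.run (k :: w₁) y v = kill K y v := by
    intro v hv
    rw [run_cons, run_cons, h1, h2]
    simp [kill, updateAt_of_ne hv]
  obtain ⟨w', hw', hwl', hag, hlit⟩ := killJ (N.net.run (k :: w₁) x) (N.net.run (k :: w₁) y) (by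
      intro v hv
      rw [Finset.mem_insert, not_or] at hv
      have hvK : v ∉ K := fun h => hv.2 (hKL h)
      obtain ⟨h1, h2⟩ := hx₂v v hv.1
      rw [h1, h2, kill_of_notMem hvK, kill_of_notMem hvK]
      exact ⟨rfl, rfl⟩) (by
      rw [hx₂k, hy₂k]
      exact fun h => hF (h.1.trans h.2.symm))
  set x₃ := N.net.run w' (N.net.run (k :: w₁) x) with hx₃
  set y₃ := N.net.run w' (N.net.run (k :: w₁) y) with hy₃
  have hkw' : k ∉ w' := fun h => by
    obtain ⟨S, hS, hkS⟩ := hw' k h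
    exact hkJ S (hJ₁J S hS) hkS
  have hx₃k : x₃ k = N.net x k := by rw [hx₃, run_of_notMem hkw', hx₂k]
  have hy₃k : y₃ k = N.net y k := by rw [hy₃, run_of_notMem hkw', hy₂k]
  have hx₃v : ∀ v, v ≠ k → (∀ S ∈ J₁, v ∉ S) → x₃ v = kill K x v ∧ y₃ v = kill K y v := by
    intro v hv hv₁
    have : v ∉ w' := fun h => by
      obtain ⟨S, hS, hvS⟩ := hw' v h
      exact hv₁ S hS hvS
    rw [hx₃, hy₃, run_of_notMem this, run_of_notMem this]
    exact hx₂v v hv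
  -- A false literal is found in each state. An equalized cycle entering `k` supplies one by `hlit`.
  -- A surviving differing in-neighbor supplies one where `k` is false, and the loop does so where
  -- `k` is true. Failing both, the in-neighbors agree after the removal of `K`, and the negation of
  -- `hE` supplies one, which is not the loop because `k` was false.
  have hfalse : N.net x₃ k = false ∧ N.net y₃ k = false := by
    by_cases hi : ∃ S ∈ J₁, ∃ a ∈ S, N.E a k
    · obtain ⟨S, hS, a, ha, he⟩ := hi
      have key : ∀ z : V → Bool, z k = true → (∀ S ∈ J₁, ∀ a ∈ S, z a = x₃ a) →
          x₃ a ≠ N.p a k := by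
        intro z hz hzr
        have := hlit z (by rw [hz, hκ]; simp) hzr S hS a ha he
        rwa [cons_of_true hz, hzr S hS a ha] at this
      have : x₃ a ≠ N.p a k := by
        by_cases h : N.net x k = true
        · exact key x₃ (by rw [hx₃k, h]) fun _ _ _ _ => rfl
        · refine key y₃ ?_ fun S hS a ha => (hag S hS a ha).symm
          rw [Bool.not_eq_true] at h
          rw [hy₃k]
          simpa [h] using hF
      exact ⟨net_eq_false.2 ⟨a, he, this⟩,
        net_eq_false.2 ⟨a, he, by rw [← hag S hS a ha]; exact this⟩⟩
    push Not at hi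
    have hnotJ : ∀ u, N.E u k → ∀ S ∈ J₁, u ∉ S := fun u he S hS huS => hi S hS u huS he
    by_cases hii : ∃ u ∈ diff x y, u ∉ K ∧ N.E u k
    · obtain ⟨u, hu, huK, he⟩ := hii
      rw [mem_diff] at hu
      have huk : u ≠ k := by
        rintro rfl
        exact hu hk
      obtain ⟨h3, h4⟩ := hx₃v u huk (hnotJ u he)
      rw [kill_of_notMem huK] at h3 h4
      have h5 := lit_iff_of_net_ne hF hu he
      have h6 := lit_iff_of_net_ne (Ne.symm hF) hu.symm he
      by_cases h : N.net x k = true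
      · have h' : N.net y k = false := by simpa [h] using Ne.symm hF
        refine ⟨net_eq_false.2 ⟨k, hloop, by rw [hx₃k, h, hpk]; simp⟩,
          net_eq_false.2 ⟨u, he, ?_⟩⟩
        rw [h4, Ne, h6, h']
        simp
      · rw [Bool.not_eq_true] at h
        have h' : N.net y k = true := by simpa [h] using Ne.symm hF
        refine ⟨net_eq_false.2 ⟨u, he, ?_⟩,
          net_eq_false.2 ⟨k, hloop, by rw [hy₃k, h', hpk]; simp⟩⟩
        rw [h3, Ne, h5, h]
        simp
    · push Not at hii
      have heq : ∀ u, N.E u k → kill K x u = kill K y u := by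
        intro u he
        by_cases huK : u ∈ K
        · rw [kill_of_mem huK, kill_of_mem huK]
        · rw [kill_of_notMem huK, kill_of_notMem huK]
          by_contra hne
          exact hii u (mem_diff.2 hne) huK he
      have hneteq : N.net (kill K x) k = N.net (kill K y) k := net_congr heq
      have hnet : N.net (kill K x) k = false := by
        by_contra h
        rw [Bool.not_eq_false] at h
        exact hE ⟨h, hneteq ▸ h⟩
      obtain ⟨u, he, hu⟩ := net_eq_false.1 hnet
      have huk : u ≠ k := by
        rintro rfl
        rw [kill_of_notMem hkK, hκ, hpk] at hu
        exact hu rfl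
      obtain ⟨h3, h4⟩ := hx₃v u huk (hnotJ u he)
      exact ⟨net_eq_false.2 ⟨u, he, by rw [h3]; exact hu⟩,
        net_eq_false.2 ⟨u, he, by rw [h4, ← heq u he]; exact hu⟩⟩
  have hrx : ∀ z : V → Bool, N.net.run ((k :: w₁) ++ w' ++ [k]) z =
      N.net.updateAt k (N.net.run w' (N.net.run (k :: w₁) z)) := by
    intro z
    rw [run_concat, run_append]
  refine fin₁ ((k :: w₁) ++ w' ++ [k]) ?_ ?_ ?_ ?_
  · simp only [List.length_append, List.length_cons, List.length_nil]
    omega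
  · intro v hv hv₁
    rw [hrx, hrx, updateAt_of_ne hv, updateAt_of_ne hv]
    exact hx₃v v hv hv₁
  · rw [hrx, hrx, updateAt_self, updateAt_self, ← hx₃, ← hy₃, hfalse.1, hfalse.2]
  · intro S hS a ha
    have hak : a ≠ k := by
      rintro rfl
      exact hkJ S (hJ₁J S hS) ha
    rw [hrx, hrx, updateAt_of_ne hak, updateAt_of_ne hak]
    exact hag S hS a ha

/-- The cost of an event with `u` vertices outside the cycles. -/
def stepCost (u : ℕ) : ℕ := eventCost u + 2 * u + 1

/-- The term with `S.card` is a potential that pays for equalizing cycles. The rest of the cost is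
bounded using that the cycles have at least `J.card` vertices in total and that `k` does not
distinguish the states. -/
theorem exists_word_step (hN : N.NPC) (hstr : N.Strong) (hc : N.Core x y J)
    (hp : N.Parents x y J) (hJ : J.Nonempty) :
    ∃ (w : List V) (J' : Finset (Finset V)), J' ⊆ J ∧ J' ≠ J ∧
      w.length + 2 * ∑ S ∈ J', S.card ≤
        stepCost (Fintype.card V - J.card) + 2 * ∑ S ∈ J, S.card ∧
      N.Core (N.net.run w x) (N.net.run w y) J' ∧
      N.Parents (N.net.run w x) (N.net.run w y) J' := by
  obtain ⟨w, k, hw, hwl, hc', hp', hev⟩ := exists_word_event hN hstr hc hp hJ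
  obtain ⟨w', J', hJ', hne, hwl', h1, h2⟩ := exists_word_of_event hN hstr hc' hp' hev
  refine ⟨w ++ w', J', hJ', hne, ?_, by rw [run_append, run_append]; exact ⟨h1, h2⟩⟩
  have hAD : ∀ {x y : V → Bool}, N.Core x y J → J.biUnion id ⊆ diff x y := by
    intro x y hc v hv
    obtain ⟨S, hS, hvS⟩ := Finset.mem_biUnion.1 hv
    exact mem_diff.2 (hc.anti S hS v hvS)
  have hkD : k ∉ diff (N.net.run w x) (N.net.run w y) := by
    rw [mem_diff, not_not]
    exact hc'.feeds_agree hev.1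
  have h3 := hc.card_le
  have h4 := Finset.card_le_card (hAD hc)
  have h5 := Finset.card_sdiff_of_subset (hAD hc')
  have h6 := Finset.card_le_card (Finset.subset_univ
    (insert k (diff (N.net.run w x) (N.net.run w y))))
  rw [Finset.card_insert_of_notMem hkD, Finset.card_univ] at h6
  have h7 := Finset.card_le_card (hAD hc')
  have h8 : eventCost (diff x y)ᶜ.card ≤ eventCost (Fintype.card V - J.card) := by
    rw [Finset.card_compl]
    exact eventCost_mono (by omega)
  rw [List.length_append, stepCost]
  omega

/-- Two states satisfying the invariant can be merged. -/
theorem Core.exists_word_eq (hN : N.NPC) (hstr : N.Strong) (n : ℕ) :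
    ∀ (J : Finset (Finset V)) (x y : V → Bool), J.card = n → N.Core x y J → N.Parents x y J →
    ∃ w : List V, N.net.run w x = N.net.run w y ∧ w.length ≤
      ∑ i ∈ Finset.range n, stepCost (Fintype.card V - (i + 1)) + 2 * ∑ S ∈ J, S.card := by
  induction n using Nat.strong_induction_on with
  | _ n ih =>
  intro J x y hJn hc hp
  rcases J.eq_empty_or_nonempty with rfl | hJ
  · refine ⟨[], ?_, by simp⟩
    by_contra hne
    obtain ⟨v, hv⟩ := Function.ne_iff.1 hne
    obtain ⟨v, hv, hv'⟩ := hN x (diff x y) ⟨v, mem_diff.2 hv⟩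
    rcases hp v (mem_diff.1 hv) with ⟨S, hS, -⟩ | ⟨u, hu, he⟩
    · simp at hS
    · exact hv' ⟨u, mem_diff.2 hu, he⟩
  · obtain ⟨w, J', hJ', hne, hwl, h1, h2⟩ := exists_word_step hN hstr hc hp hJ
    have hlt : J'.card < n := hJn ▸ Finset.card_lt_card (hJ'.ssubset_of_ne hne)
    obtain ⟨w', hw', hwl'⟩ := ih J'.card hlt J' _ _ rfl h1 h2
    refine ⟨w ++ w', by rwa [run_append, run_append], ?_⟩
    -- The number of cycles strictly decreases, so each number of cycles is charged at most once.
    obtain ⟨m, rfl⟩ : ∃ m, n = m + 1 := ⟨n - 1, by omega⟩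
    have hsum : ∑ i ∈ Finset.range J'.card, stepCost (Fintype.card V - (i + 1)) ≤
        ∑ i ∈ Finset.range m, stepCost (Fintype.card V - (i + 1)) :=
      Finset.sum_le_sum_of_subset (Finset.range_subset_range.2 (by omega))
    rw [Finset.sum_range_succ, List.length_append]
    rw [hJn] at hwl
    omega

theorem Core.exists_word_eq_card (hN : N.NPC) (hstr : N.Strong) (hc : N.Core x y J)
    (hp : N.Parents x y J) : ∃ w : List V, N.net.run w x = N.net.run w y ∧ w.length ≤
      ∑ u ∈ Finset.range (Fintype.card V), stepCost u + 2 * Fintype.card V := by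
  obtain ⟨w, hw, hwl⟩ := hc.exists_word_eq hN hstr _ J x y rfl hp
  refine ⟨w, hw, hwl.trans ?_⟩
  have h1 : ∑ S ∈ J, S.card = (J.biUnion id).card :=
    (Finset.card_biUnion fun S hS T hT hST => hc.disjoint hS hT hST).symm
  have h2 := Finset.card_le_card (Finset.subset_univ (J.biUnion id))
  rw [Finset.card_univ] at h2
  have h3 := hc.card_le
  have h4 : ∑ i ∈ Finset.range J.card, stepCost (Fintype.card V - (i + 1)) ≤
      ∑ i ∈ Finset.range (Fintype.card V), stepCost (Fintype.card V - (i + 1)) :=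
    Finset.sum_le_sum_of_subset (Finset.range_subset_range.2 (by omega))
  have h5 : ∑ i ∈ Finset.range (Fintype.card V), stepCost (Fintype.card V - (i + 1)) =
      ∑ i ∈ Finset.range (Fintype.card V), stepCost i := by
    rw [← Finset.sum_range_reflect]
    refine Finset.sum_congr rfl fun i hi => ?_
    rw [Finset.mem_range] at hi
    congr 1
    omega
  omega

end Reduction

/-! ### Pairs of states whose differing vertices have different images -/

section Literals

variable {V : Type*} {N : AndNet V} {x y : V → Bool} {r v : V}

theorem lit_of_net_ne (h : N.net x v ≠ N.net y v) {u : V} (hu : x u = y u) (he : N.E u v) :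
    x u = N.p u v := by
  by_cases hx : N.net x v = true
  · exact net_eq_true.1 hx u he
  · have hy : N.net y v = true := by
      rw [Bool.not_eq_true] at hx
      simpa [hx] using h.symm
    rw [hu, net_eq_true.1 hy u he]

theorem net_eq_true_iff_lit (he : N.E r v) (h : ∀ u, u ≠ r → N.E u v → x u = N.p u v) :
    N.net x v = true ↔ x r = N.p r v := by
  rw [net_eq_true]
  refine ⟨fun h => h r he, fun hr u hu => ?_⟩
  by_cases hur : u = r
  · rw [hur, hr]
  · exact h u hur hu

/-- Every vertex that distinguishes two states has different images. -/
def Stuck (N : AndNet V) (x y : V → Bool) : Prop := ∀ v, x v ≠ y v → N.net x v ≠ N.net y v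

/-- `t` and another vertex that distinguish the states are in-neighbors of the same vertex that
distinguishes the states. -/
def Joint (N : AndNet V) (x y : V → Bool) (t : V) : Prop :=
  ∃ v u, x v ≠ y v ∧ x u ≠ y u ∧ u ≠ t ∧ N.E t v ∧ N.E u v

/-- The vertices that distinguish two states form a set `D` where every vertex has a unique
in-neighbor, and the literals entering `D` are true. -/
structure Functional (N : AndNet V) (D : Finset V) (x y : V → Bool) : Prop where
  ne_iff : ∀ v, x v ≠ y v ↔ v ∈ D
  existsUnique : ∀ v ∈ D, ∃! u, u ∈ D ∧ N.E u v
  lit : ∀ v ∈ D, ∀ u ∉ D, N.E u v → x u = N.p u v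

theorem Functional.eq_of_mem {D : Finset V} {u : V} (h : N.Functional D x y) {u' : V} (hv : v ∈ D) (hu : u ∈ D)
    (he : N.E u v) (hu' : u' ∈ D) (he' : N.E u' v) : u = u' :=
  (h.existsUnique v hv).unique ⟨hu, he⟩ ⟨hu', he'⟩

theorem Functional.net_iff {D : Finset V} {u : V} (h : N.Functional D x y) (hv : v ∈ D) (hu : u ∈ D) (he : N.E u v) :
    (N.net x v = true ↔ x u = N.p u v) ∧ (N.net y v = true ↔ y u = N.p u v) := by
  have hD : ∀ t, t ≠ u → N.E t v → t ∉ D := fun t ht hte htD =>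
    ht (h.eq_of_mem hv htD hte hu he)
  refine ⟨net_eq_true_iff_lit he fun t ht hte => h.lit v hv t (hD t ht hte) hte,
    net_eq_true_iff_lit he fun t ht hte => ?_⟩
  rw [← h.lit v hv t (hD t ht hte) hte]
  by_contra hne
  exact hD t ht hte ((h.ne_iff t).1 (Ne.symm hne))

end Literals

/-! ### Reduction to a functional set of differing vertices -/

section Wave

variable {V : Type*} [DecidableEq V] {N : AndNet V} {x y : V → Bool} {r v t : V}

theorem exists_next {Z : Finset V} (hr : r ≠ t)
    (h : Relation.ReflTransGen (fun a b => N.E a b ∧ b ∈ Z) r t) :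
    ∃ s, N.E r s ∧ s ∈ Z.erase r ∧
      Relation.ReflTransGen (fun a b => N.E a b ∧ b ∈ Z.erase r) s t := by
  have key : ∀ a, Relation.ReflTransGen (fun a b => N.E a b ∧ b ∈ Z) a t →
      (a ≠ r ∧ Relation.ReflTransGen (fun a b => N.E a b ∧ b ∈ Z.erase r) a t) ∨
      ∃ s, N.E r s ∧ s ∈ Z.erase r ∧
      Relation.ReflTransGen (fun a b => N.E a b ∧ b ∈ Z.erase r) s t := by
    intro a ha
    induction ha using Relation.ReflTransGen.head_induction_on with
    | refl => exact Or.inl ⟨hr.symm, Relation.ReflTransGen.refl⟩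
    | @head a b hab _ ih =>
      rcases ih with ⟨hb, h⟩ | h
      · have hbZ : b ∈ Z.erase r := Finset.mem_erase.2 ⟨hb, hab.2⟩
        by_cases har : a = r
        · subst har
          exact Or.inr ⟨b, hab.1, hbZ, h⟩
        · exact Or.inl ⟨har, Relation.ReflTransGen.head ⟨hab.1, hbZ⟩ h⟩
      · exact Or.inr h
  rcases key r h with h | h
  · exact absurd rfl h.1
  · exact h

theorem not_eq_of_ne_of_ne {a b c : Bool} (h : a ≠ b) (h' : a ≠ c) : b = c := by
  cases a <;> cases b <;> cases c <;> simp_all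

variable [Fintype V]

/-- A flippable vertex `r` is moved towards `t` inside `Z`. When it is one of two differing
in-neighbors of a differing `v`, flipping it makes their literals at `v` opposite; the update of `v`
then gives false in both states. Each vertex of `Z` is updated at most once, and `v` accounts for
the last letter. -/
theorem Stuck.exists_word_wave (n : ℕ) : ∀ (Z : Finset V) (r : V) (x y : V → Bool), Z.card = n →
    N.Stuck x y → r ∈ Z → (∀ z ∈ Z, x z ≠ y z) → N.net x r ≠ x r → N.Joint x y t →
    Relation.ReflTransGen (fun a b => N.E a b ∧ b ∈ Z) r t →
    ∃ w : List V, w.length ≤ n + 1 ∧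
      (diff (N.net.run w x) (N.net.run w y)).card < (diff x y).card := by
  induction n with
  | zero =>
    intro Z r x y hZ _ hr
    rw [Finset.card_eq_zero] at hZ
    simp [hZ] at hr
  | succ n ih =>
    intro Z r x y hZ hst hr hZD hroot hjoint hreach
    have hrD := hZD r hr
    have hFr := hst r hrD
    have hroot' : N.net y r ≠ y r := by
      intro h
      have h1 := not_eq_of_ne_of_ne hFr hroot
      exact hrD (h1.symm.trans h)
    have hx₁r : N.net.updateAt r x r ≠ x r := by rwa [updateAt_self]
    have hy₁r : N.net.updateAt r y r ≠ y r := by rwa [updateAt_self]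
    have hv₁ : ∀ v, v ≠ r → N.net.updateAt r x v = x v ∧ N.net.updateAt r y v = y v :=
      fun v hv => ⟨updateAt_of_ne hv, updateAt_of_ne hv⟩
    have hD₁ : ∀ v, N.net.updateAt r x v ≠ N.net.updateAt r y v ↔ x v ≠ y v := by
      intro v
      by_cases hv : v = r
      · subst hv
        simpa [updateAt_self, hrD] using hFr
      · rw [(hv₁ v hv).1, (hv₁ v hv).2]
    by_cases hJr : N.Joint x y r
    · obtain ⟨v, u, hv, hu, hur, hev, heu⟩ := hJr
      have key : ∀ z : V → Bool, N.net.updateAt r z r ≠ z r →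
          (z r = N.p r v ↔ N.net z v = true) → (z u = N.p u v ↔ N.net z v = true) →
          N.net (N.net.updateAt r z) v = false := by
        intro z hzr h1 h2
        rw [net_eq_false]
        by_cases h : N.net z v = true
        · exact ⟨r, hev, by rwa [h1.2 h] at hzr⟩
        · exact ⟨u, heu, by rw [updateAt_of_ne hur]; exact fun h' => h (h2.1 h')⟩
      have hFv := hst v hv
      have hfx := key x hx₁r (lit_iff_of_net_ne hFv hrD hev) (lit_iff_of_net_ne hFv hu heu)
      have hfy := key y hy₁r (lit_iff_of_net_ne hFv.symm hrD.symm hev)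
        (lit_iff_of_net_ne hFv.symm hu.symm heu)
      refine ⟨[r, v], by simp, Finset.card_lt_card ?_⟩
      rw [Finset.ssubset_iff_of_subset]
      · refine ⟨v, mem_diff.2 hv, ?_⟩
        rw [mem_diff, not_not]
        simp [run_cons, run_nil, updateAt_self, hfx, hfy]
      · intro a ha
        rw [mem_diff] at ha ⊢
        by_cases hav : a = v
        · rwa [hav]
        · rw [run_cons, run_cons, run_cons, run_cons, run_nil, run_nil, updateAt_of_ne hav,
            updateAt_of_ne hav, hD₁] at ha
          exact ha
    have hrt : r ≠ t := by
      rintro rfl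
      exact hJr hjoint
    obtain ⟨s, hes, hsZ, hst'⟩ := exists_next hrt hreach
    have hsr := (Finset.mem_erase.1 hsZ).1
    have hsD := hZD s (Finset.mem_erase.1 hsZ).2
    have hcard : (Z.erase r).card = n := by
      rw [Finset.card_erase_of_mem hr, hZ]
      rfl
    by_cases hs : N.net x s = x s
    · -- the update of `r` makes `s` a root
      have honly : ∀ v, x v ≠ y v → N.E r v → ∀ u, u ≠ r → N.E u v → x u = y u := by
        intro v hv hev u hu heu
        by_contra hne
        exact hJr ⟨v, u, hv, hne, hu, hev, heu⟩
      have hlit : ∀ v, x v ≠ y v → N.E r v → ∀ u, u ≠ r → N.E u v →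
          x u = N.p u v ∧ y u = N.p u v := by
        intro v hv hev u hu heu
        have h1 := honly v hv hev u hu heu
        have h2 := lit_of_net_ne (hst v hv) h1 heu
        exact ⟨h2, by rw [← h1, h2]⟩
      have hnet : ∀ v, x v ≠ y v → N.E r v →
          (N.net x v = true ↔ x r = N.p r v) ∧
          (N.net (N.net.updateAt r x) v = true ↔ N.net.updateAt r x r = N.p r v) ∧
          (N.net (N.net.updateAt r y) v = true ↔ N.net.updateAt r y r = N.p r v) := by
        intro v hv hev
        refine ⟨net_eq_true_iff_lit hev fun u hu heu => (hlit v hv hev u hu heu).1,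
          net_eq_true_iff_lit hev fun u hu heu => ?_, net_eq_true_iff_lit hev fun u hu heu => ?_⟩
        · rw [(hv₁ u hu).1, (hlit v hv hev u hu heu).1]
        · rw [(hv₁ u hu).2, (hlit v hv hev u hu heu).2]
      have hst₁ : N.Stuck (N.net.updateAt r x) (N.net.updateAt r y) := by
        intro v hv
        rw [hD₁] at hv
        by_cases hev : N.E r v
        · obtain ⟨-, h2, h3⟩ := hnet v hv hev
          intro heq
          rw [heq, h3] at h2
          refine (hD₁ r).2 hrD ?_
          by_cases h : N.net.updateAt r x r = N.p r v
          · rw [h, h2.2 h]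
          · exact not_eq_of_ne_of_ne (Ne.symm h) fun h' => h (h2.1 h'.symm)
        · have hur : ∀ u, N.E u v → u ≠ r := fun u hu h => hev (h ▸ hu)
          rw [net_congr (N := N) fun u hu => (hv₁ u (hur u hu)).1,
            net_congr (N := N) fun u hu => (hv₁ u (hur u hu)).2]
          exact hst v hv
      have hs₁ : N.net (N.net.updateAt r x) s ≠ N.net.updateAt r x s := by
        rw [(hv₁ s hsr).1, ← hs]
        obtain ⟨h1, h2, -⟩ := hnet s hsD hes
        intro heq
        rw [heq, h1] at h2
        refine hx₁r ?_
        by_cases h : x r = N.p r s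
        · rw [h, h2.1 h]
        · exact not_eq_of_ne_of_ne (fun h' => h (h2.2 h'.symm)) (Ne.symm h)
      obtain ⟨w, hwl, hw⟩ := ih (Z.erase r) s _ _ hcard hst₁ hsZ
        (fun z hz => (hD₁ z).2 (hZD z (Finset.mem_of_mem_erase hz))) hs₁ (by
          obtain ⟨v, u, h1, h2, h3⟩ := hjoint
          exact ⟨v, u, (hD₁ v).2 h1, (hD₁ u).2 h2, h3⟩) hst'
      refine ⟨r :: w, by simpa using hwl, ?_⟩
      rw [run_cons, run_cons]
      refine hw.trans_eq ?_
      congr 1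
      ext v
      rw [mem_diff, mem_diff, hD₁]
    -- Here `s` is already flippable, so `r` is left as it is.
    · obtain ⟨w, hwl, hw⟩ := ih (Z.erase r) s x y hcard hst hsZ
        (fun z hz => hZD z (Finset.mem_of_mem_erase hz)) hs hjoint hst'
      exact ⟨w, by omega, hw⟩

/-- The cost of making functional the set of `d` vertices that distinguish two states. -/
def normCost (d : ℕ) : ℕ := ∑ i ∈ Finset.range d, (i + 2)

theorem normCost_succ (d : ℕ) : normCost (d + 1) = normCost d + (d + 2) :=
  Finset.sum_range_succ _ _

theorem normCost_mono : Monotone normCost :=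
  monotone_nat_of_le_succ fun d => by rw [normCost_succ]; omega

theorem exists_word_functional (hN : N.NPC) (d : ℕ) : ∀ x y : V → Bool, (diff x y).card = d →
    ∃ (w : List V) (D : Finset V), w.length ≤ normCost d ∧
      N.Functional D (N.net.run w x) (N.net.run w y) := by
  induction d using Nat.strong_induction_on with
  | _ d ih =>
  intro x y hd
  have step : ∀ w : List V, w.length ≤ d + 1 →
      (diff (N.net.run w x) (N.net.run w y)).card < (diff x y).card →
      ∃ (w : List V) (D : Finset V), w.length ≤ normCost d ∧
        N.Functional D (N.net.run w x) (N.net.run w y) := by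
    intro w hwl hlt
    obtain ⟨w', D, hwl', hD⟩ := ih _ (hd ▸ hlt) _ _ rfl
    refine ⟨w ++ w', D, ?_, by rwa [run_append, run_append]⟩
    obtain ⟨e, rfl⟩ : ∃ e, d = e + 1 := ⟨d - 1, by omega⟩
    have := normCost_mono (show (diff (N.net.run w x) (N.net.run w y)).card ≤ e by omega)
    rw [List.length_append, normCost_succ]
    omega
  by_cases hst : N.Stuck x y
  swap
  · rw [Stuck] at hst
    push Not at hst
    obtain ⟨v, hv, he⟩ := hst
    refine step [v] (by simp) (Finset.card_lt_card ?_)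
    rw [Finset.ssubset_iff_of_subset]
    · refine ⟨v, mem_diff.2 hv, ?_⟩
      rw [mem_diff, not_not]
      simp [run_cons, run_nil, updateAt_self, he]
    · intro a ha
      rw [mem_diff] at ha ⊢
      by_cases hav : a = v
      · rwa [hav]
      · rwa [run_cons, run_cons, run_nil, run_nil, updateAt_of_ne hav, updateAt_of_ne hav] at ha
  by_cases hj : ∃ t, x t ≠ y t ∧ N.Joint x y t
  · obtain ⟨t, ht, hjt⟩ := hj
    classical
    set A := (diff x y).filter fun a =>
      Relation.ReflTransGen (fun a b => N.E a b ∧ b ∈ diff x y) a t with hA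
    -- A vertex of `A` without consistent arc from `A` is flippable: some differing in-neighbor,
    -- also in `A`, has a literal equal to the image of `r`, which would be consistent if `r` kept
    -- its value.
    obtain ⟨r, hr, hr'⟩ := hN x A ⟨t, Finset.mem_filter.2
      ⟨mem_diff.2 ht, Relation.ReflTransGen.refl⟩⟩
    rw [hA, Finset.mem_filter] at hr
    have hrD := mem_diff.1 hr.1
    obtain ⟨u, hu, he, hl⟩ := exists_of_net_ne (hst r hrD)
    have huA : u ∈ A := Finset.mem_filter.2
      ⟨mem_diff.2 hu, Relation.ReflTransGen.head ⟨he, hr.1⟩ hr.2⟩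
    obtain ⟨w, hwl, hw⟩ := Stuck.exists_word_wave d (diff x y) r x y hd hst hr.1
      (fun z hz => mem_diff.1 hz) (fun h => hr' ⟨u, huA, he, by rwa [h] at hl⟩) hjt hr.2
    exact step w hwl hw
  · refine ⟨[], diff x y, by simp, fun v => mem_diff.symm, fun v hv => ?_, fun v hv u hu he => ?_⟩
    · have hv := mem_diff.1 hv
      obtain ⟨u, hu, he, -⟩ := exists_of_net_ne (hst v hv)
      refine ⟨u, ⟨mem_diff.2 hu, he⟩, fun u' hu' => ?_⟩
      by_contra hne
      exact hj ⟨u, hu, v, u', hv, mem_diff.1 hu'.1, hne, he, hu'.2⟩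
    · rw [mem_diff, not_not] at hu
      exact lit_of_net_ne (hst v (mem_diff.1 hv)) hu he

end Wave

/-! ### From a functional set to the invariant -/

section Settle

variable {V : Type*} [DecidableEq V] {N : AndNet V} {x y : V → Bool} {u v : V}
  {D : Finset V}

/-- On `D`, a component is a literal of its single in-neighbor in `D`, where the states differ; so
its two new values differ as well. -/
theorem Functional.updateAt (h : N.Functional D x y) (hv : v ∈ D) :
    N.Functional D (N.net.updateAt v x) (N.net.updateAt v y) := by
  refine ⟨fun a => ?_, h.existsUnique, fun a ha b hb he => ?_⟩
  · by_cases hav : a = v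
    · subst hav
      rw [updateAt_self, updateAt_self]
      refine iff_of_true ?_ hv
      obtain ⟨u, ⟨hu, he⟩, -⟩ := h.existsUnique a hv
      obtain ⟨h1, h2⟩ := h.net_iff hv hu he
      intro heq
      rw [heq, h2] at h1
      refine (h.ne_iff u).2 hu ?_
      by_cases hx : x u = N.p u a
      · rw [hx, h1.2 hx]
      · exact not_eq_of_ne_of_ne (Ne.symm hx) fun h' => hx (h1.1 h'.symm)
    · rw [updateAt_of_ne hav, updateAt_of_ne hav]
      exact h.ne_iff a
  · rw [updateAt_of_ne (ne_of_mem_of_not_mem hv hb).symm]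
    exact h.lit a ha b hb he

/-- Every part of `D` closed under in-neighbors meets `B`, so updates can propagate from `B` through
all of `D`, each making its vertex consistent with an already treated in-neighbor. -/
theorem Functional.exists_word_settle (B : Finset V)
    (hB : ∀ S ⊆ D, S.Nonempty → N.PredClosed D S → ∃ b ∈ S, b ∈ B) (n : ℕ) :
    ∀ (Z : Finset V) (x y : V → Bool), (D \ Z).card = n → B ⊆ Z → Z ⊆ D →
    N.Functional D x y → (∀ v ∈ Z, v ∉ B → N.HasPar x Z v) →
    ∃ w : List V, (∀ l ∈ w, l ∉ Z) ∧ w.length ≤ n ∧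
      N.Functional D (N.net.run w x) (N.net.run w y) ∧
      ∀ v ∈ D, v ∉ B → N.HasPar (N.net.run w x) D v := by
  induction n with
  | zero =>
    intro Z x y hZ _ hZD h hpar
    rw [Finset.card_eq_zero, Finset.sdiff_eq_empty_iff_subset] at hZ
    obtain rfl := hZ.antisymm hZD
    exact ⟨[], by simp, by simp, h, hpar⟩
  | succ n ih =>
    intro Z x y hZ hBZ hZD h hpar
    obtain ⟨v, hv, u, hu, he⟩ : ∃ v ∈ D \ Z, ∃ u ∈ Z, N.E u v := by
      by_contra! hcon
      obtain ⟨b, hb, hbB⟩ := hB (D \ Z) Finset.sdiff_subset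
        (Finset.card_pos.1 (by omega)) fun v hv u hu he =>
          Finset.mem_sdiff.2 ⟨hu, fun huZ => hcon v hv u huZ he⟩
      exact (Finset.mem_sdiff.1 hb).2 (hBZ hbB)
    rw [Finset.mem_sdiff] at hv
    have hne : ∀ a ∈ Z, a ≠ v := fun a ha hav => hv.2 (hav ▸ ha)
    obtain ⟨w, hw, hwl, h1, h2⟩ := ih (insert v Z) (N.net.updateAt v x) (N.net.updateAt v y)
      (by
        rw [Finset.sdiff_insert, Finset.card_erase_of_mem (Finset.mem_sdiff.2 hv), hZ]
        rfl)
      (hBZ.trans (Finset.subset_insert _ _)) (Finset.insert_subset hv.1 hZD) (h.updateAt hv.1) (by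
        intro a ha haB
        rcases Finset.mem_insert.1 ha with rfl | ha
        · refine ⟨u, by simp [hu], he, ?_⟩
          rw [Cons, updateAt_self, updateAt_of_ne (hne u hu)]
          exact (h.net_iff hv.1 (hZD hu) he).1.symm
        · refine ((hpar a ha haB).congr (fun b hb => ?_) ?_).mono (Finset.subset_insert _ _)
          · rw [updateAt_of_ne (hne b hb)]
          · rw [updateAt_of_ne (hne a ha)])
    refine ⟨v :: w, ?_, by simpa using hwl, by rwa [run_cons, run_cons], by rwa [run_cons]⟩
    intro l hl
    rcases List.mem_cons.1 hl with rfl | h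
    · exact hv.2
    · exact fun hlZ => hw l h (Finset.mem_insert_of_mem hlZ)

/-- The chordless cycles of a functional set, as minimal sets closed under in-neighbors. -/
noncomputable def rings (N : AndNet V) (D : Finset V) : Finset (Finset V) := by
  classical
  exact D.powerset.filter fun S => S.Nonempty ∧ N.PredClosed D S ∧
    ∀ T ⊆ S, T.Nonempty → N.PredClosed D T → T = S

theorem mem_rings {S : Finset V} : S ∈ N.rings D ↔ S ⊆ D ∧ S.Nonempty ∧ N.PredClosed D S ∧
    ∀ T ⊆ S, T.Nonempty → N.PredClosed D T → T = S := by
  simp [rings]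

theorem exists_mem_rings {U : Finset V} (hU : U ⊆ D) (hne : U.Nonempty)
    (hp : N.PredClosed D U) : ∃ S ∈ N.rings D, S ⊆ U := by
  obtain ⟨S, hSU, hS⟩ := exists_minimal_le_of_wellFoundedLT
    (fun S : Finset V => S.Nonempty ∧ N.PredClosed D S) U ⟨hne, hp⟩
  refine ⟨S, mem_rings.2 ⟨hSU.trans hU, hS.1.1, hS.1.2, fun T hT hTne hTp => ?_⟩, hSU⟩
  exact hT.antisymm (hS.2 ⟨hTne, hTp⟩ hT)

theorem rings_disjoint {S T : Finset V} (hS : S ∈ N.rings D) (hT : T ∈ N.rings D)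
    (hST : S ≠ T) : Disjoint S T := by
  rw [Finset.disjoint_iff_inter_eq_empty]
  by_contra hne
  have hne := Finset.nonempty_iff_ne_empty.2 hne
  rw [mem_rings] at hS hT
  have hp : N.PredClosed D (S ∩ T) := fun v hv u hu he => by
    rw [Finset.mem_inter] at hv ⊢
    exact ⟨hS.2.2.1 v hv.1 u hu he, hT.2.2.1 v hv.2 u hu he⟩
  exact hST ((hS.2.2.2 _ Finset.inter_subset_left hne hp).symm.trans
    (hT.2.2.2 _ Finset.inter_subset_right hne hp))

theorem Functional.isRing (h : N.Functional D x y) {S : Finset V} (hS : S ∈ N.rings D) :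
    N.IsRing S := by
  rw [mem_rings] at hS
  refine ⟨hS.2.1, fun a ha => ?_, fun T hT hTne hTp => ?_⟩
  · obtain ⟨u, ⟨hu, he⟩, huniq⟩ := h.existsUnique a (hS.1 ha)
    exact ⟨u, ⟨hS.2.2.1 a ha u hu he, he⟩, fun u' hu' => huniq u' ⟨hS.1 hu'.1, hu'.2⟩⟩
  · refine hS.2.2.2 T hT hTne fun v hv u hu he => ?_
    exact hTp v hv u (hS.2.2.1 v (hT hv) u hu he) he

/-- Some vertex does not have exactly one in-neighbor. -/
def NotFunctional (N : AndNet V) : Prop := ¬ ∀ v, ∃! u, N.E u v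

/-- This is where the graph must not be a single cycle: a chordless cycle covering all vertices
would give each of them exactly one in-neighbor. -/
theorem Functional.exists_feeder (h : N.Functional D x y) (hstr : N.Strong)
    (hnf : N.NotFunctional) {S : Finset V} (hS : S ∈ N.rings D) : ∃ b ∈ S, ∃ u ∉ S, N.E u b := by
  by_cases hu : ∀ v, v ∈ S
  · refine absurd (fun v => ?_) hnf
    obtain ⟨u, hu', huniq⟩ := (h.isRing hS).existsUnique v (hu v)
    exact ⟨u, hu'.2, fun u' he => huniq u' ⟨hu u', he⟩⟩
  · push Not at hu
    obtain ⟨a, ha⟩ := (mem_rings.1 hS).2.1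
    obtain ⟨u, hu, v, hv, he⟩ := hstr {v | v ∉ S} hu (fun h => by
      have := Set.mem_univ a
      rw [← h] at this
      exact this ha)
    simp only [Set.mem_ofPred_eq, not_not] at hu hv
    exact ⟨v, hv, u, hu, he⟩

/-- The vertices `b S` can be set to true, when the cycles `S` are settled. -/
theorem Functional.exists_word_flip (hN : N.NPC) (h : N.Functional D x y) (b : Finset V → V)
    (hb : ∀ S ∈ N.rings D, b S ∈ S)
    (hpar : ∀ S ∈ N.rings D, ∀ v ∈ S, v ≠ b S → N.HasPar x S v) (J : Finset (Finset V))
    (hJ : J ⊆ N.rings D) :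
    ∃ w : List V, (∀ l ∈ w, ∃ S ∈ J, l = b S) ∧ w.length ≤ J.card ∧
      N.Functional D (N.net.run w x) (N.net.run w y) ∧ ∀ S ∈ J, N.net.run w x (b S) = true := by
  induction J using Finset.induction_on with
  | empty => exact ⟨[], by simp, by simp, h, by simp⟩
  | insert S J hSJ ih =>
    obtain ⟨w, hw, hwl, h1, h2⟩ := ih fun T hT => hJ (Finset.mem_insert_of_mem hT)
    have hS : S ∈ N.rings D := hJ (Finset.mem_insert_self _ _)
    have hTS : ∀ T ∈ J, b T ∉ S := fun T hT hbS => by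
      have hT' := hJ (Finset.mem_insert_of_mem hT)
      exact Finset.disjoint_left.1 (rings_disjoint hS hT' fun h => hSJ (h ▸ hT)) hbS (hb T hT')
    have hfix : ∀ a ∈ S, N.net.run w x a = x a := fun a ha => run_of_notMem fun haw => by
      obtain ⟨T, hT, rfl⟩ := hw a haw
      exact hTS T hT ha
    have hbD : b S ∈ D := (mem_rings.1 hS).1 (hb S hS)
    by_cases hxb : N.net.run w x (b S) = true
    · refine ⟨w, fun l hl => ?_, hwl.trans (Finset.card_le_card (Finset.subset_insert _ _)), h1, ?_⟩
      · obtain ⟨T, hT, h⟩ := hw l hl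
        exact ⟨T, Finset.mem_insert_of_mem hT, h⟩
      · intro T hT
        rcases Finset.mem_insert.1 hT with rfl | hT
        exacts [hxb, h2 T hT]
    · rw [Bool.not_eq_true] at hxb
      have hF : N.net (N.net.run w x) (b S) = true := by
        obtain ⟨u, ⟨hu, he⟩, -⟩ := h1.existsUnique _ hbD
        have huS := (mem_rings.1 hS).2.2.1 _ (hb S hS) u hu he
        have := hN.not_cons (x := N.net.run w x) (hb S hS) (fun v hv hne =>
          (hpar S hS v hv hne).congr (fun a ha => (hfix a ha).symm) (hfix v hv).symm) huS he
        rw [cons_of_false hxb, not_not] at this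
        exact (h1.net_iff hbD hu he).1.2 this
      refine ⟨w ++ [b S], ?_, ?_, ?_, ?_⟩
      · intro l hl
        rcases List.mem_append.1 hl with hl | hl
        · obtain ⟨T, hT, h⟩ := hw l hl
          exact ⟨T, Finset.mem_insert_of_mem hT, h⟩
        · exact ⟨S, Finset.mem_insert_self _ _, List.mem_singleton.1 hl⟩
      · rw [Finset.card_insert_of_notMem hSJ, List.length_append, List.length_singleton]
        omega
      · rw [run_concat, run_concat]
        exact h1.updateAt hbD
      · intro T hT
        rw [run_concat]
        rcases Finset.mem_insert.1 hT with rfl | hT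
        · rw [updateAt_self, hF]
        · rw [updateAt_of_ne (ne_of_mem_of_not_mem (hb S hS) (hTS T hT)).symm, h2 T hT]

variable [Fintype V]

/-- One vertex per cycle, fed from outside, is singled out. A first settling makes these vertices
flippable, they are set to true, and a second settling repairs the consistency that the flips
destroyed. -/
theorem Functional.exists_word_core (hN : N.NPC) (hstr : N.Strong) (hnf : N.NotFunctional)
    (h : N.Functional D x y) :
    ∃ (w : List V) (J : Finset (Finset V)), w.length ≤ 2 * Fintype.card V ∧
      N.Core (N.net.run w x) (N.net.run w y) J ∧
      N.Parents (N.net.run w x) (N.net.run w y) J := by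
  have hb : ∀ S, ∃ b, S ∈ N.rings D → b ∈ S ∧ ∃ u ∉ S, N.E u b := by
    intro S
    by_cases hS : S ∈ N.rings D
    · obtain ⟨b, hb, hu⟩ := h.exists_feeder hstr hnf hS
      exact ⟨b, fun _ => ⟨hb, hu⟩⟩
    · by_cases hV : Nonempty V
      · exact ⟨Classical.choice hV, fun h => absurd h hS⟩
      · rw [not_nonempty_iff] at hV
        exact absurd (fun v => hV.elim v) hnf
  choose b hb using hb
  set B := (N.rings D).image b with hBdef
  have hBD : B ⊆ D := by
    intro v hv
    obtain ⟨S, hS, rfl⟩ := Finset.mem_image.1 hv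
    exact (mem_rings.1 hS).1 (hb S hS).1
  have hB : ∀ S ⊆ D, S.Nonempty → N.PredClosed D S → ∃ b ∈ S, b ∈ B := by
    intro U hU hne hp
    obtain ⟨S, hS, hSU⟩ := exists_mem_rings hU hne hp
    exact ⟨b S, hSU (hb S hS).1, Finset.mem_image_of_mem _ hS⟩
  have hBS : ∀ S ∈ N.rings D, ∀ v ∈ S, v ≠ b S → v ∉ B := by
    intro S hS v hv hne hvB
    obtain ⟨T, hT, rfl⟩ := Finset.mem_image.1 hvB
    refine Finset.disjoint_left.1 (rings_disjoint hS hT ?_) hv (hb T hT).1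
    rintro rfl
    exact hne rfl
  have hring : ∀ z : V → Bool, (∀ v ∈ D, v ∉ B → N.HasPar z D v) →
      ∀ S ∈ N.rings D, ∀ v ∈ S, v ≠ b S → N.HasPar z S v := by
    intro z hz S hS v hv hne
    have hS' := mem_rings.1 hS
    obtain ⟨u, hu, he, hc⟩ := hz v (hS'.1 hv) (hBS S hS v hv hne)
    exact ⟨u, hS'.2.2.1 v hv u hu he, he, hc⟩
  have hBcard : B.card = (N.rings D).card := Finset.card_image_of_injOn fun S hS T hT he => by
    by_contra hne
    refine Finset.disjoint_left.1 (rings_disjoint hS hT hne) (hb S hS).1 ?_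
    exact he ▸ (hb T hT).1
  obtain ⟨w₁, -, hwl₁, h₁, hp₁⟩ := Functional.exists_word_settle B hB _ B x y rfl subset_rfl hBD h
    fun v hv hv' => absurd hv hv'
  obtain ⟨w₂, -, hwl₂, h₂, ht₂⟩ := h₁.exists_word_flip hN b (fun S hS => (hb S hS).1)
    (hring _ hp₁) _ subset_rfl
  obtain ⟨w₃, hw₃, hwl₃, h₃, hp₃⟩ := Functional.exists_word_settle B hB _ B _ _ rfl subset_rfl hBD
    h₂ fun v hv hv' => absurd hv hv'
  refine ⟨w₁ ++ w₂ ++ w₃, N.rings D, ?_, ?_⟩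
  · have h4 := Finset.card_sdiff_of_subset hBD
    have h5 := Finset.card_le_card hBD
    have h6 := Finset.card_le_card (Finset.subset_univ D)
    rw [Finset.card_univ] at h6
    simp only [List.length_append]
    omega
  · rw [run_append, run_append, run_append, run_append]
    refine ⟨⟨fun S hS => h.isRing hS, ?_, ?_, ?_⟩, ?_⟩
    · intro S hS a ha u hu he
      have hS' := mem_rings.1 hS
      have huD : u ∉ D := fun huD => hu (hS'.2.2.1 a ha u huD he)
      refine ⟨?_, h₃.lit a (hS'.1 ha) u huD he⟩
      by_contra hne
      exact huD ((h₃.ne_iff u).1 hne)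
    · intro S hS a ha
      exact (h₃.ne_iff a).2 ((mem_rings.1 hS).1 ha)
    · intro S hS
      refine ⟨b S, (hb S hS).1, ?_, (hb S hS).2, hring _ hp₃ S hS⟩
      rw [run_of_notMem fun hmem => hw₃ _ hmem (Finset.mem_image_of_mem _ hS), ht₂ S hS]
    · intro v hv
      have hvD := (h₃.ne_iff v).1 hv
      by_cases hvB : v ∈ B
      · obtain ⟨S, hS, rfl⟩ := Finset.mem_image.1 hvB
        exact Or.inl ⟨S, hS, (hb S hS).1⟩
      · obtain ⟨u, hu, he⟩ := hp₃ v hvD hvB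
        exact Or.inr ⟨u, (h₃.ne_iff u).2 hu, he⟩

/-- The cost of merging two states. -/
def mergeCost (n : ℕ) : ℕ :=
  normCost n + 2 * n + (∑ u ∈ Finset.range n, stepCost u + 2 * n)

/-- Any two states can be merged. -/
theorem exists_word_merge (hN : N.NPC) (hstr : N.Strong) (hnf : N.NotFunctional)
    (x y : V → Bool) :
    ∃ w : List V, N.net.run w x = N.net.run w y ∧ w.length ≤ mergeCost (Fintype.card V) := by
  obtain ⟨w₁, D, hwl₁, hD⟩ := exists_word_functional hN _ x y rfl
  obtain ⟨w₂, J, hwl₂, hc, hp⟩ := hD.exists_word_core hN hstr hnf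
  obtain ⟨w₃, hw₃, hwl₃⟩ := hc.exists_word_eq_card hN hstr hp
  refine ⟨w₁ ++ w₂ ++ w₃, by simpa only [run_append] using hw₃, ?_⟩
  have h1 := Finset.card_le_card (Finset.subset_univ (diff x y))
  rw [Finset.card_univ] at h1
  have h2 := normCost_mono h1
  simp only [List.length_append, mergeCost]
  omega

end Settle

/-! ### From merging pairs to synchronizing -/

section Synchronization

variable {V : Type*} [DecidableEq V] [Fintype V] {N : AndNet V}

theorem exists_word_const_on (hN : N.NPC) (hstr : N.Strong) (hnf : N.NotFunctional)
    (A : Finset (V → Bool)) :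
    ∃ (w : List V) (c : V → Bool), (∀ x ∈ A, N.net.run w x = c) ∧
      w.length ≤ (A.card - 1) * mergeCost (Fintype.card V) := by
  induction A using Finset.induction_on with
  | empty => exact ⟨[], fun _ => false, by simp, by simp⟩
  | insert a A ha ih =>
    rcases A.eq_empty_or_nonempty with rfl | hA
    · exact ⟨[], a, by simp [run_nil], by simp⟩
    · obtain ⟨w, c, hw, hwl⟩ := ih
      obtain ⟨w', hw', hwl'⟩ := exists_word_merge hN hstr hnf (N.net.run w a) c
      refine ⟨w ++ w', N.net.run w' c, fun x hx => ?_, ?_⟩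
      · rw [run_append]
        rcases Finset.mem_insert.1 hx with rfl | hx
        · exact hw'
        · rw [hw x hx]
      · obtain ⟨m, hm⟩ : ∃ m, A.card = m + 1 := ⟨A.card - 1, by have := hA.card_pos; omega⟩
        rw [Finset.card_insert_of_notMem ha, List.length_append, hm]
        rw [hm] at hwl
        simp only [Nat.add_sub_cancel] at hwl ⊢
        rw [Nat.succ_mul]
        omega

theorem exists_synchronizingWord (hN : N.NPC) (hstr : N.Strong) (hnf : N.NotFunctional) :
    ∃ w : List V, N.net.IsSynchronizingWord w ∧
      w.length ≤ 2 ^ Fintype.card V * mergeCost (Fintype.card V) := by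
  obtain ⟨w, c, hw, hwl⟩ := exists_word_const_on hN hstr hnf Finset.univ
  refine ⟨w, ⟨c, fun x => hw x (Finset.mem_univ x)⟩, hwl.trans (Nat.mul_le_mul_right _ ?_)⟩
  simp

end Synchronization

/-! ### Bounds by Fibonacci numbers and the golden ratio -/

section Numeric

theorem stepCost_add (u : ℕ) : stepCost u + 2 = Nat.fib (u + 4) + u := by
  have := eventCost_add u
  rw [stepCost]
  omega

theorem mergeCost_add (n : ℕ) : mergeCost n + 5 = Nat.fib (n + 5) + n ^ 2 + 3 * n := by
  induction n with
  | zero => rfl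
  | succ n ih =>
    have h1 := stepCost_add n
    have h2 : Nat.fib (n + 1 + 5) = Nat.fib (n + 4) + Nat.fib (n + 5) := Nat.fib_add_two
    have h3 : (n + 1) ^ 2 = n ^ 2 + 2 * n + 1 := by ring
    rw [mergeCost] at ih ⊢
    rw [normCost_succ, Finset.sum_range_succ, h3]
    omega

theorem sq_add_le_fib (n : ℕ) : n ^ 2 + 3 * n ≤ Nat.fib (n + 5) + 5 := by
  induction n using Nat.strong_induction_on with
  | _ n ih =>
    rcases Nat.lt_or_ge n 5 with h | h
    · interval_cases n <;> decide
    · obtain ⟨m, rfl⟩ : ∃ m, n = m + 2 := ⟨n - 2, by omega⟩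
      have h1 := ih m (by omega)
      have h2 := ih (m + 1) (by omega)
      have h3 : Nat.fib (m + 2 + 5) = Nat.fib (m + 5) + Nat.fib (m + 1 + 5) := Nat.fib_add_two
      nlinarith

theorem mergeCost_le (n : ℕ) : mergeCost n ≤ 2 * Nat.fib (n + 5) := by
  have h1 := mergeCost_add n
  have h2 := sq_add_le_fib n
  omega

theorem two_mul_fib_le (n : ℕ) :
    (2 ^ n * (2 * Nat.fib (n + 5)) : ℝ) ≤ 10 * (Real.sqrt 5 + 1) ^ n := by
  have h5 : Real.sqrt 5 ^ 2 = 5 := Real.sq_sqrt (by norm_num)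
  have h22 : (2.2 : ℝ) ≤ Real.sqrt 5 := Real.le_sqrt_of_sq_le (by norm_num)
  set φ : ℝ := (Real.sqrt 5 + 1) / 2 with hφ
  have hφ2 : φ ^ 2 = φ + 1 := by rw [hφ, div_pow, add_sq, h5]; ring
  have hφ16 : 1.6 ≤ φ := by rw [hφ]; linarith
  have hpow : ∀ m : ℕ, φ ^ m = Nat.fib m * (φ - 1) + Nat.fib (m + 1) := by
    intro m
    induction m with
    | zero => simp
    | succ m ih =>
      rw [pow_succ, ih, Nat.fib_add_two (n := m)]
      push_cast
      linear_combination (Nat.fib m : ℝ) * hφ2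
  have hfib : (Nat.fib (n + 5) : ℝ) = 5 * Nat.fib (n + 1) + 3 * Nat.fib n := by
    have : Nat.fib (n + 5) = 5 * Nat.fib (n + 1) + 3 * Nat.fib n := by
      have h1 : Nat.fib (n + 2) = Nat.fib n + Nat.fib (n + 1) := Nat.fib_add_two
      have h2 : Nat.fib (n + 3) = Nat.fib (n + 1) + Nat.fib (n + 2) := Nat.fib_add_two
      have h3 : Nat.fib (n + 4) = Nat.fib (n + 2) + Nat.fib (n + 3) := Nat.fib_add_two
      have h4 : Nat.fib (n + 5) = Nat.fib (n + 3) + Nat.fib (n + 4) := Nat.fib_add_two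
      omega
    exact_mod_cast this
  have h2φ : Real.sqrt 5 + 1 = 2 * φ := by rw [hφ]; ring
  -- The coefficients of `Nat.fib (n + 1)` are both 10; those of `Nat.fib n` are 6 and `10 * (φ -
  -- 1)`, whence the bound `1.6 ≤ φ`.
  have hle : (2 * Nat.fib (n + 5) : ℝ) ≤ 10 * φ ^ n := by
    rw [hpow, hfib]
    have : (0 : ℝ) ≤ Nat.fib n := Nat.cast_nonneg _
    nlinarith
  calc (2 ^ n * (2 * Nat.fib (n + 5)) : ℝ) ≤ 2 ^ n * (10 * φ ^ n) :=
        mul_le_mul_of_nonneg_left hle (by positivity)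
    _ = 10 * (Real.sqrt 5 + 1) ^ n := by rw [h2φ, mul_pow]; ring

end Numeric

end AndNet

/-! ### Dependence on in-neighbors and complementation -/

namespace BooleanNetwork

variable {V : Type*} [DecidableEq V] {f : BooleanNetwork V} {i j : V}

theorem apply_update (h : ∀ s, ¬ f.interactionDigraph.Arc j i s) (x : V → Bool) (b : Bool) :
    f (Function.update x j b) i = f x i := by
  have key : ∀ x : V → Bool, x j = false → f (Function.update x j true) i = f x i := by
    intro x hx
    by_contra hne
    rcases lt_or_gt_of_ne hne with hlt | hlt
    · exact h (-1) ⟨x, hx, Or.inr ⟨rfl, hlt⟩⟩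
    · exact h 1 ⟨x, hx, Or.inl ⟨rfl, hlt⟩⟩
  cases hxj : x j <;> cases b
  · rw [← hxj, Function.update_eq_self]
  · exact key x hxj
  · have := key (Function.update x j false) (by simp)
    rw [Function.update_idem, ← hxj, Function.update_eq_self] at this
    exact this.symm
  · rw [← hxj, Function.update_eq_self]

theorem apply_eq_of_agree [Fintype V] {x y : V → Bool}
    (h : ∀ j s, f.interactionDigraph.Arc j i s → x j = y j) : f x i = f y i := by
  have key : ∀ (A : Finset V) (x : V → Bool), (∀ j, x j ≠ y j → j ∈ A) →
      (∀ j s, f.interactionDigraph.Arc j i s → x j = y j) → f x i = f y i := by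
    intro A
    induction A using Finset.induction_on with
    | empty =>
      intro x hx _
      congr 1
      funext j
      by_contra hne
      simpa using hx j hne
    | insert a A _ ih =>
      intro x hx hag
      by_cases ha : x a = y a
      · refine ih x (fun j hj => ?_) hag
        refine (Finset.mem_insert.1 (hx j hj)).resolve_left ?_
        rintro rfl
        exact hj ha
      · rw [← apply_update (fun s hs => ha (hag a s hs)) x (y a)]
        refine ih _ (fun j hj => ?_) fun j s hs => ?_
        · by_cases hja : j = a
          · subst hja
            simp at hj
          · rw [Function.update_of_ne hja] at hj
            exact (Finset.mem_insert.1 (hx j hj)).resolve_left hja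
        · by_cases hja : j = a
          · subst hja
            simp
          · rw [Function.update_of_ne hja]
            exact hag j s hs
  exact key Finset.univ x (fun j _ => Finset.mem_univ j) h

theorem exists_apply_ne {s : ℤˣ} (h : f.interactionDigraph.Arc j i s) :
    ∃ x : V → Bool, x j = false ∧ f x i ≠ f (Function.update x j true) i := by
  obtain ⟨x, hx, ⟨-, h⟩ | ⟨-, h⟩⟩ := h
  exacts [⟨x, hx, h.ne⟩, ⟨x, hx, h.ne'⟩]

/-- If every component depends on one component only, the complement commutes with the network. -/
theorem apply_compl [Fintype V] (h : ∃ s, f.interactionDigraph.Arc j i s)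
    (huniq : ∀ j' s, f.interactionDigraph.Arc j' i s → j' = j) (x : V → Bool) :
    f (fun v => !x v) i = !f x i := by
  obtain ⟨s, hs⟩ := h
  obtain ⟨z, hz, hne⟩ := exists_apply_ne hs
  have h0 : ∀ x : V → Bool, x j = false → f x i = f z i := fun x hx =>
    apply_eq_of_agree fun j' s hs => by rw [huniq j' s hs, hx, hz]
  have h1 : ∀ x : V → Bool, x j = true → f x i = f (Function.update z j true) i := fun x hx =>
    apply_eq_of_agree fun j' s hs => by rw [huniq j' s hs, hx, Function.update_self]
  cases hx : x j
  · rw [h0 x hx, h1 _ (by simp [hx])]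
    exact (Bool.eq_not_of_ne hne.symm)
  · rw [h1 x hx, h0 _ (by simp [hx])]
    exact (Bool.eq_not_of_ne hne)

theorem run_compl (h : ∀ x : V → Bool, f (fun v => !x v) = fun v => !f x v) (w : List V) :
    ∀ x : V → Bool, f.run w (fun v => !x v) = fun v => !f.run w x v := by
  induction w with
  | nil => exact fun x => rfl
  | cons i w ih =>
    intro x
    rw [AndNet.run_cons, AndNet.run_cons, ← ih]
    congr 1
    funext v
    by_cases hv : v = i
    · subst hv
      rw [AndNet.updateAt_self, AndNet.updateAt_self, h]
    · rw [AndNet.updateAt_of_ne hv, AndNet.updateAt_of_ne hv]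

end BooleanNetwork

/-! ### Cycles of signed digraphs -/

namespace SignedDigraph

open BooleanNetwork

variable {V : Type*} {G : SignedDigraph V}

theorem StronglyConnected.exists_arc (h : G.StronglyConnected) (X : Set V) (hX : X.Nonempty)
    (hX' : X ≠ Set.univ) : ∃ u ∈ X, ∃ v ∉ X, ∃ s, G.Arc u v s := by
  obtain ⟨u, hu⟩ := hX
  obtain ⟨w, hw⟩ := (Set.ne_univ_iff_exists_notMem X).1 hX'
  by_contra! hcon
  have key : ∀ w, Relation.ReflTransGen G.underlying.Adj u w → w ∈ X := by
    intro w hw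
    induction hw with
    | refl => exact hu
    | tail _ hab ih =>
      by_contra hb
      obtain ⟨s, hs⟩ := hab
      exact hcon _ ih _ hb s hs
  exact hw (key w (h u w))

theorem IsCycle.exists_pred (h : G.IsCycle) :
    Nonempty V ∧ ∃ (g : V → V) (σ : V → ℤˣ), ∀ j i s, G.Arc j i s ↔ j = g i ∧ s = σ i := by
  obtain ⟨C, hsurj, harc⟩ := h
  refine ⟨⟨C.vertex 0⟩, ?_⟩
  choose t ht using hsurj
  refine ⟨fun i => C.vertex (t i - 1), fun i => C.arcSign (t i - 1), fun j i s => ⟨?_, ?_⟩⟩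
  · intro hji
    obtain ⟨r, rfl, rfl, rfl⟩ := harc j i s hji
    have := C.vertex_injective (ht (C.vertex (r + 1)))
    simp only [this, add_sub_cancel_right, and_self]
  · rintro ⟨rfl, rfl⟩
    have := C.arc (t i - 1)
    rwa [sub_add_cancel, ht] at this

variable [DecidableEq V]

/-- A map from a finite set to itself has a cyclic orbit. -/
theorem exists_orbit (g : V → V) (S : Finset V) (hS : S.Nonempty) (hg : ∀ v ∈ S, g v ∈ S) :
    ∃ (m : ℕ) (vertex : Fin (m + 1) → V), Function.Injective vertex ∧ (∀ t, vertex t ∈ S) ∧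
      ∀ t, g (vertex (t + 1)) = vertex t := by
  let N : AndNet V := ⟨fun u v => u = g v, fun _ _ => true⟩
  obtain ⟨C, hC, -⟩ := AndNet.exists_mem_rings (N := N) (D := S) subset_rfl hS
    fun v _ u hu _ => hu
  obtain ⟨hCS, hne, hp, hmin⟩ := AndNet.mem_rings.1 hC
  have hgC : ∀ a ∈ C, g a ∈ C := fun a ha => hp a ha (g a) (hg a (hCS ha)) rfl
  have hR : N.IsRing C := by
    refine ⟨hne, fun a ha => ⟨g a, ⟨hgC a ha, rfl⟩, fun u hu => hu.2⟩, fun T hT hTne hTp => ?_⟩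
    exact hmin T hT hTne fun v hv u _ he => hTp v hv u (he ▸ hgC v (hT hv)) he
  obtain ⟨b, hb⟩ := hne
  obtain ⟨s, -, hs⟩ := hR.exists_enum hb
  have hpos := Finset.card_pos.2 ⟨b, hb⟩
  obtain ⟨m, hm⟩ : ∃ m, C.card = m + 1 := ⟨C.card - 1, by omega⟩
  have hpred : ∀ t, g (s (t + 1)) = s t := fun t => ((hs.pred t _ (hs.mem t)).2 rfl).symm
  refine ⟨m, fun t => s t, fun t t' h => ?_, fun t => hCS (hs.mem t), fun t => ?_⟩
  · exact Fin.ext (hs.inj (by omega) (by omega) h)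
  · rcases Fin.eq_castSucc_or_eq_last t with ⟨t', rfl⟩ | rfl
    · rw [Fin.coeSucc_eq_succ]
      exact hpred t'
    · have h0 : s 0 = s (m + 1) := by rw [← hm, ← hs.period 0, zero_add]
      simp only [Fin.last_add_one, Fin.val_zero, Fin.val_last, h0]
      exact hpred m

/-- The sign of a Boolean value. -/
def boolSign (b : Bool) : ℤˣ := if b then 1 else -1

theorem boolSign_mul_self (b : Bool) : boolSign b * boolSign b = 1 := by
  cases b <;> decide

theorem eq_boolSign_mul {s : ℤˣ} {b c : Bool} (h1 : s = 1 → b = c) (h2 : s = -1 → b ≠ c) :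
    s = boolSign b * boolSign c := by
  rcases Int.units_eq_one_or s with rfl | rfl
  · rw [h1 rfl, boolSign_mul_self]
  · have := h2 rfl
    cases b <;> cases c <;> simp_all [boolSign]

/-- Without positive cycles, in every state every nonempty set has a vertex without incoming arc
of the set whose sign is the product of the signs of the values. -/
theorem NoPositiveCycles.exists_vertex (h : G.NoPositiveCycles) (x : V → Bool) (S : Finset V)
    (hS : S.Nonempty) :
    ∃ v ∈ S, ∀ u ∈ S, ¬ G.Arc u v (boolSign (x u) * boolSign (x v)) := by
  by_contra! hcon
  choose! g hg hgarc using hcon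
  obtain ⟨m, vertex, hinj, hmem, hpred⟩ := exists_orbit g S hS hg
  let C : G.Cycle := ⟨m, vertex, fun t => boolSign (x (vertex t)) * boolSign (x (vertex (t + 1))),
    hinj, fun t => by
      have := hgarc (vertex (t + 1)) (hmem _)
      rwa [hpred] at this⟩
  refine h C ?_
  -- Around the cycle each vertex contributes its sign twice, so the cycle is positive.
  have h1 : ∏ t, boolSign (x (vertex (t + 1))) = ∏ t, boolSign (x (vertex t)) :=
    Fintype.prod_equiv (Equiv.addRight (1 : Fin (m + 1))) _ _ fun t => rfl
  calc C.sign = ∏ t, boolSign (x (vertex t)) * boolSign (x (vertex (t + 1))) := rfl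
    _ = ∏ t, boolSign (x (vertex t)) * boolSign (x (vertex t)) := by
      rw [Finset.prod_mul_distrib, h1, ← Finset.prod_mul_distrib]
    _ = 1 := Finset.prod_eq_one fun t _ => boolSign_mul_self _

/-- A cyclic orbit of the predecessor map is closed under in-neighbors, so strong connectivity makes
it contain all vertices. -/
theorem isCycle_of_existsUnique [Fintype V] [Nonempty V] (hconn : G.StronglyConnected)
    (hs : ∀ j i s s', G.Arc j i s → G.Arc j i s' → s = s')
    (h : ∀ i, ∃! j, ∃ s, G.Arc j i s) : G.IsCycle := by
  choose g hg hguniq using h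
  choose σ hσ using hg
  obtain ⟨m, vertex, hinj, -, hpred⟩ := exists_orbit g Finset.univ Finset.univ_nonempty
    fun v _ => Finset.mem_univ _
  have hsurj : Function.Surjective vertex := by
    rw [← Set.range_eq_univ]
    by_contra hne
    obtain ⟨u, hu, v, hv, s, hus⟩ := hconn.exists_arc (Set.range vertex)ᶜ
      (Set.nonempty_compl.2 hne) (by
        rw [Ne, Set.compl_univ_iff]
        exact (Set.range_nonempty vertex).ne_empty)
    rw [Set.notMem_compl_iff] at hv
    obtain ⟨t, rfl⟩ := hv
    refine hu ⟨t - 1, ?_⟩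
    have := hpred (t - 1)
    rw [sub_add_cancel] at this
    rw [← this]
    exact (hguniq _ u ⟨s, hus⟩).symm
  refine ⟨⟨m, vertex, fun t => σ (vertex (t + 1)), hinj, fun t => ?_⟩, hsurj, fun j i s hji => ?_⟩
  · have := hσ (vertex (t + 1))
    rwa [hpred] at this
  · obtain ⟨t, rfl⟩ := hsurj i
    have h1 : j = g (vertex t) := hguniq _ j ⟨s, hji⟩
    have h2 := hpred (t - 1)
    rw [sub_add_cancel] at h2
    refine ⟨t - 1, ?_, ?_, ?_⟩
    · rw [h1, h2]
    · rw [sub_add_cancel]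
    · simp only [sub_add_cancel]
      exact hs j _ _ _ (h1 ▸ hσ (vertex t)) hji

theorem IsCycle.not_isSynchronizing [Fintype V] (h : G.IsCycle) {f : BooleanNetwork V}
    (hf : f.IsOn G) : ¬ f.IsSynchronizing := by
  obtain ⟨⟨v⟩, g, σ, hg⟩ := h.exists_pred
  rw [← show f.interactionDigraph = G from hf] at hg
  rintro ⟨w, c, hc⟩
  have h1 := run_compl (f := f) (fun x => by
    funext i
    exact apply_compl ⟨σ i, (hg (g i) i _).2 ⟨rfl, rfl⟩⟩ (fun j s hs => ((hg j i s).1 hs).1) x)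
    w c
  rw [hc, hc] at h1
  have := congrFun h1 v
  simp at this

/-- Needed so that the second statement of the theorem does not hold vacuously for a cycle. -/
theorem IsCycle.exists_isAndOrNet (h : G.IsCycle) :
    ∃ f : BooleanNetwork V, f.IsOn G ∧ f.IsAndOrNet := by
  obtain ⟨-, g, σ, hg⟩ := h.exists_pred
  let f : BooleanNetwork V := fun x i => decide ((x (g i) = true) ↔ (σ i = 1))
  have hne : (-1 : ℤˣ) ≠ 1 := by decide
  have hon : f.interactionDigraph = G := by
    ext j i s
    rw [hg]
    constructor
    · rintro ⟨x, hx, h⟩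
      have hj : j = g i := by
        by_contra hne
        have : f (Function.update x j true) i = f x i := by
          simp only [f]
          rw [Function.update_of_ne (Ne.symm hne)]
        rw [this] at h
        simp at h
      subst hj
      refine ⟨rfl, ?_⟩
      rcases Int.units_eq_one_or (σ i) with hσ | hσ <;>
        rcases h with ⟨rfl, h⟩ | ⟨rfl, h⟩ <;> simp [f, hx, hσ, hne, Bool.lt_iff] at h ⊢
    · rintro ⟨rfl, rfl⟩
      refine ⟨fun _ => false, rfl, ?_⟩
      rcases Int.units_eq_one_or (σ i) with hσ | hσ <;> simp [f, hσ, hne]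
  refine ⟨f, hon, fun i => ⟨true, fun x => ?_⟩⟩
  rw [hon]
  simp only [hg]
  rcases Int.units_eq_one_or (σ i) with hσ | hσ
  · simp [f, hσ]
  · simp [f, hσ, hne]

end SignedDigraph

/-! ### Switching and-or-nets to conjunctive networks -/

namespace BooleanNetwork

open SignedDigraph

variable {V : Type*} [DecidableEq V] {f : BooleanNetwork V}

/-- Two arcs of opposite signs from `j` to `i` would impose contradictory conditions on `j`, and the
component `i` would be constant. -/
theorem IsAndOrNet.sign_unique (hf : f.IsAndOrNet) {j i : V} {s s' : ℤˣ}
    (h : f.interactionDigraph.Arc j i s) (h' : f.interactionDigraph.Arc j i s') : s = s' := by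
  have key : ¬ (f.interactionDigraph.Arc j i 1 ∧ f.interactionDigraph.Arc j i (-1)) := by
    rintro ⟨h1, h2⟩
    obtain ⟨a, ha⟩ := hf i
    have hconst : ∀ x : V → Bool, f x i = !a := fun x => by
      refine Bool.eq_not_of_ne fun hx => ?_
      obtain ⟨h3, h4⟩ := (ha x).1 hx
      exact h4 j h2 (h3 j h1)
    obtain ⟨x, -, hx⟩ := exists_apply_ne h1
    exact hx (by rw [hconst, hconst])
  rcases Int.units_eq_one_or s with rfl | rfl <;> rcases Int.units_eq_one_or s' with rfl | rfl
  exacts [rfl, absurd ⟨h, h'⟩ key, absurd ⟨h', h⟩ key, rfl]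

open Classical in
/-- The conjunctive network obtained from an and-or-net by switching. -/
noncomputable def toAndNet (f : BooleanNetwork V) (a : V → Bool) : AndNet V where
  E j i := ∃ s, f.interactionDigraph.Arc j i s
  p j i := decide ((f.interactionDigraph.Arc j i 1) ↔ a i = a j)

theorem toAndNet_lit (hf : f.IsAndOrNet) (a x : V → Bool) {j i : V} {s : ℤˣ}
    (hs : f.interactionDigraph.Arc j i s) :
    (x j == a j) = (f.toAndNet a).p j i ↔ (s = 1 ∧ x j = a i ∨ s = -1 ∧ x j ≠ a i) := by
  have hne : (-1 : ℤˣ) ≠ 1 := by decide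
  rcases Int.units_eq_one_or s with rfl | rfl
  · simp only [toAndNet, hs, true_iff, hne.symm, false_and, or_false, true_and]
    cases x j <;> cases a j <;> cases a i <;> simp
  · have : ¬ f.interactionDigraph.Arc j i 1 := fun h => hne (hf.sign_unique hs h)
    simp only [toAndNet, this, false_iff, hne, false_and, false_or, true_and]
    cases x j <;> cases a j <;> cases a i <;> simp

theorem toAndNet_net (hf : f.IsAndOrNet) {a : V → Bool}
    (ha : ∀ i, ∀ x : V → Bool, f x i = a i ↔ (∀ j, f.interactionDigraph.Arc j i 1 → x j = a i) ∧
      (∀ j, f.interactionDigraph.Arc j i (-1) → x j ≠ a i)) (x : V → Bool) (i : V) :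
    (f.toAndNet a).net (fun v => x v == a v) i = (f x i == a i) := by
  have hne : (-1 : ℤˣ) ≠ 1 := by decide
  rw [Bool.eq_iff_iff, AndNet.net_eq_true, beq_iff_eq, ha]
  constructor
  · refine fun h => ⟨fun j hj => ?_, fun j hj => ?_⟩
    · have := (toAndNet_lit hf a x hj).1 (h j ⟨_, hj⟩)
      simpa [hne.symm] using this
    · have := (toAndNet_lit hf a x hj).1 (h j ⟨_, hj⟩)
      simpa [hne] using this
  · rintro ⟨h1, h2⟩ j ⟨s, hs⟩
    rw [toAndNet_lit hf a x hs]
    rcases Int.units_eq_one_or s with rfl | rfl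
    · exact Or.inl ⟨rfl, h1 j hs⟩
    · exact Or.inr ⟨rfl, h2 j hs⟩

theorem toAndNet_run (hf : f.IsAndOrNet) {a : V → Bool}
    (ha : ∀ i, ∀ x : V → Bool, f x i = a i ↔ (∀ j, f.interactionDigraph.Arc j i 1 → x j = a i) ∧
      (∀ j, f.interactionDigraph.Arc j i (-1) → x j ≠ a i)) (w : List V) : ∀ x : V → Bool,
    (f.toAndNet a).net.run w (fun v => x v == a v) = fun v => f.run w x v == a v := by
  induction w with
  | nil => exact fun x => rfl
  | cons i w ih =>
    intro x
    rw [AndNet.run_cons, AndNet.run_cons, ← ih]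
    congr 1
    funext v
    by_cases hv : v = i
    · subst hv
      rw [AndNet.updateAt_self, AndNet.updateAt_self, toAndNet_net hf ha]
    · rw [AndNet.updateAt_of_ne hv, AndNet.updateAt_of_ne hv]

/-- An arc is consistent after switching exactly when its sign is the product of the signs of the
original values of its ends. -/
theorem toAndNet_NPC (hf : f.IsAndOrNet) (a : V → Bool)
    (hpos : f.interactionDigraph.NoPositiveCycles) : (f.toAndNet a).NPC := by
  intro x S hS
  obtain ⟨v, hv, h⟩ := hpos.exists_vertex (fun v => x v == a v) S hS
  refine ⟨v, hv, ?_⟩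
  rintro ⟨u, hu, ⟨s, hs⟩, hc⟩
  have h1 := toAndNet_lit hf a (fun v => x v == a v) hs
  have h2 : ((x u == a u) == a u) = x u := by cases x u <;> cases a u <;> rfl
  rw [h2] at h1
  rw [AndNet.Cons, h1] at hc
  refine h u hu ?_
  rw [← eq_boolSign_mul (s := s)]
  · exact hs
  · rintro rfl
    have hne : (1 : ℤˣ) ≠ -1 := by decide
    simp only [hne, true_and, false_and, or_false] at hc
    revert hc
    cases x u <;> cases a u <;> cases x v <;> cases a v <;> simp
  · rintro rfl
    have hne : (-1 : ℤˣ) ≠ 1 := by decide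
    simp only [hne, true_and, false_and, false_or] at hc
    revert hc
    cases x u <;> cases a u <;> cases x v <;> cases a v <;> simp

theorem IsAndOrNet.exists_synchronizingWord [Fintype V] [Nonempty V] (hf : f.IsAndOrNet)
    (hconn : f.interactionDigraph.StronglyConnected)
    (hpos : f.interactionDigraph.NoPositiveCycles) (hcyc : ¬ f.interactionDigraph.IsCycle) :
    ∃ w : List V, f.IsSynchronizingWord w ∧
      w.length ≤ 2 ^ Fintype.card V * AndNet.mergeCost (Fintype.card V) := by
  choose a ha using fun i => hf i
  obtain ⟨w, ⟨c, hc⟩, hwl⟩ := AndNet.exists_synchronizingWord (N := f.toAndNet a)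
    (toAndNet_NPC hf a hpos) (fun X hX hX' => hconn.exists_arc X hX hX')
    (fun h => hcyc (isCycle_of_existsUnique hconn (fun j i s s' => hf.sign_unique) h))
  refine ⟨w, ⟨fun v => c v == a v, fun x => ?_⟩, hwl⟩
  have h1 := toAndNet_run hf ha w x
  rw [hc] at h1
  funext v
  simp only [h1]
  cases f.run w x v <;> cases a v <;> rfl

end BooleanNetwork

theorem theorem1 (n : ℕ) (G : SignedDigraph (Fin n))
    (hconn : G.StronglyConnected) (hpos : G.NoPositiveCycles) :
    Xor (G.IsCycle ∧ ∀ f : BooleanNetwork (Fin n), f.IsOn G → ¬ f.IsSynchronizing)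
      (∀ f : BooleanNetwork (Fin n), f.IsOn G → f.IsAndOrNet →
        ∃ w : List (Fin n), f.IsSynchronizingWord w ∧
          (w.length : ℝ) ≤ 10 * (Real.sqrt 5 + 1) ^ n) := by
  by_cases hcyc : G.IsCycle
  · refine Or.inl ⟨⟨hcyc, fun f hf => hcyc.not_isSynchronizing hf⟩, fun h => ?_⟩
    obtain ⟨f, hf, hf'⟩ := hcyc.exists_isAndOrNet
    obtain ⟨w, hw, -⟩ := h f hf hf'
    exact hcyc.not_isSynchronizing hf ⟨w, hw⟩
  · refine Or.inr ⟨fun f hf hf' => ?_, fun h => hcyc h.1⟩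
    obtain rfl : f.interactionDigraph = G := hf
    rcases Nat.eq_zero_or_pos n with rfl | hn
    -- The empty graph is not a cycle, as a cycle has at least one vertex; it has a single state, so
    -- the empty word synchronizes.
    · exact ⟨[], ⟨fun _ => false, fun x => Subsingleton.elim _ _⟩, by simp⟩
    · have : Nonempty (Fin n) := ⟨⟨0, hn⟩⟩
      obtain ⟨w, hw, hwl⟩ := hf'.exists_synchronizingWord hconn hpos hcyc
      rw [Fintype.card_fin] at hwl
      have h1 : w.length ≤ 2 ^ n * (2 * Nat.fib (n + 5)) :=
        hwl.trans (Nat.mul_le_mul_left _ (AndNet.mergeCost_le n))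
      refine ⟨w, hw, le_trans ?_ (AndNet.two_mul_fib_le n)⟩
      exact_mod_cast h1
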